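/- Let $\mathcal B(1)\subset\mathbb R^d$, $d\ge 1$, be the closed Euclidean unit ball (diameter $D=2$), let $\alpha,G>0$, and let $F(\mathbf x)=\mathbb E_{\xi\sim P}[f(\mathbf x;\xi)]$ for an unknown probability distribution $P$, where for every $\xi$ the function $f(\cdot;\xi)$ is $\alpha$-exp-concave ($e^{-\alpha f(\cdot;\xi)}$ is concave), differentiable and $G$-Lipschitz ($\|\nabla f(\cdot;\xi)\|_2\le G$) on $\mathcal B(1)$. In round $t$ a stochastic gradient oracle answers the query $\mathbf x_t$ with $\nabla f(\mathbf x_t;\xi_t)$, where $\xi_1,\xi_2,\dots$ are i.i.d. with law $P$. Put $\gamma_0=\frac12\min\{\frac1{DG},\alpha\}$. **LightONS** with preconditioner coefficient $\lambda>0$ and hysteresis coefficient $k\in(1,3]$: start with $A_0=\lambda I$, $\mathbf y_1=\mathbf 0$. In round $t=1,2,\dots$ let $\mathbf x_t$ be the Euclidean projection of $\mathbf y_t$ onto $\mathcal B(1)$, query the oracle once to get $\mathbf g_t=\nabla f(\mathbf x_t;\xi_t)$, and put $$\mathbf h_t=\mathbf g_t+\frac{[-\mathbf g_t^\top(\mathbf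 y_t-\mathbf x_t)]_+}{\|\mathbf y_t-\mathbf x_t\|_2^2}(\mathbf y_t-\mathbf x_t)\quad(\mathbf h_t=\mathbf g_t\text{ if }\mathbf y_t=\mathbf x_t),\qquad A_t=A_{t-1}+\mathbf h_t\mathbf h_t^\top,\qquad \hat{\mathbf y}_{t+1}=\mathbf y_t-\tfrac1{\gamma'}A_t^{-1}\mathbf h_t,$$ where $\gamma'=\frac12\min\{\frac1{DG},\frac4{(k+1)DG},\alpha\}=\gamma_0$. If $\|\hat{\mathbf y}_{t+1}\|_2\le k$ then $\mathbf y_{t+1}=\hat{\mathbf y}_{t+1}$; otherwise $\mathbf y_{t+1}$ is the projection of $\hat{\mathbf y}_{t+1}$ onto $\mathcal B(1)$ in the norm $\mathbf v\mapsto(\mathbf v^\top A_t\mathbf v)^{1/2}$. This projection is either exact, or computed approximately by *FastProj*. For a point $\mathbf u$ outside $\mathcal B(1)$, a tolerance $\zeta$ and an eigenvalue range $[\underline\lambda,\overline\lambda]$ of $A$, FastProj makes $\lceil\log_2(\frac1\zeta(\overline\lambda/\underline\lambda-1)\|\mathbf u\|_2(\|\mathbf u\|_2-1))\rceil$ (or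 $0$, if this is negative or the argument of the logarithm is $0$) bisection steps for the root of $\mu\mapsto\|(A+\mu I)^{-1}A\mathbf u\|_2^2-1$, starting from the bracket $[(\|\mathbf u\|_2-1)\underline\lambda,(\|\mathbf u\|_2-1)\overline\lambda]$, and returns $\tilde{\mathbf v}/\|\tilde{\mathbf v}\|_2$ with $\tilde{\mathbf v}=(A+\mu I)^{-1}A\mathbf u$ at the midpoint $\mu$ of the last bracket. In round $t$ it is used with $\underline\lambda=\lambda$, $\overline\lambda=\lambda+G^2t$ and $$\zeta_t=\min\Big\{\frac{\gamma'}{2kD(G^2t+\lambda)t^2},\ \frac1t\sqrt{\frac{\gamma'}{2(G^2t+\lambda)t}}\Big\}.$$ Let $\bar{\mathbf x}_T=\frac1T\sum_{t=1}^T\mathbf x_t$, let $\mathrm{Reg}_T=\sum_{t=1}^Tf(\mathbf x_t;\xi_t)-\min_{\mathbf u\in\mathcal B(1)}\sum_{t=1}^Tf(\mathbf u;\xi_t)$, and $$\mathcal R_{T,\delta}=\frac1T\Big(\mathrm{Reg}_T+4\sqrt{\tfrac{\mathrm{Reg}_T}{2\gamma_0}\log\tfrac{4\log T}\delta}+\tfrac8{\gamma_0}\log\tfrac{4\log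 T}\delta\Big),$$ where the square root of a negative number is read as $0$. The *runtime* is the number of elementary operations (arithmetic operations, square roots, comparisons, stores, loop passes, and $d$ operations per oracle query) that a fixed explicit program performs in exact real arithmetic. The program maintains $A_t^{-1}$ by rank-one updates and projects by FastProj with Gauss–Jordan inversion ($O(d^3)$ operations per matrix inverse). **Theorem.** Fix $\alpha,G>0$ and $k\in(1,3]$. 1. The program computes exactly the averaged iterate $\bar{\mathbf x}_T$ of LightONS with FastProj. 2. For all $\lambda>0$, $T\ge3$, $\delta\in(0,1)$, with exact projections always $$\mathrm{Reg}_T\le\frac d{2\gamma_0}\log\Big(1+\frac{G^2}{d\lambda}T\Big)+\frac{\gamma_0\lambda D^2}8,$$ and with FastProj the same bound holds up to an additive constant that depends only on $\alpha,G,k$. For both versions, with probability at least $1-\delta$, $F(\bar{\mathbf x}_T)-\min_{\mathcal B(1)}F\le\mathcal R_{T,\delta}$. From here on let $\lambda=d\log T$. Fix $r_0>1$, $\delta_0\in(0,1)$ and the two constants implied by $\Theta$. The constants implied by $O$ and $\tilde O$ depend only on these and on $\alpha,G,k$; the target accuracy $\varepsilon>0$ is such that $d/\varepsilon\ge r_0$;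 $\tilde O$ hides a fixed power of $\log(d/\varepsilon)$, whose exponent depends only on $\alpha,G,k$. 3. For $\delta\in(0,\delta_0]$ and $3\le T=\Theta(\frac d\varepsilon\log\frac d\varepsilon\log\frac1\delta)$, for both versions, with probability at least $1-\delta$, $$F(\bar{\mathbf x}_T)-\min_{\mathcal B(1)}F\le\mathcal R_{T,\delta}\quad\text{and}\quad\mathcal R_{T,\delta}=O(\varepsilon).$$ The runtime is always $O\big(\frac{d^3}\varepsilon\log\frac d\varepsilon\log\frac1\delta+\frac{d^{3.5}}{\sqrt\varepsilon}\log\frac d\varepsilon\log\frac1\delta\big)$, and it is $\tilde O(\frac{d^3}\varepsilon)\cdot\log\frac1\delta$. 4. For $3\le T'=\Theta(\frac d\varepsilon\log\frac d\varepsilon)$ (the choice $1/\delta=T'$), for both versions, $\mathbb E[F(\bar{\mathbf x}_{T'})-\min_{\mathcal B(1)}F]=O(\varepsilon)$. The runtime is always $O\big(\frac{d^3}\varepsilon\log\frac d\varepsilon+\frac{d^{3.5}}{\sqrt\varepsilon}\log\frac d\varepsilon\big)$, and it is $\tilde O(\frac{d^3}\varepsilon)$. This answers part (b) of Koren's COLT'13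 open problem, which asks for a runtime better than $\tilde O(d^4/\varepsilon)$. -/

import Mathlib

noncomputable section

open MeasureTheory ProbabilityTheory

namespace SXO

/-! ### The stochastic exp-concave optimization problem over the unit ball -/

/-- The Euclidean space of dimension `d`. -/
abbrev E (d : ℕ) : Type := EuclideanSpace ℝ (Fin d)

/-- Real square matrices of size `d`. -/
abbrev Mat (d : ℕ) : Type := Matrix (Fin d) (Fin d) ℝ

/-- The domain: the closed Euclidean unit ball (its diameter is `2`). -/
def domain (d : ℕ) : Set (E d) := Metric.closedBall 0 1

/-- `φ` is `α`-exp-concave on `X`: the function `exp (-α φ)` is concave on `X`. -/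
def ExpConcaveOn {d : ℕ} (α : ℝ) (X : Set (E d)) (φ : E d → ℝ) : Prop :=
  ConcaveOn ℝ X (fun x => Real.exp (-α * φ x))

/-- The gradient at `x` of the sample loss `f (·; z)`, a function on the domain
(so the derivative is taken within the domain). -/
def lossGrad {d : ℕ} {Ξ : Type*} (f : E d → Ξ → ℝ) (z : Ξ) (x : E d) : E d :=
  gradientWithin (fun x' => f x' z) (domain d) x

/-- The assumptions on the random loss `f (x; z)`, `z ∼ P`: every sample loss is `α`-exp-concave,
differentiable and `G`-Lipschitz (gradient norm at most `G`) on the domain.  The last three fields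
say that losses and oracle answers are random variables and that the expected loss exists. -/
structure IsStochasticLoss {d : ℕ} {Ξ : Type*} [MeasurableSpace Ξ] (α G : ℝ) (P : Measure Ξ)
    (f : E d → Ξ → ℝ) : Prop where
  expConcave : ∀ z, ExpConcaveOn α (domain d) (fun x => f x z)
  differentiable : ∀ z, DifferentiableOn ℝ (fun x => f x z) (domain d)
  lipschitz : ∀ z, ∀ x ∈ domain d, ‖lossGrad f z x‖ ≤ G
  measurable_loss : ∀ x ∈ domain d, Measurable (f x)
  measurable_grad : Measurable (fun q : domain d × Ξ => lossGrad f q.2 (q.1 : E d))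
  integrable_loss : ∀ x ∈ domain d, Integrable (f x) P

/-- `ξ 0, ξ 1, …` are independent samples with common law `P`. -/
structure IsIIDSample {Ξ Ω : Type*} [MeasurableSpace Ξ] [MeasurableSpace Ω] (P : Measure Ξ)
    (μ : Measure Ω) (ξ : ℕ → Ω → Ξ) : Prop where
  measurable : ∀ t, Measurable (ξ t)
  indep : iIndepFun ξ μ
  law : ∀ t, μ.map (ξ t) = P

/-- The expected loss `F`. -/
def risk {d : ℕ} {Ξ : Type*} [MeasurableSpace Ξ] (P : Measure Ξ) (f : E d → Ξ → ℝ)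
    (x : E d) : ℝ := ∫ z, f x z ∂P

/-- The excess risk `F x - min F`, the minimum over the domain. -/
def excessRisk {d : ℕ} {Ξ : Type*} [MeasurableSpace Ξ] (P : Measure Ξ) (f : E d → Ξ → ℝ)
    (x : E d) : ℝ := risk P f x - sInf (risk P f '' domain d)

/-- The regret of the decisions `x 0, …, x (T - 1)` on the sample losses `f (·; z t)` against the
best fixed decision of the domain. -/
def regret {d : ℕ} {Ξ : Type*} (f : E d → Ξ → ℝ) (z : ℕ → Ξ) (x : ℕ → E d) (T : ℕ) : ℝ :=
  ∑ t ∈ Finset.range T, f (x t) (z t)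
    - sInf ((fun u => ∑ t ∈ Finset.range T, f u (z t)) '' domain d)

/-- The stochastic gradient oracle: its answer to the query `x` in round `t` is `∇ f (x; z t)`. -/
def oracle {d : ℕ} {Ξ : Type*} (f : E d → Ξ → ℝ) (z : ℕ → Ξ) : ℕ → E d → E d :=
  fun t x => lossGrad f (z t) x

/-! ### Projections -/

/-- The squared Mahalanobis norm `vᵀ A v`. -/
def mahaSq {d : ℕ} (A : Mat d) (v : E d) : ℝ := v.ofLp ⬝ᵥ (A.mulVec v.ofLp)

/-- `x` minimizes the Mahalanobis distance to `y` over `X`. -/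
def IsMahaProj {d : ℕ} (A : Mat d) (X : Set (E d)) (y x : E d) : Prop :=
  x ∈ X ∧ ∀ z ∈ X, mahaSq A (x - y) ≤ mahaSq A (z - y)

/-- The Mahalanobis projection of `y` onto `X`. -/
def mahaProj {d : ℕ} (A : Mat d) (X : Set (E d)) (y : E d) : E d :=
  Classical.epsilon (IsMahaProj A X y)

/-- The Euclidean projection of `y` onto `X`. -/
def euclProj {d : ℕ} (X : Set (E d)) (y : E d) : E d := mahaProj 1 X y

/-- The matrix-vector product on Euclidean space. -/
def mulE {d : ℕ} (A : Mat d) (v : E d) : E d := WithLp.toLp 2 (A.mulVec v.ofLp)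

/-- The point `(A + m I)⁻¹ A u`. -/
def shrink {d : ℕ} (A : Mat d) (u : E d) (m : ℝ) : E d :=
  mulE (A + m • (1 : Mat d))⁻¹ (mulE A u)

/-- One bisection step on the bracket `(a, b)` for the root of `m ↦ ‖(A + m I)⁻¹ A u‖² - R²`. -/
def bisectStep {d : ℕ} (A : Mat d) (u : E d) (R : ℝ) (q : ℝ × ℝ) : ℝ × ℝ :=
  open Classical in
  if 0 ≤ ‖shrink A u ((q.1 + q.2) / 2)‖ ^ 2 - R ^ 2 then ((q.1 + q.2) / 2, q.2)
  else (q.1, (q.1 + q.2) / 2)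

/-- The number of bisection steps, for a point of Euclidean norm `r`. -/
def bisectCount (r R ζ lo hi : ℝ) : ℕ :=
  ⌈Real.logb 2 (1 / ζ * (hi / lo - 1) * r * (r / R - 1))⌉₊

/-- FastProj: the approximate Mahalanobis projection of `u` onto the ball of radius `R`, with
tolerance `ζ`, when the eigenvalues of `A` lie in `[lo, hi]`. -/
def fastProj {d : ℕ} (A : Mat d) (u : E d) (R ζ lo hi : ℝ) : E d :=
  let q := (bisectStep A u R)^[bisectCount ‖u‖ R ζ lo hi]
    ((‖u‖ / R - 1) * lo, (‖u‖ / R - 1) * hi)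
  let w := shrink A u ((q.1 + q.2) / 2)
  (R / ‖w‖) • w

/-! ### LightONS on the unit ball -/

/-- The curvature parameter `γ₀ = ½ min {1 / (D G), α}` with `D = 2`. -/
def gamma0 (α G : ℝ) : ℝ := 1 / 2 * min (1 / (2 * G)) α

/-- The curvature parameter `γ' = ½ min {1 / (D G), 4 / ((k + 1) D G), α}` with `D = 2`. -/
def gamma' (α G k : ℝ) : ℝ :=
  1 / 2 * min (min (1 / (2 * G)) (4 / ((k + 1) * (2 * G)))) α

/-- The surrogate gradient at `y`, where `x` is the projection of `y` onto the domain and `g` is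
the gradient of the loss at `x`.  It is `g` if `y = x`. -/
def surrogateGrad {d : ℕ} (g x y : E d) : E d :=
  g + (max 0 (-(inner ℝ g (y - x))) / ‖y - x‖ ^ 2) • (y - x)

/-- The state of LightONS: the matrix `A` and the surrogate decision `y`. -/
structure State (d : ℕ) where
  /-- the preconditioner -/
  A : Mat d
  /-- the surrogate decision -/
  y : E d

/-- A routine for the Mahalanobis projection onto the unit ball: it gets the number `t ≥ 1` of the
round, the matrix of the norm and the point. -/
abbrev ProjRoutine (d : ℕ) : Type := ℕ → Mat d → E d → E d

/-- The exact projection. -/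
def exactProj {d : ℕ} : ProjRoutine d := fun _ A u => mahaProj A (domain d) u

/-- The tolerance `ζ_t` of the approximate projection in round `t` (with `D = 2`), where `e` is the
preconditioner coefficient. -/
def tolerance (γ G e k : ℝ) (t : ℕ) : ℝ :=
  min (γ / (2 * k * 2 * (G ^ 2 * t + e) * (t : ℝ) ^ 2))
    (1 / t * √(γ / (2 * (G ^ 2 * t + e) * t)))

/-- The projection by bisection: in round `t` the eigenvalues of the matrix lie in
`[e, e + G² t]`. -/
def approxProj {d : ℕ} (γ G e k : ℝ) : ProjRoutine d := fun t A u =>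
  fastProj A u 1 (tolerance γ G e k t) e (e + G ^ 2 * t)

/-- One round of LightONS (round `t + 1` when rounds are counted from `1`) with curvature parameter
`γ`, hysteresis coefficient `k`, projection routine `proj` and gradient oracle `grad`. -/
def step {d : ℕ} (proj : ProjRoutine d) (γ k : ℝ) (grad : ℕ → E d → E d) (t : ℕ) (s : State d) :
    State d :=
  let x := euclProj (domain d) s.y
  let h := surrogateGrad (grad t x) x s.y
  let A' := s.A + Matrix.vecMulVec h.ofLp h.ofLp
  let yhat := s.y - (1 / γ) • mulE A'⁻¹ h
  open Classical in
  { A := A', y := if ‖yhat‖ ≤ k then yhat else proj (t + 1) A' yhat }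

/-- The state of LightONS after `t` rounds, with preconditioner coefficient `e`. -/
def state {d : ℕ} (proj : ProjRoutine d) (γ e k : ℝ) (grad : ℕ → E d → E d) : ℕ → State d
  | 0 => { A := e • (1 : Mat d), y := 0 }
  | t + 1 => step proj γ k grad t (state proj γ e k grad t)

/-- The decisions of LightONS; index `t` is round `t + 1` when rounds are counted from `1`. -/
def decision {d : ℕ} (proj : ProjRoutine d) (γ e k : ℝ) (grad : ℕ → E d → E d) (t : ℕ) : E d :=
  euclProj (domain d) (state proj γ e k grad t).y

/-- The average of the decisions of the first `T` rounds. -/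
def averaged {d : ℕ} (proj : ProjRoutine d) (γ e k : ℝ) (grad : ℕ → E d → E d) (T : ℕ) : E d :=
  (1 / (T : ℝ)) • ∑ t ∈ Finset.range T, decision proj γ e k grad t

/-! ### The cost model: exact real arithmetic, unit cost per operation -/

/-- A computation: its result and the number of elementary operations it performs. -/
structure Timed (β : Type) where
  /-- the result -/
  val : β
  /-- the number of elementary operations -/
  time : ℕ

instance : Monad Timed where
  pure b := ⟨b, 0⟩
  bind m g := ⟨(g m.val).val, m.time + (g m.val).time⟩

namespace Timed

/-- Addition. -/
def add (a b : ℝ) : Timed ℝ := ⟨a + b, 1⟩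

/-- Subtraction. -/
def sub (a b : ℝ) : Timed ℝ := ⟨a - b, 1⟩

/-- Multiplication. -/
def mul (a b : ℝ) : Timed ℝ := ⟨a * b, 1⟩

/-- Division. -/
def div (a b : ℝ) : Timed ℝ := ⟨a / b, 1⟩

/-- Square root. -/
def sqrt (a : ℝ) : Timed ℝ := ⟨√a, 1⟩

/-- The comparison `a ≤ b`. -/
def le (a b : ℝ) : Timed Bool := ⟨open Classical in decide (a ≤ b), 1⟩

/-- The least natural number `n` with `a ≤ 2 ^ n`, for `0 ≤ a`, found by repeated doubling: the cost is `n`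
doublings and `n + 1` comparisons. -/
def ceilLog2 (a : ℝ) : Timed ℕ := ⟨⌈Real.logb 2 a⌉₊, 2 * ⌈Real.logb 2 a⌉₊ + 1⟩

/-- Compute and store the entries of a vector; each store costs one operation. -/
def vec {n : ℕ} (g : Fin n → Timed ℝ) : Timed (Fin n → ℝ) :=
  ⟨fun i => (g i).val, ∑ i, ((g i).time + 1)⟩

/-- Compute and store the entries of a matrix; each store costs one operation. -/
def mat {n : ℕ} (g : Fin n → Fin n → Timed ℝ) : Timed (Mat n) :=
  ⟨Matrix.of fun i j => (g i j).val, ∑ i, ∑ j, ((g i j).time + 1)⟩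

/-- Compute and add up the terms of a sum; each addition costs one operation. -/
def sum {n : ℕ} (g : Fin n → Timed ℝ) : Timed ℝ :=
  ⟨∑ i, (g i).val, ∑ i, ((g i).time + 1)⟩

/-- The loop `for i = 0, …, n - 1`; every pass costs one operation on top of its body. -/
def loop {β : Type} (body : ℕ → β → Timed β) : ℕ → β → Timed β
  | 0, b => pure b
  | n + 1, b => do
    let c ← loop body n b
    let r ← body n c
    (⟨r, 1⟩ : Timed β)

/-- A query to the gradient oracle in round `t`; the answer is read at one operation per
coordinate. -/
def query {d : ℕ} (grad : ℕ → E d → E d) (t : ℕ) (x : Fin d → ℝ) : Timed (Fin d → ℝ) :=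
  ⟨(grad t (WithLp.toLp 2 x)).ofLp, d⟩

/-! ### LightONS as a program in this model -/

variable {d : ℕ}

/-- The dot product. -/
def dot (u v : Fin d → ℝ) : Timed ℝ := sum fun i => mul (u i) (v i)

/-- The Euclidean norm. -/
def norm (u : Fin d → ℝ) : Timed ℝ := do
  let s ← dot u u
  sqrt s

/-- The multiple of a vector by a scalar. -/
def smul (c : ℝ) (u : Fin d → ℝ) : Timed (Fin d → ℝ) := vec fun i => mul c (u i)

/-- The difference of two vectors. -/
def vsub (u v : Fin d → ℝ) : Timed (Fin d → ℝ) := vec fun i => sub (u i) (v i)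

/-- The sum of two vectors. -/
def vadd (u v : Fin d → ℝ) : Timed (Fin d → ℝ) := vec fun i => add (u i) (v i)

/-- The product of a matrix and a vector. -/
def mulVec (A : Mat d) (u : Fin d → ℝ) : Timed (Fin d → ℝ) :=
  vec fun i => sum fun j => mul (A i j) (u j)

/-- One Gauss-Jordan exchange step with pivot `p`: if `M` maps `x` to `y`, the result maps `x` with
entry `p` replaced by `y p` to `y` with entry `p` replaced by `x p`. -/
def pivot (p : Fin d) (M : Mat d) : Timed (Mat d) :=
  mat fun i j => do
    if i = p then
      if j = p then div 1 (M p p)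
      else
        let c ← div (M p j) (M p p)
        sub 0 c
    else
      let c ← div (M i p) (M p p)
      if j = p then pure c
      else
        let e ← mul c (M p j)
        sub (M i j) e

/-- The inverse of a positive definite matrix, by exchange steps with the pivots `0, …, d - 1`. -/
def inverse (M : Mat d) : Timed (Mat d) :=
  loop (fun p N => if hp : p < d then pivot ⟨p, hp⟩ N else pure N) d M

/-- The vector `(A + m I)⁻¹ p`. -/
def shiftedSolve (A : Mat d) (m : ℝ) (p : Fin d → ℝ) : Timed (Fin d → ℝ) := do
  let M ← mat fun i j => if i = j then add (A i j) m else pure (A i j)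
  let N ← inverse M
  mulVec N p

/-- FastProj as a program. -/
def fastProj (A : Mat d) (u : Fin d → ℝ) (R ζ lo hi : ℝ) : Timed (Fin d → ℝ) := do
  let p ← mulVec A u
  let RR ← mul R R
  let r ← norm u
  let r₁ ← div r R
  let r₂ ← sub r₁ 1
  let a ← mul r₂ lo
  let b ← mul r₂ hi
  let c₁ ← div 1 ζ
  let c₂ ← div hi lo
  let c₃ ← sub c₂ 1
  let c₄ ← mul c₁ c₃
  let c₅ ← mul c₄ r
  let c₆ ← mul c₅ r₂
  let n ← ceilLog2 c₆
  let q ← loop (fun _ (q : ℝ × ℝ) => do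
      let s ← add q.1 q.2
      let m ← div s 2
      let w ← shiftedSolve A m p
      let ww ← dot w w
      let big ← le RR ww
      if big then pure (m, q.2) else pure (q.1, m)) n (a, b)
  let s ← add q.1 q.2
  let m ← div s 2
  let w ← shiftedSolve A m p
  let l ← norm w
  let c ← div R l
  smul c w

/-- The tolerance `ζ_t` as a program. -/
def tolerance (γ G e k : ℝ) (t : ℕ) : Timed ℝ := do
  let g₁ ← mul G G
  let g₂ ← mul g₁ t
  let m ← add g₂ e
  let a₁ ← mul 2 k
  let a₂ ← mul a₁ 2
  let a₃ ← mul a₂ m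
  let tt ← mul t t
  let a₄ ← mul a₃ tt
  let a ← div γ a₄
  let b₁ ← mul 2 m
  let b₂ ← mul b₁ t
  let b₃ ← div γ b₂
  let b₄ ← sqrt b₃
  let b₅ ← div 1 t
  let b ← mul b₅ b₄
  let small ← le a b
  if small then pure a else pure b

/-- The memory of the program: the matrix `A`, its inverse `V`, the surrogate decision `y` and the
sum of the past decisions. -/
structure Memory (d : ℕ) where
  /-- the preconditioner -/
  A : Mat d
  /-- the inverse of the preconditioner -/
  V : Mat d
  /-- the surrogate decision -/
  y : Fin d → ℝ
  /-- the sum of the past decisions -/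
  total : Fin d → ℝ

/-- The initialization. -/
def start (e : ℝ) : Timed (Memory d) := do
  let A ← mat fun i j => if i = j then pure e else pure 0
  let c ← div 1 e
  let V ← mat fun i j => if i = j then pure c else pure 0
  let y ← vec fun _ => pure 0
  let total ← vec fun _ => pure 0
  pure ⟨A, V, y, total⟩

/-- The decision and the surrogate gradient: project `y` onto the unit ball, query the oracle
once, and correct the answer if `y` lies outside the ball. -/
def observe (grad : ℕ → E d → E d) (t : ℕ) (y : Fin d → ℝ) :
    Timed ((Fin d → ℝ) × (Fin d → ℝ)) := do
  let r ← norm y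
  let inside ← le r 1
  if inside then
    let g ← query grad t y
    pure (y, g)
  else
    let c ← div 1 r
    let x ← smul c y
    let g ← query grad t x
    let v ← vsub y x
    let gv ← dot g v
    let pos ← le 0 gv
    if pos then pure (x, g)
    else
      let n ← sub 0 gv
      let vv ← dot v v
      let q ← div n vv
      let w ← smul q v
      let h ← vadd g w
      pure (x, h)

/-- One round of the program; the inverse is maintained by rank-one updates. -/
def round (γ G e k : ℝ) (grad : ℕ → E d → E d) (t : ℕ) (s : Memory d) : Timed (Memory d) := do
  let (x, h) ← observe grad t s.y
  let total ← vadd s.total x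
  let A ← mat fun i j => do
    let c ← mul (h i) (h j)
    add (s.A i j) c
  let w ← mulVec s.V h
  let hw ← dot h w
  let den ← add 1 hw
  let V ← mat fun i j => do
    let c ← mul (w i) (w j)
    let q ← div c den
    sub (s.V i j) q
  let v ← mulVec V h
  let c ← div 1 γ
  let dir ← smul c v
  let yhat ← vsub s.y dir
  let r ← norm yhat
  let near ← le r k
  if near then pure ⟨A, V, yhat, total⟩
  else
    let ζ ← tolerance γ G e k (t + 1)
    let g₁ ← mul G G
    let g₂ ← mul g₁ ((t + 1 : ℕ) : ℝ)
    let hi ← add e g₂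
    let y ← fastProj A yhat 1 ζ e hi
    pure ⟨A, V, y, total⟩

/-- LightONS with projection by bisection, run for `T` rounds with one oracle query per round; the
program returns the average of its decisions. -/
def lightONS (γ G e k : ℝ) (grad : ℕ → E d → E d) (T : ℕ) : Timed (E d) := do
  let s₀ ← start e
  let s ← loop (round γ G e k grad) T s₀
  let c ← div 1 (T : ℝ)
  let xbar ← smul c s.total
  pure (WithLp.toLp 2 xbar)

end Timed

/-! ### The bounds -/

/-- The regret bound `d / (2 γ₀) log (1 + G² T / (d e)) + γ₀ e D² / 8` with `D = 2`, where `e` is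
the preconditioner coefficient. -/
def regretBound (α G e : ℝ) (d T : ℕ) : ℝ :=
  d / (2 * gamma0 α G) * Real.log (1 + G ^ 2 / (d * e) * T) + gamma0 α G * e * 2 ^ 2 / 8

/-- The bound on the excess risk in terms of the regret `r` of `T` rounds and the confidence
parameter `δ`. -/
def riskBound (α G δ : ℝ) (T : ℕ) (r : ℝ) : ℝ :=
  1 / T * (r + 4 * √(r / (2 * gamma0 α G) * Real.log (4 * Real.log T / δ))
    + 8 / gamma0 α G * Real.log (4 * Real.log T / δ))

end SXO

end

open MeasureTheory ProbabilityTheory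

namespace SXO

variable {d : ℕ}

/-! ### Matrices acting on Euclidean space -/

/-! Three arguments are combined: a regret bound, a conversion of regret into excess risk, and an
amortized count of projections.

Regret. Exp-concavity and the Lipschitz bound give `f x - f u ≤ a - γ/2 a²` with `a = ⟪g, x - u⟫`
(`IsStochasticLoss.le_loss`). The surrogate gradient `h` at `y` is no longer than `g` and satisfies
`a ≤ ⟪h, y - u⟫`. Since `s - γ/2 s²` increases up to `s = 1/γ`, and `‖y‖ ≤ k ≤ 3` keeps `⟪h, y - u⟫`
below that point, `a` may be replaced by `⟪h, y - u⟫`. The quadratic term then pays for the growth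
of the norm of `A`: the potential `(y - u)ᵀ A (y - u)` telescopes, and the leftover `hᵀ A⁻¹ h` is at
most an increment of `log det A` (`inner_roundGrad_le`, `log_det_state_le`). Exact projection does
not increase the potential, by the Pythagorean inequality; FastProj adds a summable error
(`isNearProj_approxProj`).

Risk. At a minimizer `u` of the risk, exp-concavity along the segment towards `x` gives `E exp (-η
(f x - f u)) ≤ 1` (`IsStochasticLoss.integral_exp_le_one`). This bounds the second moment of the
excess loss by its mean, so that a supermartingale exists for every scale `s ∈ [0, 1]`. Markov's
inequality, a union bound over the scales `2⁻ⁱ` and the choice of the best scale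
(`le_of_dyadic_deviation`) bound the sum of the excess risks by the regret plus lower-order terms;
convexity passes to the average (`excessRisk_le_riskBound`).

Time. A round without projection costs `O(d²)`, thanks to rank-one updates of the inverse. A
projection needs `O(log T)` bisection steps of cost `O(d³)`, but occurs only when `‖y‖` would exceed
`k`, and it resets the norm to `1`. One round moves `y` by at most `G / (γ λ)` apart from
projections, so there are at most `T G / (γ λ (k - 1))` projections (`Timed.loop_round_time_le`).
For `λ = d log T` this amounts to `O(T d²)` in total, that is `O(d³ / ε)` up to logarithms. The
program is correct because exchange pivoting meets only positive pivots on a positive definite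
matrix (`Timed.loop_pivot_mulVec`), and by the Sherman-Morrison formula. -/

theorem inner_eq_dotProduct (u v : E d) : inner ℝ u v = u.ofLp ⬝ᵥ v.ofLp := by
  rw [EuclideanSpace.inner_eq_star_dotProduct, dotProduct_comm]; simp

theorem mulE_add (A : Mat d) (u v : E d) : mulE A (u + v) = mulE A u + mulE A v := by
  simp [mulE, Matrix.mulVec_add]

theorem mulE_sub (A : Mat d) (u v : E d) : mulE A (u - v) = mulE A u - mulE A v := by
  simp [mulE, Matrix.mulVec_sub]

theorem mulE_smul (A : Mat d) (c : ℝ) (u : E d) : mulE A (c • u) = c • mulE A u := by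
  simp [mulE, Matrix.mulVec_smul]

theorem add_mulE (A B : Mat d) (u : E d) : mulE (A + B) u = mulE A u + mulE B u := by
  simp [mulE, Matrix.add_mulVec]

theorem smul_one_mulE (c : ℝ) (u : E d) : mulE (c • (1 : Mat d)) u = c • u := by
  simp [mulE, Matrix.smul_mulVec]

theorem one_mulE (u : E d) : mulE (1 : Mat d) u = u := by simp [mulE]

theorem mulE_mulE (A B : Mat d) (u : E d) : mulE A (mulE B u) = mulE (A * B) u := by
  simp [mulE]

theorem vecMulVec_mulE (h u : E d) :
    mulE (Matrix.vecMulVec h.ofLp h.ofLp) u = (inner ℝ h u : ℝ) • h := by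
  ext i
  simp [mulE, Matrix.vecMulVec_mulVec, inner_eq_dotProduct]

theorem mahaSq_eq_inner (A : Mat d) (v : E d) : mahaSq A v = inner ℝ v (mulE A v) := by
  simp [mahaSq, mulE, inner_eq_dotProduct]

/-- `A` is symmetric with all its eigenvalues in `[lo, hi]`. -/
structure EigBounds (A : Mat d) (lo hi : ℝ) : Prop where
  symm : A.IsSymm
  lower : ∀ v : E d, lo * ‖v‖ ^ 2 ≤ inner ℝ v (mulE A v)
  upper : ∀ v : E d, inner ℝ v (mulE A v) ≤ hi * ‖v‖ ^ 2

namespace EigBounds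

variable {A : Mat d} {lo hi : ℝ}

theorem inner_mulE (hA : EigBounds A lo hi) (u v : E d) :
    inner ℝ u (mulE A v) = inner ℝ (mulE A u) v := by
  simp only [inner_eq_dotProduct, mulE]
  rw [Matrix.dotProduct_mulVec, ← Matrix.mulVec_transpose, hA.symm.eq]

theorem nonneg (hA : EigBounds A lo hi) (hlo : 0 < lo) (v : E d) :
    0 ≤ inner ℝ v (mulE A v) := le_trans (by positivity) (hA.lower v)

theorem mahaSq_nonneg (hA : EigBounds A lo hi) (hlo : 0 < lo) (v : E d) :
    0 ≤ mahaSq A v := by rw [mahaSq_eq_inner]; exact hA.nonneg hlo v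

theorem mulE_injective (hA : EigBounds A lo hi) (hlo : 0 < lo) {v : E d} (hv : mulE A v = 0) :
    v = 0 := by
  have h := hA.lower v
  rw [hv, inner_zero_right] at h
  have : ‖v‖ ^ 2 ≤ 0 := by
    by_contra hc
    push Not at hc
    nlinarith
  have h2 : ‖v‖ = 0 := by nlinarith [norm_nonneg v]
  exact norm_eq_zero.1 h2

theorem isUnit_det (hA : EigBounds A lo hi) (hlo : 0 < lo) : IsUnit A.det := by
  rw [← Matrix.isUnit_iff_isUnit_det]
  rw [← Matrix.mulVec_injective_iff_isUnit]
  intro x y hxy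
  have : mulE A (WithLp.toLp 2 (x - y)) = 0 := by
    simp only [mulE, Matrix.mulVec_sub]
    rw [show A.mulVec x = A.mulVec y from hxy]; simp
  have h2 := hA.mulE_injective hlo this
  have h3 : x - y = 0 := congrArg WithLp.ofLp h2
  exact sub_eq_zero.1 h3

theorem mulE_inv (hA : EigBounds A lo hi) (hlo : 0 < lo) (u : E d) : mulE A (mulE A⁻¹ u) = u := by
  rw [mulE_mulE, Matrix.mul_nonsing_inv _ (hA.isUnit_det hlo), one_mulE]

theorem inv_mulE (hA : EigBounds A lo hi) (hlo : 0 < lo) (u : E d) : mulE A⁻¹ (mulE A u) = u := by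
  rw [mulE_mulE, Matrix.nonsing_inv_mul _ (hA.isUnit_det hlo), one_mulE]

theorem le_norm_mulE (hA : EigBounds A lo hi) (v : E d) : lo * ‖v‖ ≤ ‖mulE A v‖ := by
  rcases eq_or_ne v 0 with rfl | hv
  · simp
  have hv' : 0 < ‖v‖ := norm_pos_iff.2 hv
  have h := (hA.lower v).trans (real_inner_le_norm _ _)
  nlinarith

theorem norm_inv_mulE_le (hA : EigBounds A lo hi) (hlo : 0 < lo) (v : E d) :
    ‖mulE A⁻¹ v‖ ≤ ‖v‖ / lo := by
  have := hA.le_norm_mulE (mulE A⁻¹ v)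
  rw [hA.mulE_inv hlo] at this
  rw [le_div_iff₀ hlo]; linarith

/-- The form of `A` is nonnegative at `p - A p / hi`; expanding it and bounding the form at `A p` by
`hi` gives the claim without a square root or a spectral decomposition of `A`. -/
theorem norm_mulE_sq_le (hA : EigBounds A lo hi) (hlo : 0 < lo) (hhi : 0 < hi) (p : E d) :
    ‖mulE A p‖ ^ 2 ≤ hi * inner ℝ p (mulE A p) := by
  set q := mulE A p with hq
  have h1 := hA.nonneg hlo (p - hi⁻¹ • q)
  have h2 := hA.upper q
  rw [mulE_sub, mulE_smul, inner_sub_left, inner_sub_right, inner_sub_right, inner_smul_right,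
    inner_smul_left, inner_smul_left, inner_smul_right, hA.inner_mulE p q, ← hq,
    real_inner_self_eq_norm_sq] at h1
  simp only [conj_trivial] at h1
  have h3 : hi⁻¹ * (hi⁻¹ * inner ℝ q (mulE A q)) ≤ hi⁻¹ * ‖q‖ ^ 2 := by
    have : hi⁻¹ * inner ℝ q (mulE A q) ≤ ‖q‖ ^ 2 := by
      rw [inv_mul_le_iff₀ hhi]; exact h2
    exact mul_le_mul_of_nonneg_left this (by positivity)
  have h4 : hi⁻¹ * ‖q‖ ^ 2 ≤ inner ℝ p q := by linarith
  rwa [inv_mul_le_iff₀ hhi] at h4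

theorem norm_mulE_le (hA : EigBounds A lo hi) (hlo : 0 < lo) (hhi : 0 < hi) (p : E d) :
    ‖mulE A p‖ ≤ hi * ‖p‖ := by
  have h := hA.norm_mulE_sq_le hlo hhi p
  have h2 := real_inner_le_norm p (mulE A p)
  rcases (norm_nonneg (mulE A p)).eq_or_lt with h0 | h0
  · rw [← h0]; positivity
  · have : ‖mulE A p‖ * ‖mulE A p‖ ≤ (hi * ‖p‖) * ‖mulE A p‖ := by nlinarith
    exact le_of_mul_le_mul_right this h0

theorem add_smul_one (hA : EigBounds A lo hi) (m : ℝ) :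
    EigBounds (A + m • (1 : Mat d)) (lo + m) (hi + m) where
  symm := by
    have := hA.symm
    unfold Matrix.IsSymm at *
    simp [this]
  lower v := by
    have := hA.lower v
    rw [add_mulE, inner_add_right, smul_one_mulE, inner_smul_right, real_inner_self_eq_norm_sq]
    linarith
  upper v := by
    have := hA.upper v
    rw [add_mulE, inner_add_right, smul_one_mulE, inner_smul_right, real_inner_self_eq_norm_sq]
    linarith

theorem smul_one (e : ℝ) : EigBounds (e • (1 : Mat d)) e e where
  symm := by simp [Matrix.IsSymm]
  lower v := by rw [smul_one_mulE, inner_smul_right, real_inner_self_eq_norm_sq]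
  upper v := by rw [smul_one_mulE, inner_smul_right, real_inner_self_eq_norm_sq]

theorem add_vecMulVec (hA : EigBounds A lo hi) {h : E d} {G : ℝ} (hh : ‖h‖ ≤ G) :
    EigBounds (A + Matrix.vecMulVec h.ofLp h.ofLp) lo (hi + G ^ 2) where
  symm := by
    have := hA.symm
    unfold Matrix.IsSymm at *
    simp [this, Matrix.transpose_vecMulVec]
  lower v := by
    have := hA.lower v
    rw [add_mulE, inner_add_right, vecMulVec_mulE, inner_smul_right, real_inner_comm h v]
    nlinarith [mul_self_nonneg (inner ℝ h v : ℝ)]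
  upper v := by
    have := hA.upper v
    rw [add_mulE, inner_add_right, vecMulVec_mulE, inner_smul_right, real_inner_comm h v]
    have h1 := abs_real_inner_le_norm h v
    have h2 : (inner ℝ h v : ℝ) ^ 2 ≤ (G * ‖v‖) ^ 2 := by
      rw [← sq_abs]
      gcongr
      exact h1.trans (by gcongr)
    nlinarith

end EigBounds

/-! ### Mahalanobis projections -/

theorem mahaSq_add {A : Mat d} {lo hi : ℝ} (hA : EigBounds A lo hi) (a b : E d) :
    mahaSq A (a + b) = mahaSq A a + 2 * inner ℝ (mulE A a) b + mahaSq A b := by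
  simp only [mahaSq_eq_inner, mulE_add, inner_add_left, inner_add_right]
  rw [hA.inner_mulE a b, real_inner_comm b (mulE A a), real_inner_comm]
  ring

/-- The variational inequality implies the Pythagorean inequality. -/
theorem mahaSq_pythagoras {A : Mat d} {lo hi : ℝ} (hA : EigBounds A lo hi) {u v z : E d}
    (h : inner ℝ (mulE A (u - v)) (z - v) ≤ 0) :
    mahaSq A (v - z) + mahaSq A (u - v) ≤ mahaSq A (u - z) := by
  have := mahaSq_add hA (u - v) (v - z)
  rw [sub_add_sub_cancel] at this
  have h2 : inner ℝ (mulE A (u - v)) (v - z) = - inner ℝ (mulE A (u - v)) (z - v) := by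
    rw [← inner_neg_right, neg_sub]
  rw [h2] at this
  linarith

theorem mahaSq_neg (A : Mat d) (v : E d) : mahaSq A (-v) = mahaSq A v := by
  simp [mahaSq, Matrix.mulVec_neg]

/-- The projection is an arbitrary choice among the minimizers. The Pythagorean inequality shows
that `v` is one of them, and `0 < lo` makes it the only one. -/
theorem mahaProj_eq {A : Mat d} {lo hi : ℝ} (hA : EigBounds A lo hi) (hlo : 0 < lo)
    {X : Set (E d)} {u v : E d} (hv : v ∈ X)
    (h : ∀ z ∈ X, inner ℝ (mulE A (u - v)) (z - v) ≤ 0) : mahaProj A X u = v := by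
  have key : ∀ z ∈ X, mahaSq A (z - v) + mahaSq A (v - u) ≤ mahaSq A (z - u) := by
    intro z hz
    have := mahaSq_pythagoras hA (h z hz)
    rwa [← mahaSq_neg, ← mahaSq_neg A (u - v), ← mahaSq_neg A (u - z), neg_sub, neg_sub, neg_sub]
      at this
  have hv' : IsMahaProj A X u v := ⟨hv, fun z hz => by
    have := key z hz
    have := hA.mahaSq_nonneg hlo (z - v)
    linarith⟩
  have hp : IsMahaProj A X u (mahaProj A X u) := Classical.epsilon_spec ⟨v, hv'⟩
  have h1 := key _ hp.1
  have h2 := hp.2 v hv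
  have h3 : mahaSq A (mahaProj A X u - v) ≤ 0 := by linarith
  rw [mahaSq_eq_inner] at h3
  have h4 := hA.lower (mahaProj A X u - v)
  have h5 : ‖mahaProj A X u - v‖ ^ 2 ≤ 0 := by
    by_contra hc
    push Not at hc
    nlinarith
  have h6 : ‖mahaProj A X u - v‖ = 0 := by nlinarith [norm_nonneg (mahaProj A X u - v)]
  exact sub_eq_zero.1 (norm_eq_zero.1 h6)

theorem mem_domain {x : E d} : x ∈ domain d ↔ ‖x‖ ≤ 1 := by simp [domain]

theorem eigBounds_one : EigBounds (1 : Mat d) 1 1 := by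
  simpa using EigBounds.smul_one (d := d) 1

theorem euclProj_of_norm_le {y : E d} (hy : ‖y‖ ≤ 1) : euclProj (domain d) y = y :=
  mahaProj_eq eigBounds_one one_pos (mem_domain.2 hy) (by simp [one_mulE])

theorem euclProj_of_one_lt {y : E d} (hy : 1 < ‖y‖) :
    euclProj (domain d) y = (1 / ‖y‖) • y := by
  have hy0 : 0 < ‖y‖ := by linarith
  refine mahaProj_eq eigBounds_one one_pos (mem_domain.2 ?_) ?_
  · rw [norm_smul, Real.norm_of_nonneg (by positivity)]; field_simp; exact le_rfl
  · intro z hz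
    rw [mem_domain] at hz
    rw [one_mulE]
    have e1 : y - (1 / ‖y‖) • y = (1 - 1 / ‖y‖) • y := by rw [sub_smul, one_smul]
    rw [e1, inner_smul_left, inner_sub_right, inner_smul_right, real_inner_self_eq_norm_sq]
    simp only [conj_trivial]
    have h1 : 1 / ‖y‖ ≤ 1 := by rw [div_le_one hy0]; exact hy.le
    have h2 : inner ℝ y z ≤ ‖y‖ := (real_inner_le_norm y z).trans (by nlinarith)
    have h3 : 1 / ‖y‖ * ‖y‖ ^ 2 = ‖y‖ := by field_simp
    rw [h3]
    exact mul_nonpos_of_nonneg_of_nonpos (by linarith) (by linarith)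

theorem euclProj_mem (y : E d) : euclProj (domain d) y ∈ domain d := by
  rcases le_or_gt ‖y‖ 1 with hy | hy
  · rw [euclProj_of_norm_le hy]; exact mem_domain.2 hy
  · rw [euclProj_of_one_lt hy, mem_domain, norm_smul, Real.norm_of_nonneg (by positivity)]
    have : 0 < ‖y‖ := by linarith
    field_simp; exact le_rfl

theorem inner_sub_euclProj_nonneg (y : E d) {u : E d} (hu : u ∈ domain d) :
    0 ≤ inner ℝ (y - euclProj (domain d) y) (euclProj (domain d) y - u) := by
  rcases le_or_gt ‖y‖ 1 with hy | hy
  · rw [euclProj_of_norm_le hy]; simp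
  · rw [mem_domain] at hu
    rw [euclProj_of_one_lt hy]
    have hy0 : 0 < ‖y‖ := by linarith
    have e1 : y - (1 / ‖y‖) • y = (1 - 1 / ‖y‖) • y := by rw [sub_smul, one_smul]
    rw [e1, inner_smul_left, inner_sub_right, inner_smul_right, real_inner_self_eq_norm_sq]
    simp only [conj_trivial]
    have h1 : 1 / ‖y‖ ≤ 1 := by rw [div_le_one hy0]; exact hy.le
    have h2 : inner ℝ y u ≤ ‖y‖ := (real_inner_le_norm y u).trans (by nlinarith)
    have h3 : 1 / ‖y‖ * ‖y‖ ^ 2 = ‖y‖ := by field_simp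
    rw [h3]
    exact mul_nonneg (by linarith) (by linarith)

/-! ### Projection by bisection -/

section Shrink

variable {A : Mat d} {lo hi : ℝ}

/-- Rewritten as `A (u - w) = m w`, this is the stationarity condition of the projection onto a
ball, with multiplier `m`. -/
theorem mulE_shrink (hA : EigBounds A lo hi) (hlo : 0 < lo) (u : E d) {m : ℝ} (hm : 0 ≤ m) :
    mulE A (shrink A u m) + m • shrink A u m = mulE A u := by
  have := (hA.add_smul_one m).mulE_inv (by linarith) (mulE A u)
  rwa [add_mulE, smul_one_mulE] at this

/-- Resolvent identity: `A + m I` sends the difference to `(n - m) • shrink A u n`, and it expands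
norms by at least `lo`. With `n` the exact multiplier the last factor is `1`. -/
theorem norm_shrink_sub_le (hA : EigBounds A lo hi) (hlo : 0 < lo) (u : E d) {m n : ℝ}
    (hm : 0 ≤ m) (hn : 0 ≤ n) :
    ‖shrink A u m - shrink A u n‖ ≤ |m - n| / lo * ‖shrink A u n‖ := by
  have h1 := mulE_shrink hA hlo u hm
  have h2 := mulE_shrink hA hlo u hn
  have h3 : mulE (A + m • (1 : Mat d)) (shrink A u m - shrink A u n)
      = (n - m) • shrink A u n := by
    rw [add_mulE, smul_one_mulE, mulE_sub, smul_sub, sub_smul]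
    rw [← h2] at h1
    have : mulE A (shrink A u m) = mulE A (shrink A u n) + n • shrink A u n - m • shrink A u m := by
      rw [← h1]; abel
    rw [this]; abel
  have h4 := (hA.add_smul_one m).le_norm_mulE (shrink A u m - shrink A u n)
  rw [h3, norm_smul, Real.norm_eq_abs, abs_sub_comm] at h4
  rw [div_mul_eq_mul_div, le_div_iff₀ hlo]
  have : 0 ≤ ‖shrink A u m - shrink A u n‖ := norm_nonneg _
  nlinarith

/-- With `w = shrink A u m` one has `u = w + m A⁻¹ w`; pair this with `w` and use `A⁻¹ ≥ 1 / hi`. It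
validates the upper end of the initial bracket. -/
theorem norm_shrink_le (hA : EigBounds A lo hi) (hlo : 0 < lo) (hhi : 0 < hi) (u : E d) {m : ℝ}
    (hm : 0 ≤ m) : (1 + m / hi) * ‖shrink A u m‖ ≤ ‖u‖ := by
  set w := shrink A u m with hw
  have h1 : mulE A w + m • w = mulE A u := mulE_shrink hA hlo u hm
  set p := mulE A⁻¹ w with hp
  have hpw : mulE A p = w := hA.mulE_inv hlo w
  have hu : u = w + m • p := by
    rw [← hA.inv_mulE hlo u, ← h1, mulE_add, hA.inv_mulE hlo, mulE_smul]
  have h2 := hA.norm_mulE_sq_le hlo hhi p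
  rw [hpw] at h2
  have h3 : inner ℝ u w = ‖w‖ ^ 2 + m * inner ℝ p w := by
    conv_lhs => rw [hu]
    rw [inner_add_left, inner_smul_left, real_inner_self_eq_norm_sq]; simp
  have h4 := real_inner_le_norm u w
  rcases (norm_nonneg w).eq_or_lt with h0 | h0
  · rw [← h0]; simp
  · have h5 : ‖w‖ ^ 2 / hi ≤ inner ℝ p w := by rw [div_le_iff₀ hhi]; linarith
    have h6 : (1 + m / hi) * ‖w‖ * ‖w‖ ≤ ‖u‖ * ‖w‖ := by
      calc (1 + m / hi) * ‖w‖ * ‖w‖ = ‖w‖ ^ 2 + m * (‖w‖ ^ 2 / hi) := by ring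
        _ ≤ ‖w‖ ^ 2 + m * inner ℝ p w := by gcongr
        _ ≤ _ := by linarith
    exact le_of_mul_le_mul_right h6 h0

/-- The triangle inequality in `u = w + m A⁻¹ w` with `A⁻¹ ≤ 1 / lo`. It validates the lower end of
the initial bracket. -/
theorem le_norm_shrink (hA : EigBounds A lo hi) (hlo : 0 < lo) (u : E d) {m : ℝ}
    (hm : 0 ≤ m) : ‖u‖ ≤ (1 + m / lo) * ‖shrink A u m‖ := by
  set w := shrink A u m with hw
  have h1 : mulE A w + m • w = mulE A u := mulE_shrink hA hlo u hm
  have hu : u = w + m • mulE A⁻¹ w := by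
    rw [← hA.inv_mulE hlo u, ← h1, mulE_add, hA.inv_mulE hlo, mulE_smul]
  have h2 := hA.norm_inv_mulE_le hlo w
  calc ‖u‖ = ‖w + m • mulE A⁻¹ w‖ := congrArg _ hu
    _ ≤ ‖w‖ + ‖m • mulE A⁻¹ w‖ := norm_add_le _ _
    _ = ‖w‖ + m * ‖mulE A⁻¹ w‖ := by rw [norm_smul, Real.norm_of_nonneg hm]
    _ ≤ ‖w‖ + m * (‖w‖ / lo) := by gcongr
    _ = _ := by ring

theorem continuousOn_norm_shrink (hA : EigBounds A lo hi) (hlo : 0 < lo) (hhi : 0 < hi) (u : E d) :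
    ContinuousOn (fun m => ‖shrink A u m‖) (Set.Ici 0) := by
  have : LipschitzOnWith (Real.toNNReal (‖u‖ / lo)) (fun m => ‖shrink A u m‖) (Set.Ici 0) := by
    refine LipschitzOnWith.of_dist_le_mul fun m hm n hn => ?_
    rw [Real.dist_eq, Real.dist_eq, Real.coe_toNNReal _ (by positivity)]
    refine (abs_norm_sub_norm_le _ _).trans ((norm_shrink_sub_le hA hlo u hm hn).trans ?_)
    have h1 := norm_shrink_le hA hlo hhi u hn
    have hn' : (0 : ℝ) ≤ n := hn
    have h2 : ‖shrink A u n‖ ≤ ‖u‖ := by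
      have : 0 ≤ n / hi * ‖shrink A u n‖ := by positivity
      nlinarith
    calc |m - n| / lo * ‖shrink A u n‖ ≤ |m - n| / lo * ‖u‖ := by gcongr
      _ = _ := by ring
  exact this.continuousOn

/-- The invariant of the bisection. -/
theorem iterate_bisectStep (A : Mat d) (u : E d) (n : ℕ) {q : ℝ × ℝ} (h0 : 0 ≤ q.1)
    (hq : q.1 ≤ q.2) (h1 : 1 ≤ ‖shrink A u q.1‖) (h2 : ‖shrink A u q.2‖ ≤ 1) :
    0 ≤ ((bisectStep A u 1)^[n] q).1 ∧
    ((bisectStep A u 1)^[n] q).2 - ((bisectStep A u 1)^[n] q).1 = (q.2 - q.1) / 2 ^ n ∧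
    1 ≤ ‖shrink A u ((bisectStep A u 1)^[n] q).1‖ ∧
    ‖shrink A u ((bisectStep A u 1)^[n] q).2‖ ≤ 1 := by
  induction n generalizing q with
  | zero => simp [h0, h1, h2]
  | succ n ih =>
    rw [Function.iterate_succ_apply]
    unfold bisectStep
    split_ifs with hc
    · have h3 : 1 ≤ ‖shrink A u ((q.1 + q.2) / 2)‖ := by
        nlinarith [norm_nonneg (shrink A u ((q.1 + q.2) / 2))]
      obtain ⟨a, b, c⟩ := ih (q := ((q.1 + q.2) / 2, q.2)) (by simp; linarith) (by simp; linarith)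
        h3 h2
      refine ⟨a, ?_, c⟩
      refine b.trans ?_
      simp only; rw [pow_succ]; field_simp; ring
    · have h3 : ‖shrink A u ((q.1 + q.2) / 2)‖ ≤ 1 := by
        nlinarith [norm_nonneg (shrink A u ((q.1 + q.2) / 2))]
      obtain ⟨a, b, c⟩ := ih (q := (q.1, (q.1 + q.2) / 2)) h0 (by simp; linarith) h1 h3
      refine ⟨a, ?_, c⟩
      refine b.trans ?_
      simp only; rw [pow_succ]; field_simp; ring

theorem le_two_pow_bisectCount {r ζ : ℝ} (hr : 1 < r) (hζ : 0 < ζ) (hlo : 0 < lo) (h : lo ≤ hi) :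
    1 / ζ * (hi / lo - 1) * r * (r - 1) ≤ 2 ^ bisectCount r 1 ζ lo hi := by
  set a := 1 / ζ * (hi / lo - 1) * r * (r - 1) with ha
  have h1 : 0 ≤ hi / lo - 1 := by rw [sub_nonneg, le_div_iff₀ hlo]; linarith
  have ha0 : 0 ≤ a := by
    have : 0 ≤ r - 1 := by linarith
    positivity
  -- For `lo = hi` the argument of the logarithm vanishes and no step is needed.
  rcases ha0.eq_or_lt with h0 | h0
  · rw [← h0]; positivity
  have : bisectCount r 1 ζ lo hi = ⌈Real.logb 2 a⌉₊ := by simp [bisectCount, ha]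
  rw [this, ← Real.rpow_natCast]
  calc a = 2 ^ Real.logb 2 a := by rw [Real.rpow_logb] <;> norm_num [h0]
    _ ≤ _ := Real.rpow_le_rpow_of_exponent_le (by norm_num) (Nat.le_ceil _)

/-- FastProj returns a unit vector at distance at most `ζ` from the Mahalanobis projection, which
is characterized by the variational inequality. -/
theorem fastProj_spec (hA : EigBounds A lo hi) (hlo : 0 < lo) (hlh : lo ≤ hi) {u : E d}
    (hu : 1 < ‖u‖) {ζ : ℝ} (hζ : 0 < ζ) :
    ‖fastProj A u 1 ζ lo hi‖ = 1 ∧ ∃ v : E d, ‖v‖ = 1 ∧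
      (∀ z ∈ domain d, inner ℝ (mulE A (u - v)) (z - v) ≤ 0) ∧
      ‖fastProj A u 1 ζ lo hi - v‖ ≤ ζ := by
  have hhi : 0 < hi := by linarith
  set r := ‖u‖ with hr
  set q₀ : ℝ × ℝ := ((r / 1 - 1) * lo, (r / 1 - 1) * hi) with hq₀
  have hr1 : 0 < r - 1 := by linarith
  have hq1 : 0 ≤ q₀.1 := by simp [hq₀]; positivity
  have hq12 : q₀.1 ≤ q₀.2 := by simp [hq₀]; gcongr
  -- The bracket is chosen so that `1 + m / lo = ‖u‖` at its lower end and `1 + m / hi = ‖u‖` at its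
  -- upper end.
  have ha : 1 ≤ ‖shrink A u q₀.1‖ := by
    have := le_norm_shrink hA hlo u hq1
    have e : 1 + q₀.1 / lo = r := by simp [hq₀]; field_simp; ring
    rw [e, ← hr] at this
    by_contra hc
    push Not at hc
    nlinarith
  have hb : ‖shrink A u q₀.2‖ ≤ 1 := by
    have := norm_shrink_le hA hlo hhi u (hq1.trans hq12)
    have e : 1 + q₀.2 / hi = r := by simp [hq₀]; field_simp; ring
    rw [e, ← hr] at this
    by_contra hc
    push Not at hc
    nlinarith
  set n := bisectCount r 1 ζ lo hi with hn
  set q := (bisectStep A u 1)^[n] q₀ with hq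
  obtain ⟨i1, i2, i3, i4⟩ := iterate_bisectStep A u n hq1 hq12 ha hb
  rw [← hq] at i1 i2 i3 i4
  have hle : q.1 ≤ q.2 := by
    have : 0 ≤ (q₀.2 - q₀.1) / 2 ^ n := by
      have : 0 ≤ q₀.2 - q₀.1 := by linarith
      positivity
    linarith
  -- The count contains one more factor `r > 1` than this width requires.
  have hwidth : q.2 - q.1 ≤ ζ * lo := by
    rw [i2, div_le_iff₀ (by positivity)]
    have := le_two_pow_bisectCount hu hζ hlo hlh
    rw [← hn] at this
    have e : q₀.2 - q₀.1 = ζ * lo * (1 / ζ * (hi / lo - 1) * (r - 1)) := by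
      simp [hq₀]; field_simp
    rw [e]
    have h0 : 0 ≤ hi / lo - 1 := by rw [sub_nonneg, le_div_iff₀ hlo]; linarith
    have h3 : 1 / ζ * (hi / lo - 1) * (r - 1) ≤ 1 / ζ * (hi / lo - 1) * r * (r - 1) := by
      have : 0 ≤ 1 / ζ * (hi / lo - 1) * (r - 1) := by positivity
      nlinarith
    gcongr
    exact h3.trans this
  obtain ⟨m, hm, hm1⟩ : ∃ m ∈ Set.Icc q.1 q.2, ‖shrink A u m‖ = 1 := by
    have := intermediate_value_Icc' hle ((continuousOn_norm_shrink hA hlo hhi u).mono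
      (fun x hx => i1.trans hx.1))
    exact this ⟨i4, i3⟩
  have hm0 : 0 ≤ m := i1.trans hm.1
  set c := (q.1 + q.2) / 2 with hc
  have hc0 : 0 ≤ c := by rw [hc]; linarith
  set w := shrink A u c with hw
  set v := shrink A u m with hv
  -- The midpoint is within half the bracket width of the root, which gives `ζ / 2`; normalizing `w`
  -- costs at most another `ζ / 2`, because `|‖w‖ - 1| ≤ ‖w - v‖`.
  have hwv : ‖w - v‖ ≤ ζ / 2 := by
    have := norm_shrink_sub_le hA hlo u hc0 hm0
    rw [← hw, ← hv, hm1, mul_one] at this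
    refine this.trans ?_
    rw [div_le_iff₀ hlo, abs_le]
    have := hm.1
    have := hm.2
    constructor <;> rw [hc] <;> linarith
  have hfp : fastProj A u 1 ζ lo hi = (1 / ‖w‖) • w := rfl
  have hw0 : 0 < ‖w‖ := by
    have := le_norm_shrink hA hlo u hc0
    rw [← hw, ← hr] at this
    have h2 : 0 < 1 + c / lo := by positivity
    by_contra h3
    push Not at h3
    nlinarith
  refine ⟨?_, v, hm1, ?_, ?_⟩
  · rw [hfp, norm_smul, Real.norm_of_nonneg (by positivity)]; field_simp
  · intro z hz
    rw [mem_domain] at hz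
    have h1 := mulE_shrink hA hlo u hm0
    rw [← hv] at h1
    have h2 : mulE A (u - v) = m • v := by rw [mulE_sub, ← h1]; abel
    rw [h2, inner_smul_left, inner_sub_right, real_inner_self_eq_norm_sq, hm1]
    have h3 := real_inner_le_norm v z
    rw [hm1] at h3
    simp only [conj_trivial]
    exact mul_nonpos_of_nonneg_of_nonpos hm0 (by linarith)
  · rw [hfp]
    have h1 : ‖(1 / ‖w‖) • w - w‖ ≤ ζ / 2 := by
      have : (1 / ‖w‖) • w - w = ((1 - ‖w‖) / ‖w‖) • w := by
        rw [sub_div, div_self hw0.ne', sub_smul, one_smul]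
      rw [this, norm_smul, norm_div, norm_norm, div_mul_cancel₀ _ hw0.ne', Real.norm_eq_abs,
        ← hm1, abs_sub_comm]
      exact (abs_norm_sub_norm_le _ _).trans hwv
    calc ‖(1 / ‖w‖) • w - v‖ = ‖((1 / ‖w‖) • w - w) + (w - v)‖ := by congr 1; abel
      _ ≤ _ := norm_add_le _ _
      _ ≤ ζ := by linarith

/-- The last clause, valid for every `ζ > 0`, exhibits the exact projection as a limit of values of
FastProj; its measurability rests on this. -/
theorem exists_exactProj (hA : EigBounds A lo hi) (hlo : 0 < lo) (hlh : lo ≤ hi) {u : E d}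
    (hu : 1 < ‖u‖) {ζ : ℝ} (hζ : 0 < ζ) :
    ‖mahaProj A (domain d) u‖ = 1 ∧
      (∀ z ∈ domain d, mahaSq A (mahaProj A (domain d) u - z) ≤ mahaSq A (u - z)) ∧
      ‖fastProj A u 1 ζ lo hi - mahaProj A (domain d) u‖ ≤ ζ := by
  obtain ⟨-, v, h1, h2, h3⟩ := fastProj_spec hA hlo hlh hu hζ
  have : mahaProj A (domain d) u = v := mahaProj_eq hA hlo (mem_domain.2 h1.le) h2
  rw [this]
  refine ⟨h1, fun z hz => ?_, h3⟩
  have := mahaSq_pythagoras hA (h2 z hz)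
  have := hA.mahaSq_nonneg hlo (u - v)
  linarith

end Shrink

/-! ### Exp-concave losses -/

/-- `exp (-η φ)` is the power `η / α ≤ 1` of `exp (-α φ)`, and such a power is concave and
increasing. -/
theorem ExpConcaveOn.mono {α η : ℝ} (hα : 0 < α) (hη : 0 ≤ η) (h : η ≤ α) {X : Set (E d)}
    {φ : E d → ℝ} (hφ : ExpConcaveOn α X φ) : ExpConcaveOn η X φ := by
  refine ⟨hφ.1, fun x hx y hy a b ha hb hab => ?_⟩
  have hp0 : 0 ≤ η / α := by positivity
  have hp1 : η / α ≤ 1 := by rw [div_le_one hα]; exact h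
  have e : ∀ w, Real.exp (-η * φ w) = Real.exp (-α * φ w) ^ (η / α) := by
    intro w
    rw [← Real.exp_mul]; congr 1; field_simp
  have h1 := hφ.2 hx hy ha hb hab
  have h2 := (Real.concaveOn_rpow hp0 hp1).2 (x := Real.exp (-α * φ x))
    (y := Real.exp (-α * φ y)) (Real.exp_pos _).le (Real.exp_pos _).le ha hb hab
  simp only [smul_eq_mul, e] at *
  refine h2.trans (Real.rpow_le_rpow ?_ h1 hp0)
  positivity

theorem concaveOn_le_add_fderivWithin {s : Set (E d)} {ψ : E d → ℝ} {ψ' : E d →L[ℝ] ℝ} {x u : E d}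
    (hψ : ConcaveOn ℝ s ψ) (hx : x ∈ s) (hu : u ∈ s) (h : HasFDerivWithinAt ψ ψ' s x) :
    ψ u ≤ ψ x + ψ' (u - x) := by
  have hmaps : Set.MapsTo (AffineMap.lineMap x u : ℝ → E d) (Set.Icc 0 1) s := by
    intro θ hθ
    exact hψ.1.lineMap_mem hx hu hθ
  have h1 : ConcaveOn ℝ (Set.Icc (0 : ℝ) 1) (ψ ∘ (AffineMap.lineMap x u : ℝ →ᵃ[ℝ] E d)) :=
    (hψ.comp_affineMap (AffineMap.lineMap x u)).subset hmaps (convex_Icc 0 1)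
  have h2 : HasDerivWithinAt (AffineMap.lineMap x u : ℝ → E d) (u - x) (Set.Icc 0 1) 0 :=
    AffineMap.hasDerivWithinAt_lineMap
  have h3 : HasDerivWithinAt (ψ ∘ (AffineMap.lineMap x u : ℝ → E d)) (ψ' (u - x))
      (Set.Icc 0 1) 0 := by
    refine HasFDerivWithinAt.comp_hasDerivWithinAt (t := s) 0 ?_ h2 hmaps
    simpa using h
  have h4 := h1.slope_le_of_hasDerivWithinAt (x := 0) (y := 1) (by simp) (by simp) one_pos h3
  simp [slope_def_field] at h4
  rw [map_sub]
  linarith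

/-- Turns the tangent inequality for `exp (-2γ f)` into a quadratic bound on `f` itself, after
taking logarithms. -/
theorem one_add_le_exp_sub_sq {w : ℝ} (h1 : -1 ≤ w) (h2 : w ≤ 1) :
    1 + w ≤ Real.exp (w - w ^ 2 / 4) := by
  rcases le_or_gt 0 w with h | h
  · have := Real.quadratic_le_exp_of_nonneg (x := w - w ^ 2 / 4) (by nlinarith)
    refine le_trans ?_ this
    nlinarith [mul_nonneg h h, mul_nonneg (mul_nonneg h h) h,
      mul_nonneg (mul_nonneg h h) (sub_nonneg.2 h2)]
  -- For `w < 0` put `s = w - w²/4`: then `exp s ≥ (1 + s/2)² = 1 + s + s²/4`, and `s² ≥ w²`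
  -- restores the lost `w²/4`.
  · have h3 : 1 + (w - w ^ 2 / 4) / 2 ≤ Real.exp ((w - w ^ 2 / 4) / 2) := by
      have := Real.add_one_le_exp ((w - w ^ 2 / 4) / 2); linarith
    have h4 : 0 ≤ 1 + (w - w ^ 2 / 4) / 2 := by nlinarith
    have h5 : Real.exp (w - w ^ 2 / 4) = Real.exp ((w - w ^ 2 / 4) / 2) ^ 2 := by
      rw [← Real.exp_nat_mul]; congr 1; push_cast; ring
    rw [h5]
    refine le_trans ?_ (pow_le_pow_left₀ h4 h3 2)
    have : w ^ 2 ≤ (w - w ^ 2 / 4) ^ 2 := by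
      have : (w - w ^ 2 / 4) ^ 2 = w ^ 2 * (1 - w / 4) ^ 2 := by ring
      rw [this]
      have : 1 ≤ (1 - w / 4) ^ 2 := by nlinarith
      nlinarith [sq_nonneg w]
    nlinarith

/-! ### The curvature parameter -/

section Gamma

variable {α G k : ℝ}

theorem gamma0_pos (hα : 0 < α) (hG : 0 < G) : 0 < gamma0 α G := by
  unfold gamma0; positivity

theorem two_mul_gamma0_le (α G : ℝ) : 2 * gamma0 α G ≤ α := by
  unfold gamma0
  have := min_le_right (1 / (2 * G)) α
  linarith

/-- The factor `4` serves twice: as `2 * 2` in `2γ |⟪g, x - u⟫| ≤ 1`, and as the bound `k + 1 ≤ 4`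
on `‖y - u‖` for surrogate decisions. -/
theorem four_mul_gamma0_mul_le (α : ℝ) (hG : 0 < G) : 4 * (gamma0 α G * G) ≤ 1 := by
  unfold gamma0
  have := min_le_left (1 / (2 * G)) α
  have h : min (1 / (2 * G)) α * (2 * G) ≤ 1 := by
    rwa [← le_div_iff₀ (by positivity)]
  linarith

/-- For `k ≤ 3` the factor `4 / (k + 1)` is at least `1`, so the middle term never attains the
minimum alone. -/
theorem gamma'_eq_gamma0 (α : ℝ) (hG : 0 < G) (hk : 1 < k) (hk3 : k ≤ 3) :
    gamma' α G k = gamma0 α G := by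
  have : 1 / (2 * G) ≤ 4 / ((k + 1) * (2 * G)) := by
    have : 0 < k + 1 := by linarith
    rw [div_le_div_iff₀ (by positivity) (by positivity)]
    nlinarith
  rw [gamma', gamma0, min_eq_left this]

end Gamma

/-! ### First-order consequences of exp-concavity -/

section Loss

variable {Ξ : Type*} [MeasurableSpace Ξ] {α G : ℝ} {P : Measure Ξ} {f : E d → Ξ → ℝ}

/-- The tangent inequality at `x` of the concave function `exp (-η f)`, divided by its value at `x`.
-/
theorem IsStochasticLoss.exp_le (hf : IsStochasticLoss α G P f) (hα : 0 < α) {η : ℝ} (hη : 0 ≤ η)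
    (hηα : η ≤ α) (z : Ξ) {x u : E d} (hx : x ∈ domain d) (hu : u ∈ domain d) :
    Real.exp (-η * (f u z - f x z)) ≤ 1 - η * inner ℝ (lossGrad f z x) (u - x) := by
  have h1 := (hf.expConcave z).mono hα hη hηα
  have h2 := (hf.differentiable z x hx).hasFDerivWithinAt
  have h3 : HasFDerivWithinAt (fun x => Real.exp (-η * f x z)) _ (domain d) x :=
    (h2.const_mul (-η)).exp
  have h4 := concaveOn_le_add_fderivWithin h1 hx hu h3
  simp only [smul_apply, smul_eq_mul] at h4
  rw [← inner_gradientWithin_left] at h4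
  rw [mul_sub, Real.exp_sub, div_le_iff₀ (Real.exp_pos _), lossGrad]
  linarith

/-- Take `η = 2γ` in the tangent inequality. Since `|2γ a| ≤ 1`, the right side `1 + 2γ a` is at
most `exp (2γ a - (2γ a)² / 4)`; compare exponents. -/
theorem IsStochasticLoss.le_loss (hf : IsStochasticLoss α G P f) (hα : 0 < α) (hG : 0 < G)
    (z : Ξ) {x u : E d} (hx : x ∈ domain d) (hu : u ∈ domain d) :
    f x z - f u z ≤ inner ℝ (lossGrad f z x) (x - u)
      - gamma0 α G / 2 * inner ℝ (lossGrad f z x) (x - u) ^ 2 := by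
  set γ := gamma0 α G with hγ
  have hγ0 : 0 < γ := gamma0_pos hα hG
  have h1 := hf.exp_le hα (η := 2 * γ) (by positivity) (two_mul_gamma0_le α G) z hx hu
  set a := inner ℝ (lossGrad f z x) (x - u) with ha
  have e : inner ℝ (lossGrad f z x) (u - x) = -a := by rw [ha, ← inner_neg_right, neg_sub]
  rw [e] at h1
  have h2 : |a| ≤ G * 2 := by
    refine (abs_real_inner_le_norm _ _).trans ?_
    have := hf.lipschitz z x hx
    have : ‖x - u‖ ≤ 2 := by
      rw [mem_domain] at hx hu
      exact (norm_sub_le _ _).trans (by linarith)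
    gcongr
  have h3 := four_mul_gamma0_mul_le α hG
  rw [← hγ] at h3
  obtain ⟨h4, h5⟩ := abs_le.1 h2
  have h6 := one_add_le_exp_sub_sq (w := 2 * γ * a) (by nlinarith) (by nlinarith)
  have h7 : Real.exp (-(2 * γ) * (f u z - f x z)) ≤
      Real.exp (2 * γ * a - (2 * γ * a) ^ 2 / 4) := by
    refine le_trans (h1.trans ?_) h6
    linarith
  rw [Real.exp_le_exp] at h7
  have h8 : (2 * γ) * (f x z - f u z) ≤ (2 * γ) * (a - γ / 2 * a ^ 2) := by linarith
  exact le_of_mul_le_mul_left h8 (by positivity)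

theorem IsStochasticLoss.le_inner (hf : IsStochasticLoss α G P f) (hα : 0 < α) (hG : 0 < G)
    (z : Ξ) {x u : E d} (hx : x ∈ domain d) (hu : u ∈ domain d) :
    f x z - f u z ≤ inner ℝ (lossGrad f z x) (x - u) := by
  have h := hf.le_loss hα hG z hx hu
  have h2 := gamma0_pos hα hG
  have : 0 ≤ gamma0 α G / 2 * inner ℝ (lossGrad f z x) (x - u) ^ 2 := by positivity
  linarith

theorem IsStochasticLoss.abs_sub_le (hf : IsStochasticLoss α G P f) (hα : 0 < α) (hG : 0 < G)
    (z : Ξ) {x u : E d} (hx : x ∈ domain d) (hu : u ∈ domain d) :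
    |f x z - f u z| ≤ G * ‖x - u‖ := by
  have key : ∀ {x u : E d}, x ∈ domain d → u ∈ domain d → f x z - f u z ≤ G * ‖x - u‖ := by
    intro x u hx hu
    refine (hf.le_inner hα hG z hx hu).trans ((real_inner_le_norm _ _).trans ?_)
    have := hf.lipschitz z x hx
    gcongr
  rw [abs_le]
  have h1 := key hx hu
  have h2 := key hu hx
  rw [norm_sub_rev] at h2
  constructor <;> linarith

end Loss

/-! ### Surrogate gradients -/

/-- If `⟪g, y - x⟫ < 0`, the correction removes exactly the component of `g` along `y - x`, so the
result is an orthogonal projection of `g`. -/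
theorem norm_surrogateGrad_le (g x y : E d) : ‖surrogateGrad g x y‖ ≤ ‖g‖ := by
  unfold surrogateGrad
  set v := y - x
  rcases le_or_gt 0 (inner ℝ g v : ℝ) with h | h
  · rw [max_eq_left (by linarith)]; simp
  · rw [max_eq_right (by linarith)]
    have hv : v ≠ 0 := by rintro h0; rw [h0] at h; simp at h
    have hv' : 0 < ‖v‖ := norm_pos_iff.2 hv
    refine le_of_sq_le_sq ?_ (norm_nonneg _)
    rw [norm_add_sq_real, inner_smul_right, norm_smul, Real.norm_of_nonneg
      (div_nonneg (by linarith) (by positivity))]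
    have : 2 * (-inner ℝ g v / ‖v‖ ^ 2 * inner ℝ g v) + (-inner ℝ g v / ‖v‖ ^ 2 * ‖v‖) ^ 2
      = -(inner ℝ g v ^ 2 / ‖v‖ ^ 2) := by field_simp; ring
    have h2 : 0 ≤ (inner ℝ g v : ℝ) ^ 2 / ‖v‖ ^ 2 := by positivity
    linarith

/-- Split `y - u = (y - x) + (x - u)`. The correction cancels a negative `⟪g, y - x⟫`, and its
pairing with `x - u` is nonnegative by the variational inequality of the Euclidean projection. -/
theorem inner_le_inner_surrogateGrad (g y : E d) {u : E d} (hu : u ∈ domain d) :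
    inner ℝ g (euclProj (domain d) y - u)
      ≤ inner ℝ (surrogateGrad g (euclProj (domain d) y) y) (y - u) := by
  have h1 := inner_sub_euclProj_nonneg y hu
  set x := euclProj (domain d) y
  unfold surrogateGrad
  set v := y - x with hv
  set c := max 0 (-(inner ℝ g v)) / ‖v‖ ^ 2 with hc
  have hc0 : 0 ≤ c := by positivity
  have e : y - u = v + (x - u) := by rw [hv]; abel
  rw [e, inner_add_left, inner_add_right, inner_smul_left, inner_add_right,
    real_inner_self_eq_norm_sq]
  simp only [conj_trivial]
  have h2 : -(inner ℝ g v) ≤ c * ‖v‖ ^ 2 := by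
    rcases eq_or_ne v 0 with h0 | h0
    · rw [h0]; simp
    · have : ‖v‖ ≠ 0 := norm_ne_zero_iff.2 h0
      rw [hc, div_mul_cancel₀ _ (by positivity)]
      exact le_max_right _ _
  have h3 : 0 ≤ c * inner ℝ v (x - u) := mul_nonneg hc0 h1
  linarith

/-! ### Determinants -/

section Det

variable {A : Mat d} {lo hi : ℝ}

theorem EigBounds.posDef (hA : EigBounds A lo hi) (hlo : 0 < lo) : A.PosDef := by
  refine Matrix.PosDef.of_dotProduct_mulVec_pos ?_ ?_
  · have := hA.symm
    simpa [Matrix.IsHermitian, Matrix.IsSymm] using this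
  · intro x hx
    have h := hA.lower (WithLp.toLp 2 x)
    have h2 : 0 < ‖(WithLp.toLp 2 x : E d)‖ := by
      rw [norm_pos_iff]; intro h0; apply hx; simpa using h0
    have h3 : inner ℝ (WithLp.toLp 2 x : E d) (mulE A (WithLp.toLp 2 x)) = star x ⬝ᵥ A.mulVec x := by
      simp [inner_eq_dotProduct, mulE]
    rw [← h3]
    have : 0 < lo * ‖(WithLp.toLp 2 x : E d)‖ ^ 2 := by positivity
    linarith

/-- The arithmetic-geometric mean inequality for the eigenvalues, obtained by summing the tangent
bound of `log` at their mean. -/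
theorem log_det_le (hd : 1 ≤ d) (hA : A.PosDef) :
    Real.log A.det ≤ d * Real.log (A.trace / d) := by
  have hd' : (0 : ℝ) < d := by exact_mod_cast hd
  have hpos : ∀ i, 0 < hA.isHermitian.eigenvalues i := fun i => hA.eigenvalues_pos i
  have h1 : A.det = ∏ i, hA.isHermitian.eigenvalues i := by
    simpa using hA.isHermitian.det_eq_prod_eigenvalues
  have h2 : A.trace = ∑ i, hA.isHermitian.eigenvalues i := by
    simpa using hA.isHermitian.trace_eq_sum_eigenvalues
  have htr : 0 < A.trace := by
    rw [h2]
    have : Nonempty (Fin d) := ⟨⟨0, hd⟩⟩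
    exact Finset.sum_pos (fun i _ => hpos i) Finset.univ_nonempty
  set c := A.trace / d with hc
  have hc0 : 0 < c := by positivity
  rw [h1, Real.log_prod (fun i _ => (hpos i).ne')]
  have h3 : ∀ i, Real.log (hA.isHermitian.eigenvalues i)
      ≤ hA.isHermitian.eigenvalues i / c - 1 + Real.log c := by
    intro i
    have := Real.log_le_sub_one_of_pos (div_pos (hpos i) hc0)
    rw [Real.log_div (hpos i).ne' hc0.ne'] at this
    linarith
  refine (Finset.sum_le_sum fun i _ => h3 i).trans ?_
  rw [Finset.sum_add_distrib, Finset.sum_sub_distrib, ← Finset.sum_div, ← h2]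
  simp
  rw [hc]
  field_simp
  simp

theorem det_add_vecMulVec (hA : EigBounds A lo hi) (hlo : 0 < lo) (h : E d) :
    (A + Matrix.vecMulVec h.ofLp h.ofLp).det = A.det * (1 + inner ℝ h (mulE A⁻¹ h)) := by
  rw [Matrix.vecMulVec_eq (ι := Unit), Matrix.det_add_replicateCol_mul_replicateRow
    (hA.isUnit_det hlo), Matrix.det_unique (n := Unit)]
  congr 1
  simp [Matrix.mul_apply, inner_eq_dotProduct, mulE, dotProduct, Matrix.mulVec,
    Finset.sum_mul, Finset.mul_sum]
  rw [Finset.sum_comm]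
  exact Finset.sum_congr rfl fun i _ => Finset.sum_congr rfl fun j _ => by ring

theorem inner_inv_mulE_nonneg (hA : EigBounds A lo hi) (hlo : 0 < lo) (h : E d) :
    0 ≤ inner ℝ h (mulE A⁻¹ h) := by
  have := hA.nonneg hlo (mulE A⁻¹ h)
  rwa [hA.mulE_inv hlo, real_inner_comm] at this

/-- The Sherman-Morrison formula, applied to the vector of the update. -/
theorem mulE_inv_add_vecMulVec (hA : EigBounds A lo hi) (hlo : 0 < lo) (h : E d) :
    mulE (A + Matrix.vecMulVec h.ofLp h.ofLp)⁻¹ h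
      = (1 / (1 + inner ℝ h (mulE A⁻¹ h))) • mulE A⁻¹ h := by
  have hA' := hA.add_vecMulVec (h := h) le_rfl
  have h0 := inner_inv_mulE_nonneg hA hlo h
  set w : ℝ := inner ℝ h (mulE A⁻¹ h) with hw
  have h1 : mulE (A + Matrix.vecMulVec h.ofLp h.ofLp) ((1 / (1 + w)) • mulE A⁻¹ h) = h := by
    rw [mulE_smul, add_mulE, hA.mulE_inv hlo, vecMulVec_mulE, ← hw]
    nth_rewrite 1 [← one_smul ℝ h]
    rw [← add_smul, smul_smul]
    have : 1 / (1 + w) * (1 + w) = 1 := by field_simp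
    rw [this, one_smul]
  have h2 := hA'.inv_mulE hlo ((1 / (1 + w)) • mulE A⁻¹ h)
  rwa [h1] at h2

/-- With `w = hᵀ A⁻¹ h` the left side is `w / (1 + w) = 1 - 1 / (1 + w)` and the right side is `log
(1 + w)`. -/
theorem inner_inv_le_log_det (hA : EigBounds A lo hi) (hlo : 0 < lo) (h : E d) :
    inner ℝ h (mulE (A + Matrix.vecMulVec h.ofLp h.ofLp)⁻¹ h)
      ≤ Real.log (A + Matrix.vecMulVec h.ofLp h.ofLp).det - Real.log A.det := by
  have h0 := inner_inv_mulE_nonneg hA hlo h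
  have hdet := (hA.posDef hlo).det_pos
  rw [mulE_inv_add_vecMulVec hA hlo, det_add_vecMulVec hA hlo, inner_smul_right,
    Real.log_mul hdet.ne' (by positivity)]
  set w : ℝ := inner ℝ h (mulE A⁻¹ h)
  have h2 := Real.one_sub_inv_le_log_of_pos (x := 1 + w) (by positivity)
  have h3 : 1 / (1 + w) * w = 1 - (1 + w)⁻¹ := by field_simp; ring
  linarith

end Det

/-! ### The regret of LightONS -/

/-- A projection routine that maps into the unit ball and that increases the squared distance to
points of the ball by at most `err t` in round `t + 1`. -/
structure IsNearProj (proj : ProjRoutine d) (G e : ℝ) (err : ℕ → ℝ) : Prop where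
  norm_le : ∀ t A u, EigBounds A e (e + G ^ 2 * (t + 1 : ℕ)) → 1 < ‖u‖ → ‖proj (t + 1) A u‖ ≤ 1
  mahaSq_le : ∀ t A u, EigBounds A e (e + G ^ 2 * (t + 1 : ℕ)) → 1 < ‖u‖ → ∀ z ∈ domain d,
    mahaSq A (proj (t + 1) A u - z) ≤ mahaSq A (u - z) + err t

section

variable {G e k γ : ℝ}

theorem isNearProj_exactProj (he : 0 < e) : IsNearProj (exactProj (d := d)) G e fun _ => 0 where
  norm_le t A u hA hu :=
    (exists_exactProj hA he (by nlinarith [sq_nonneg G, (Nat.cast_nonneg (t + 1) : (0 : ℝ) ≤ _)])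
      hu one_pos).1.le
  mahaSq_le t A u hA hu z hz := by
    rw [add_zero]
    exact (exists_exactProj hA he
      (by nlinarith [sq_nonneg G, (Nat.cast_nonneg (t + 1) : (0 : ℝ) ≤ _)]) hu one_pos).2.1 z hz

theorem tolerance_pos (hγ : 0 < γ) (hk : 0 < k) (he : 0 < e) (t : ℕ) :
    0 < tolerance γ G e k (t + 1) := by
  have : (0 : ℝ) < (t + 1 : ℕ) := by positivity
  unfold tolerance
  refine lt_min ?_ ?_ <;> positivity

/-- Only the first term of the minimum in the tolerance is needed for the regret. -/
theorem mul_tolerance_le (hγ : 0 < γ) (hk : 1 ≤ k) (he : 0 < e) (t : ℕ) :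
    (e + G ^ 2 * (t + 1 : ℕ)) * tolerance γ G e k (t + 1) ≤ γ / (4 * ((t + 1 : ℕ) : ℝ) ^ 2) := by
  set s : ℝ := ((t + 1 : ℕ) : ℝ)
  have hs : (0 : ℝ) < s := by positivity
  have h0 : 0 < e + G ^ 2 * s := by positivity
  have h1 : tolerance γ G e k (t + 1) ≤ γ / (2 * k * 2 * (G ^ 2 * s + e) * s ^ 2) :=
    min_le_left _ _
  refine (mul_le_mul_of_nonneg_left h1 h0.le).trans ?_
  have e1 : (e + G ^ 2 * s) * (γ / (2 * k * 2 * (G ^ 2 * s + e) * s ^ 2)) = γ / (k * (4 * s ^ 2)) := by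
    rw [add_comm (G ^ 2 * s) e]; field_simp; norm_num
  rw [e1]
  have : 0 < 4 * s ^ 2 := by positivity
  exact div_le_div_of_nonneg_left hγ.le this (by nlinarith)

/-- Replacing the exact projection `v` by a point `w` with `‖w - v‖ ≤ ζ` changes the squared
distance to `z` by `2⟪A (w - v), v - z⟫ + (w - v)ᵀ A (w - v)`, which is at most `6 hi ζ`. The
tolerance makes this less than `2γ / (t + 1)²`. -/
theorem isNearProj_approxProj (hγ : 0 < γ) (hk : 1 ≤ k) (he : 0 < e) :
    IsNearProj (approxProj (d := d) γ G e k) G e fun t => 2 * γ / ((t + 1 : ℕ) : ℝ) ^ 2 where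
  norm_le t A u hA hu :=
    (fastProj_spec hA he (by nlinarith [sq_nonneg G, (Nat.cast_nonneg (t + 1) : (0 : ℝ) ≤ _)])
      hu (tolerance_pos hγ (by linarith) he t)).1.le
  mahaSq_le t A u hA hu z hz := by
    set hi := e + G ^ 2 * (t + 1 : ℕ) with hhi
    have hlh : e ≤ hi := by nlinarith [sq_nonneg G, (Nat.cast_nonneg (t + 1) : (0 : ℝ) ≤ _)]
    have hhi0 : 0 < hi := by linarith
    obtain ⟨h1, v, hv1, hv2, hv3⟩ := fastProj_spec hA he hlh hu
      (tolerance_pos (G := G) hγ (by linarith : 0 < k) he t)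
    have hζ := mul_tolerance_le (G := G) hγ hk he t
    have hp : approxProj γ G e k (t + 1) A u
      = fastProj A u 1 (tolerance γ G e k (t + 1)) e hi := rfl
    rw [hp]
    set ζ := tolerance γ G e k (t + 1)
    set w := fastProj A u 1 ζ e hi
    rw [← hhi] at hζ
    have h2 := mahaSq_pythagoras hA (hv2 z hz)
    have h3 := hA.mahaSq_nonneg he (u - v)
    have h4 := mahaSq_add hA (w - v) (v - z)
    rw [sub_add_sub_cancel] at h4
    rw [mem_domain] at hz
    have h5 : ‖v - z‖ ≤ 2 := (norm_sub_le _ _).trans (by linarith)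
    have h6 : ‖w - v‖ ≤ 2 := (norm_sub_le _ _).trans (by linarith)
    have h7 : mahaSq A (w - v) ≤ hi * ζ * 2 := by
      rw [mahaSq_eq_inner]
      refine (hA.upper _).trans ?_
      have : ‖w - v‖ ^ 2 ≤ ζ * 2 := by nlinarith [norm_nonneg (w - v)]
      nlinarith
    have h8 : inner ℝ (mulE A (w - v)) (v - z) ≤ hi * ζ * 2 := by
      refine (real_inner_le_norm _ _).trans ?_
      have := (hA.norm_mulE_le he hhi0 (w - v)).trans (mul_le_mul_of_nonneg_left hv3 hhi0.le)
      exact mul_le_mul this h5 (norm_nonneg _) ((norm_nonneg _).trans this)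
    have h9 : hi * ζ * 6 ≤ 2 * γ / ((t + 1 : ℕ) : ℝ) ^ 2 := by
      have : 2 * γ / ((t + 1 : ℕ) : ℝ) ^ 2 = γ / (4 * ((t + 1 : ℕ) : ℝ) ^ 2) * 8 := by
        field_simp; norm_num
      have h0 : 0 ≤ γ / (4 * ((t + 1 : ℕ) : ℝ) ^ 2) := by positivity
      rw [this]; nlinarith
    linarith

theorem sum_inv_sq_le (T : ℕ) : ∑ t ∈ Finset.range T, 1 / ((t + 1 : ℕ) : ℝ) ^ 2 ≤ 2 - 1 / (T : ℝ) := by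
  induction T with
  | zero => simp
  | succ n ih =>
    rw [Finset.sum_range_succ]
    -- The telescoping bound `1 / (n + 1)² ≤ 1 / n - 1 / (n + 1)` starts at `n = 1`, since `1 / 0`
    -- is read as `0`.
    rcases Nat.eq_zero_or_pos n with rfl | hn
    · norm_num
    · have hn' : (0 : ℝ) < n := by exact_mod_cast hn
      have : 1 / ((n + 1 : ℕ) : ℝ) ^ 2 ≤ 1 / n - 1 / ((n + 1 : ℕ) : ℝ) := by
        push_cast
        rw [div_sub_div _ _ (by positivity) (by positivity), div_le_div_iff₀ (by positivity)
          (by positivity)]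
        nlinarith
      linarith

end

/-! ### Invariants and potential of one round -/

section State

variable {proj : ProjRoutine d} {G e k γ : ℝ} {err : ℕ → ℝ} {grad : ℕ → E d → E d}

/-- The surrogate gradient of LightONS in round `t + 1`. -/
noncomputable def roundGrad (grad : ℕ → E d → E d) (t : ℕ) (s : State d) : E d :=
  surrogateGrad (grad t (euclProj (domain d) s.y)) (euclProj (domain d) s.y) s.y

/-- The preconditioner after round `t + 1`. -/
noncomputable def nextA (grad : ℕ → E d → E d) (t : ℕ) (s : State d) : Mat d :=
  s.A + Matrix.vecMulVec (roundGrad grad t s).ofLp (roundGrad grad t s).ofLp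

/-- The surrogate decision after round `t + 1`, before the projection. -/
noncomputable def nextY (γ : ℝ) (grad : ℕ → E d → E d) (t : ℕ) (s : State d) : E d :=
  s.y - (1 / γ) • mulE (nextA grad t s)⁻¹ (roundGrad grad t s)

theorem step_A (t : ℕ) (s : State d) : (step proj γ k grad t s).A = nextA grad t s := rfl

open Classical in
theorem step_y (t : ℕ) (s : State d) : (step proj γ k grad t s).y =
    if ‖nextY γ grad t s‖ ≤ k then nextY γ grad t s
    else proj (t + 1) (nextA grad t s) (nextY γ grad t s) := rfl

theorem norm_roundGrad_le (hgrad : ∀ t, ∀ x ∈ domain d, ‖grad t x‖ ≤ G) (t : ℕ) (s : State d) :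
    ‖roundGrad grad t s‖ ≤ G :=
  (norm_surrogateGrad_le _ _ _).trans (hgrad t _ (euclProj_mem _))

theorem eigBounds_nextA (hgrad : ∀ t, ∀ x ∈ domain d, ‖grad t x‖ ≤ G) {t : ℕ} {s : State d}
    (hs : EigBounds s.A e (e + G ^ 2 * t)) :
    EigBounds (nextA grad t s) e (e + G ^ 2 * (t + 1 : ℕ)) := by
  have := hs.add_vecMulVec (norm_roundGrad_le hgrad t s)
  have e1 : e + G ^ 2 * (t + 1 : ℕ) = e + G ^ 2 * t + G ^ 2 := by push_cast; ring
  rw [e1]; exact this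

theorem eigBounds_state (hgrad : ∀ t, ∀ x ∈ domain d, ‖grad t x‖ ≤ G) (t : ℕ) :
    EigBounds (state proj γ e k grad t).A e (e + G ^ 2 * t) := by
  induction t with
  | zero => simpa [state] using EigBounds.smul_one (d := d) e
  | succ t ih =>
    simp only [state, step_A]
    exact eigBounds_nextA hgrad ih

theorem norm_state_le (hproj : IsNearProj proj G e err) (hk : 1 ≤ k)
    (hgrad : ∀ t, ∀ x ∈ domain d, ‖grad t x‖ ≤ G) (t : ℕ) :
    ‖(state proj γ e k grad t).y‖ ≤ k := by
  induction t with
  | zero => simp [state]; linarith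
  | succ t ih =>
    simp only [state, step_y]
    split_ifs with h
    · exact h
    · push Not at h
      exact (hproj.norm_le t _ _ (eigBounds_nextA hgrad (eigBounds_state hgrad t))
        (by linarith)).trans hk

theorem mahaSq_step_le (hproj : IsNearProj proj G e err) (hk : 1 ≤ k) (herr : ∀ t, 0 ≤ err t)
    (hgrad : ∀ t, ∀ x ∈ domain d, ‖grad t x‖ ≤ G) {t : ℕ} {s : State d}
    (hs : EigBounds s.A e (e + G ^ 2 * t)) {u : E d} (hu : u ∈ domain d) :
    mahaSq (nextA grad t s) ((step proj γ k grad t s).y - u)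
      ≤ mahaSq (nextA grad t s) (nextY γ grad t s - u) + err t := by
  rw [step_y]
  split_ifs with h
  · linarith [herr t]
  · push Not at h
    exact hproj.mahaSq_le t _ _ (eigBounds_nextA hgrad hs) (by linarith) u hu

/-- Expand the square of the Newton step. The rank-one update contributes `⟪h, y - u⟫²`, and the
preconditioner cancels its inverse in the cross term. -/
theorem mahaSq_nextY (he : 0 < e) (hγ : 0 < γ)
    (hgrad : ∀ t, ∀ x ∈ domain d, ‖grad t x‖ ≤ G) {t : ℕ} {s : State d}
    (hs : EigBounds s.A e (e + G ^ 2 * t)) (u : E d) :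
    mahaSq (nextA grad t s) (nextY γ grad t s - u) =
      mahaSq s.A (s.y - u) + inner ℝ (roundGrad grad t s) (s.y - u) ^ 2
        - 2 / γ * inner ℝ (roundGrad grad t s) (s.y - u)
        + 1 / γ ^ 2 * inner ℝ (roundGrad grad t s)
            (mulE (nextA grad t s)⁻¹ (roundGrad grad t s)) := by
  have hA := eigBounds_nextA hgrad hs
  set h := roundGrad grad t s with hh
  have e1 : nextY γ grad t s - u = (s.y - u) + (-(1 / γ)) • mulE (nextA grad t s)⁻¹ h := by
    rw [nextY, neg_smul]; abel
  have e2 : mahaSq (nextA grad t s) (s.y - u)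
      = mahaSq s.A (s.y - u) + inner ℝ h (s.y - u) ^ 2 := by
    rw [mahaSq_eq_inner, nextA, add_mulE, inner_add_right, ← mahaSq_eq_inner, ← hh,
      vecMulVec_mulE, inner_smul_right, real_inner_comm h (s.y - u), sq]
  rw [e1, mahaSq_add hA, e2, inner_smul_right, ← hA.inner_mulE, hA.mulE_inv he,
    mahaSq_eq_inner _ ((-(1 / γ)) • _), mulE_smul, hA.mulE_inv he, inner_smul_left,
    inner_smul_right, real_inner_comm h (s.y - u),
    real_inner_comm h (mulE _ _)]
  simp only [conj_trivial]
  field_simp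
  ring

/-- The potential inequality of one round. -/
theorem inner_roundGrad_le (hproj : IsNearProj proj G e err) (hk : 1 ≤ k) (he : 0 < e)
    (herr : ∀ t, 0 ≤ err t) (hγ : 0 < γ)
    (hgrad : ∀ t, ∀ x ∈ domain d, ‖grad t x‖ ≤ G) {t : ℕ} {s : State d}
    (hs : EigBounds s.A e (e + G ^ 2 * t)) {u : E d} (hu : u ∈ domain d) :
    inner ℝ (roundGrad grad t s) (s.y - u) - γ / 2 * inner ℝ (roundGrad grad t s) (s.y - u) ^ 2
      ≤ γ / 2 * (mahaSq s.A (s.y - u)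
          - mahaSq (step proj γ k grad t s).A ((step proj γ k grad t s).y - u))
        + 1 / (2 * γ) * (Real.log (step proj γ k grad t s).A.det - Real.log s.A.det)
        + γ / 2 * err t := by
  have h1 := mahaSq_step_le (γ := γ) hproj hk herr hgrad hs hu
  have h2 := mahaSq_nextY he hγ hgrad hs u
  have h3 := inner_inv_le_log_det hs he (roundGrad grad t s)
  rw [step_A]
  rw [h2] at h1
  change inner ℝ _ (mulE (nextA grad t s)⁻¹ _) ≤ Real.log (nextA grad t s).det - _ at h3
  set a : ℝ := inner ℝ (roundGrad grad t s) (s.y - u)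
  set b : ℝ := inner ℝ (roundGrad grad t s) (mulE (nextA grad t s)⁻¹ (roundGrad grad t s))
  have h4 := mul_le_mul_of_nonneg_left h1 (by positivity : 0 ≤ γ / 2)
  have h5 := mul_le_mul_of_nonneg_left h3 (by positivity : 0 ≤ 1 / (2 * γ))
  have e1 : γ / 2 * (mahaSq s.A (s.y - u) + a ^ 2 - 2 / γ * a + 1 / γ ^ 2 * b + err t)
      = γ / 2 * mahaSq s.A (s.y - u) + γ / 2 * a ^ 2 - a + 1 / (2 * γ) * b + γ / 2 * err t := by
    field_simp
  rw [e1] at h4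
  linarith

theorem trace_state_le (hgrad : ∀ t, ∀ x ∈ domain d, ‖grad t x‖ ≤ G) (t : ℕ) :
    (state proj γ e k grad t).A.trace ≤ d * e + G ^ 2 * t := by
  induction t with
  | zero => simp [state, Matrix.trace_smul, mul_comm]
  | succ t ih =>
    simp only [state, step_A, nextA, Matrix.trace_add, Matrix.trace_vecMulVec]
    rw [← inner_eq_dotProduct, real_inner_self_eq_norm_sq]
    have := norm_roundGrad_le hgrad t (state proj γ e k grad t)
    have : ‖roundGrad grad t (state proj γ e k grad t)‖ ^ 2 ≤ G ^ 2 := by gcongr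
    push_cast
    linarith

/-- The trace grows by at most `G²` per round; the arithmetic-geometric mean inequality turns this
into a bound on the determinant. -/
theorem log_det_state_le (hd : 1 ≤ d) (he : 0 < e)
    (hgrad : ∀ t, ∀ x ∈ domain d, ‖grad t x‖ ≤ G) (t : ℕ) :
    Real.log (state proj γ e k grad t).A.det - Real.log (state proj γ e k grad 0).A.det
      ≤ d * Real.log (1 + G ^ 2 / (d * e) * t) := by
  have hd' : (0 : ℝ) < d := by exact_mod_cast hd
  have hA := (eigBounds_state (proj := proj) (γ := γ) (e := e) (k := k) hgrad t).posDef he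
  have h1 := log_det_le hd hA
  have h2 := trace_state_le (proj := proj) (γ := γ) (e := e) (k := k) hgrad t
  have h3 : Real.log (state proj γ e k grad 0).A.det = d * Real.log e := by
    simp [state]
  have h4 : 0 < (state proj γ e k grad t).A.trace := by
    have : Nonempty (Fin d) := ⟨⟨0, hd⟩⟩
    exact hA.trace_pos
  have h5 : Real.log ((state proj γ e k grad t).A.trace / d)
      ≤ Real.log (e * (1 + G ^ 2 / (d * e) * t)) := by
    refine Real.log_le_log (by positivity) ?_
    rw [div_le_iff₀ hd']
    refine h2.trans (le_of_eq ?_)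
    field_simp
  rw [Real.log_mul he.ne' (by positivity)] at h5
  rw [h3]
  have := mul_le_mul_of_nonneg_left h5 hd'.le
  linarith

end State

theorem domain_nonempty : (domain d).Nonempty := ⟨0, by simp [domain]⟩

theorem regret_le {Ξ : Type*} {f : E d → Ξ → ℝ} {z : ℕ → Ξ} {x : ℕ → E d} {T : ℕ} {B : ℝ}
    (h : ∀ u ∈ domain d, ∑ t ∈ Finset.range T, f (x t) (z t) - ∑ t ∈ Finset.range T, f u (z t) ≤ B) :
    regret f z x T ≤ B := by
  unfold regret
  have : ∑ t ∈ Finset.range T, f (x t) (z t) - B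
      ≤ sInf ((fun u => ∑ t ∈ Finset.range T, f u (z t)) '' domain d) := by
    refine le_csInf (domain_nonempty.image _) ?_
    rintro _ ⟨u, hu, rfl⟩
    have := h u hu
    simp only
    linarith
  linarith

section Regret

variable {Ξ : Type*} [MeasurableSpace Ξ] {α G k e : ℝ} {P : Measure Ξ} {f : E d → Ξ → ℝ}
  {proj : ProjRoutine d} {err : ℕ → ℝ}

theorem IsStochasticLoss.norm_oracle_le (hf : IsStochasticLoss α G P f) (z : ℕ → Ξ) :
    ∀ t, ∀ x ∈ domain d, ‖oracle f z t x‖ ≤ G := fun t x hx => hf.lipschitz (z t) x hx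

theorem decision_mem (γ e k : ℝ) (proj : ProjRoutine d) (grad : ℕ → E d → E d) (t : ℕ) :
    decision proj γ e k grad t ∈ domain d := euclProj_mem _

/-- Sums the potential inequality over the rounds. The link to the true losses is that `s - γ/2 s²`
increases for `s ≤ 1/γ`, a range guaranteed by `k ≤ 3`. -/
theorem sum_sub_le (hd : 1 ≤ d) (hf : IsStochasticLoss α G P f) (hα : 0 < α) (hG : 0 < G)
    (hk : 1 ≤ k) (hk3 : k ≤ 3) (he : 0 < e) (hproj : IsNearProj proj G e err)
    (herr : ∀ t, 0 ≤ err t) (z : ℕ → Ξ) (T : ℕ) {u : E d} (hu : u ∈ domain d) :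
    ∑ t ∈ Finset.range T, f (decision proj (gamma0 α G) e k (oracle f z) t) (z t)
      - ∑ t ∈ Finset.range T, f u (z t)
      ≤ regretBound α G e d T + gamma0 α G / 2 * ∑ t ∈ Finset.range T, err t := by
  set γ := gamma0 α G with hγ
  have hγ0 : 0 < γ := gamma0_pos hα hG
  have hγG := four_mul_gamma0_mul_le α hG
  rw [← hγ] at hγG
  have hgrad := hf.norm_oracle_le z
  set s := state proj γ e k (oracle f z) with hs
  have hA : ∀ t, EigBounds (s t).A e (e + G ^ 2 * t) := eigBounds_state hgrad
  have hy : ∀ t, ‖(s t).y‖ ≤ k := norm_state_le hproj hk hgrad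
  have key : ∀ t, f (decision proj γ e k (oracle f z) t) (z t) - f u (z t) ≤
      γ / 2 * (mahaSq (s t).A ((s t).y - u) - mahaSq (s (t + 1)).A ((s (t + 1)).y - u))
        + 1 / (2 * γ) * (Real.log (s (t + 1)).A.det - Real.log (s t).A.det)
        + γ / 2 * err t := by
    intro t
    refine le_trans ?_ (inner_roundGrad_le hproj hk he herr hγ0 hgrad (hA t) hu)
    refine (hf.le_loss hα hG (z t) (decision_mem ..) hu).trans ?_
    rw [← hγ]
    set a : ℝ := inner ℝ (lossGrad f (z t) (decision proj γ e k (oracle f z) t))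
      (decision proj γ e k (oracle f z) t - u) with ha
    set b : ℝ := inner ℝ (roundGrad (oracle f z) t (s t)) ((s t).y - u) with hb
    have hab : a ≤ b := inner_le_inner_surrogateGrad _ _ hu
    have hbG : b ≤ G * 4 := by
      refine (real_inner_le_norm _ _).trans ?_
      have h1 := norm_roundGrad_le hgrad t (s t)
      have h2 : ‖(s t).y - u‖ ≤ 4 := by
        rw [mem_domain] at hu
        exact (norm_sub_le _ _).trans (by linarith [hy t])
      gcongr
    have h3 : γ * b ≤ 1 := by nlinarith
    have h4 : γ * a ≤ 1 := by nlinarith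
    -- `(b - γ/2 b²) - (a - γ/2 a²) = (b - a) (2 - γ a - γ b) / 2`.
    nlinarith [mul_nonneg (sub_nonneg.2 hab) (by linarith : 0 ≤ 2 - γ * a - γ * b)]
  rw [← Finset.sum_sub_distrib]
  refine (Finset.sum_le_sum fun t _ => key t).trans ?_
  rw [Finset.sum_add_distrib, Finset.sum_add_distrib, ← Finset.mul_sum, ← Finset.mul_sum,
    ← Finset.mul_sum, Finset.sum_range_sub', Finset.sum_range_sub (fun t => Real.log (s t).A.det)]
  have h1 := log_det_state_le (proj := proj) (γ := γ) (k := k) hd he hgrad T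
  -- The start is the centre of the ball, so the initial potential is at most `e`; `γ/2 * e` is the
  -- last term of the regret bound.
  have h2 : mahaSq (s 0).A ((s 0).y - u) ≤ e := by
    rw [mem_domain] at hu
    have : (s 0).A = e • (1 : Mat d) := rfl
    rw [mahaSq_eq_inner, this, smul_one_mulE, inner_smul_right, real_inner_self_eq_norm_sq]
    have : (s 0).y - u = -u := by simp [hs, state]
    rw [this, norm_neg]
    have : ‖u‖ ^ 2 ≤ 1 := by nlinarith [norm_nonneg u]
    nlinarith
  have h3 := (hA T).mahaSq_nonneg he ((s T).y - u)
  rw [regretBound, ← hγ]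
  have h4 := mul_le_mul_of_nonneg_left h1 (by positivity : 0 ≤ 1 / (2 * γ))
  have h5 : γ / 2 * (mahaSq (s 0).A ((s 0).y - u) - mahaSq (s T).A ((s T).y - u)) ≤ γ / 2 * e := by
    gcongr; linarith
  have e1 : 1 / (2 * γ) * (d * Real.log (1 + G ^ 2 / (d * e) * T))
      = d / (2 * γ) * Real.log (1 + G ^ 2 / (d * e) * T) := by ring
  rw [e1] at h4
  linarith

theorem regret_exactProj_le (hd : 1 ≤ d) (hf : IsStochasticLoss α G P f) (hα : 0 < α) (hG : 0 < G)
    (hk : 1 ≤ k) (hk3 : k ≤ 3) (he : 0 < e) (z : ℕ → Ξ) (T : ℕ) :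
    regret f z (decision exactProj (gamma0 α G) e k (oracle f z)) T ≤ regretBound α G e d T := by
  refine regret_le fun u hu => ?_
  simpa using sum_sub_le hd hf hα hG hk hk3 he (isNearProj_exactProj he) (fun _ => le_rfl) z T hu

/-- The constant is `γ/2 * ∑ 2γ / t²`, with `∑ 1 / t² ≤ 2`. -/
theorem regret_approxProj_le (hd : 1 ≤ d) (hf : IsStochasticLoss α G P f) (hα : 0 < α) (hG : 0 < G)
    (hk : 1 ≤ k) (hk3 : k ≤ 3) (he : 0 < e) (z : ℕ → Ξ) (T : ℕ) :
    regret f z (decision (approxProj (gamma0 α G) G e k) (gamma0 α G) e k (oracle f z)) T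
      ≤ regretBound α G e d T + 2 * gamma0 α G ^ 2 := by
  have hγ := gamma0_pos hα hG
  refine regret_le fun u hu => ?_
  refine (sum_sub_le hd hf hα hG hk hk3 he (isNearProj_approxProj hγ hk he)
    (fun _ => by positivity) z T hu).trans ?_
  have h1 := sum_inv_sq_le T
  have h2 : (0 : ℝ) ≤ 1 / T := by positivity
  have h3 : ∑ t ∈ Finset.range T, 2 * gamma0 α G / ((t + 1 : ℕ) : ℝ) ^ 2
      = 2 * gamma0 α G * ∑ t ∈ Finset.range T, 1 / ((t + 1 : ℕ) : ℝ) ^ 2 := by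
    rw [Finset.mul_sum]
    exact Finset.sum_congr rfl fun t _ => by ring
  rw [h3]
  nlinarith [mul_pos hγ hγ]

end Regret

/-! ### Measurability of the decisions -/

section Measurability

variable {Ω : Type*} [MeasurableSpace Ω]

theorem measurable_euclidean_iff {g : Ω → E d} :
    Measurable g ↔ ∀ i, Measurable fun ω => g ω i := by
  constructor
  · intro h i
    exact (EuclideanSpace.proj (𝕜 := ℝ) i).continuous.measurable.comp h
  · intro h
    have : Measurable fun ω => (g ω).ofLp := measurable_pi_lambda _ h
    exact (WithLp.measurable_toLp 2 (Fin d → ℝ)).comp this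

/-- All the entries of a random matrix are measurable. -/
def EntryMeasurable (A : Ω → Mat d) : Prop := ∀ i j, Measurable fun ω => A ω i j

theorem EntryMeasurable.det {A : Ω → Mat d} (hA : EntryMeasurable A) :
    Measurable fun ω => (A ω).det := by
  simp only [Matrix.det_apply]
  refine Finset.measurable_sum _ fun σ _ => ?_
  exact (Finset.measurable_prod _ fun i _ => hA _ _).const_smul _

theorem EntryMeasurable.inv {A : Ω → Mat d} (hA : EntryMeasurable A) :
    EntryMeasurable fun ω => (A ω)⁻¹ := by
  intro i j
  simp only [Matrix.inv_def, Matrix.smul_apply, Ring.inverse_eq_inv, smul_eq_mul,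
    Matrix.adjugate_apply]
  refine hA.det.inv.mul (EntryMeasurable.det fun a b => ?_)
  simp only [Matrix.updateRow_apply]
  split_ifs
  · exact measurable_const
  · exact hA _ _

theorem EntryMeasurable.mulE {A : Ω → Mat d} (hA : EntryMeasurable A) {u : Ω → E d}
    (hu : Measurable u) : Measurable fun ω => mulE (A ω) (u ω) := by
  rw [measurable_euclidean_iff] at hu ⊢
  intro i
  simp only [SXO.mulE, Matrix.mulVec, dotProduct]
  exact Finset.measurable_sum _ fun j _ => (hA i j).mul (hu j)

theorem EntryMeasurable.shrink {A : Ω → Mat d} (hA : EntryMeasurable A) {u : Ω → E d}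
    (hu : Measurable u) {m : Ω → ℝ} (hm : Measurable m) :
    Measurable fun ω => shrink (A ω) (u ω) (m ω) := by
  refine EntryMeasurable.mulE (EntryMeasurable.inv fun i j => ?_) (hA.mulE hu)
  simp only [Matrix.add_apply, Matrix.smul_apply, smul_eq_mul]
  exact (hA i j).add (hm.mul_const _)

theorem EntryMeasurable.iterate_bisectStep {A : Ω → Mat d} (hA : EntryMeasurable A) {u : Ω → E d}
    (hu : Measurable u) (R : ℝ) (n : ℕ) {q : Ω → ℝ × ℝ} (hq : Measurable q) :
    Measurable fun ω => (bisectStep (A ω) (u ω) R)^[n] (q ω) := by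
  induction n generalizing q with
  | zero => simpa using hq
  | succ n ih =>
    simp only [Function.iterate_succ_apply]
    refine ih ?_
    have hm : Measurable fun ω => ((q ω).1 + (q ω).2) / 2 := (hq.fst.add hq.snd).div_const 2
    unfold bisectStep
    refine Measurable.ite ?_ (hm.prodMk hq.snd) (hq.fst.prodMk hm)
    exact measurableSet_le measurable_const (((hA.shrink hu hm).norm.pow_const 2).sub_const _)

theorem measurable_bisectCount (R ζ lo hi : ℝ) : Measurable fun r => bisectCount r R ζ lo hi := by
  unfold bisectCount
  refine Nat.measurable_ceil.comp ?_
  simp only [Real.logb]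
  fun_prop

/-- Needed because the number of bisection steps is itself random. -/
theorem measurable_nat_index {β : Type*} [MeasurableSpace β] {g : ℕ → Ω → β}
    (hg : ∀ n, Measurable (g n)) {n : Ω → ℕ} (hn : Measurable n) :
    Measurable fun ω => g (n ω) ω := by
  have h1 : Measurable fun p : Ω × ℕ => g p.2 p.1 := measurable_from_prod_countable_left hg
  exact h1.comp (measurable_id.prodMk hn)

theorem EntryMeasurable.fastProj {A : Ω → Mat d} (hA : EntryMeasurable A) {u : Ω → E d}
    (hu : Measurable u) (R ζ lo hi : ℝ) :
    Measurable fun ω => fastProj (A ω) (u ω) R ζ lo hi := by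
  have hq0 : Measurable fun ω => ((‖u ω‖ / R - 1) * lo, (‖u ω‖ / R - 1) * hi) := by
    have := hu.norm
    fun_prop
  have hq : Measurable fun ω => (bisectStep (A ω) (u ω) R)^[bisectCount ‖u ω‖ R ζ lo hi]
      ((‖u ω‖ / R - 1) * lo, (‖u ω‖ / R - 1) * hi) := by
    exact measurable_nat_index (g := fun n ω => (bisectStep (A ω) (u ω) R)^[n]
      ((‖u ω‖ / R - 1) * lo, (‖u ω‖ / R - 1) * hi))
      (fun n => hA.iterate_bisectStep hu R n hq0) ((measurable_bisectCount R ζ lo hi).comp hu.norm)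
  have hw := hA.shrink hu ((hq.fst.add hq.snd).div_const 2)
  exact (measurable_const.div hw.norm).smul hw

theorem measurable_euclProj : Measurable fun y : E d => euclProj (domain d) y := by
  have : (fun y : E d => euclProj (domain d) y)
      = fun y => if ‖y‖ ≤ 1 then y else (1 / ‖y‖) • y := by
    funext y
    split_ifs with h
    · exact euclProj_of_norm_le h
    · exact euclProj_of_one_lt (not_le.1 h)
  rw [this]
  refine Measurable.ite (measurableSet_le measurable_norm measurable_const) measurable_id ?_
  exact (measurable_const.div measurable_norm).smul measurable_id

theorem measurable_surrogateGrad {g x y : Ω → E d} (hg : Measurable g) (hx : Measurable x)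
    (hy : Measurable y) : Measurable fun ω => surrogateGrad (g ω) (x ω) (y ω) := by
  unfold surrogateGrad
  have h1 := hy.sub hx
  have h2 : Measurable fun ω => (inner ℝ (g ω) (y ω - x ω) : ℝ) := hg.inner h1
  exact hg.add (((measurable_const.max h2.neg).div (h1.norm.pow_const 2)).smul h1)

open Classical in
theorem measurable_ite_approxProj {γ G e k : ℝ} (t : ℕ) {A : Ω → Mat d} (hA : EntryMeasurable A)
    {u : Ω → E d} (hu : Measurable u) :
    Measurable fun ω => if ‖u ω‖ ≤ k then u ω else approxProj γ G e k (t + 1) (A ω) (u ω) :=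
  Measurable.ite (measurableSet_le hu.norm measurable_const) hu (hA.fastProj hu _ _ _ _)

open Classical in
-- The exact projection is given by an unspecified choice, hence by no measurable formula; it is the
-- pointwise limit of FastProj with tolerances `1 / (n + 1)`.
theorem measurable_ite_exactProj {G e k : ℝ} (he : 0 < e) (hk : 1 ≤ k) (t : ℕ) {A : Ω → Mat d}
    (hA : EntryMeasurable A) (hB : ∀ ω, EigBounds (A ω) e (e + G ^ 2 * (t + 1 : ℕ)))
    {u : Ω → E d} (hu : Measurable u) :
    Measurable fun ω => if ‖u ω‖ ≤ k then u ω else exactProj (t + 1) (A ω) (u ω) := by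
  refine measurable_of_tendsto_metrizable (f := fun (n : ℕ) ω => if ‖u ω‖ ≤ k then u ω
    else fastProj (A ω) (u ω) 1 (1 / ((n : ℝ) + 1)) e (e + G ^ 2 * (t + 1 : ℕ))) (fun n =>
    Measurable.ite (measurableSet_le hu.norm measurable_const) hu (hA.fastProj hu _ _ _ _)) ?_
  rw [tendsto_pi_nhds]
  intro ω
  by_cases h : ‖u ω‖ ≤ k
  · simp only [h, if_true]; exact tendsto_const_nhds
  · simp only [h, if_false]
    rw [tendsto_iff_norm_sub_tendsto_zero]
    refine squeeze_zero (fun _ => norm_nonneg _) (fun n => ?_)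
      (tendsto_one_div_add_atTop_nhds_zero_nat (𝕜 := ℝ))
    push Not at h
    exact (exists_exactProj (hB ω) he
      (by nlinarith [sq_nonneg G, (Nat.cast_nonneg (t + 1) : (0 : ℝ) ≤ _)])
      (by linarith) (by positivity)).2.2

variable {Ξ : Type*} [MeasurableSpace Ξ] {α G e k γ : ℝ} {P : Measure Ξ} {f : E d → Ξ → ℝ}
  {proj : ProjRoutine d}

theorem IsStochasticLoss.measurable_lossGrad (hf : IsStochasticLoss α G P f) {x : Ω → E d}
    (hx : Measurable x) (hxd : ∀ ω, x ω ∈ domain d) {z : Ω → Ξ} (hz : Measurable z) :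
    Measurable fun ω => lossGrad f (z ω) (x ω) :=
  hf.measurable_grad.comp ((hx.subtype_mk (h := hxd)).prodMk hz)

/-- Measurability is required only of the samples before round `t`, so that the σ-algebra on `Ω` can
later be the one generated by these samples. -/
theorem measurable_state (hf : IsStochasticLoss α G P f) (he : 0 < e) (hk : 1 ≤ k)
    (hproj : proj = exactProj ∨ proj = approxProj γ G e k) {z : ℕ → Ω → Ξ} {t : ℕ}
    (hz : ∀ i < t, Measurable (z i)) :
    EntryMeasurable (fun ω => (state proj γ e k (oracle f fun i => z i ω) t).A) ∧
      Measurable fun ω => (state proj γ e k (oracle f fun i => z i ω) t).y := by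
  induction t with
  | zero => exact ⟨fun i j => measurable_const, measurable_const⟩
  | succ t ih =>
    obtain ⟨hA, hy⟩ := ih fun i hi => hz i (by omega)
    have hx := measurable_euclProj.comp hy
    have hh : Measurable fun ω => roundGrad (oracle f fun i => z i ω) t
        (state proj γ e k (oracle f fun i => z i ω) t) :=
      measurable_surrogateGrad (hf.measurable_lossGrad hx (fun ω => euclProj_mem _)
        (hz t (by omega))) hx hy
    have hA' : EntryMeasurable fun ω => nextA (oracle f fun i => z i ω) t
        (state proj γ e k (oracle f fun i => z i ω) t) := by
      intro i j
      simp only [nextA, Matrix.add_apply, Matrix.vecMulVec_apply]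
      exact (hA i j).add ((measurable_euclidean_iff.1 hh i).mul (measurable_euclidean_iff.1 hh j))
    have hy' : Measurable fun ω => nextY γ (oracle f fun i => z i ω) t
        (state proj γ e k (oracle f fun i => z i ω) t) :=
      hy.sub ((hA'.inv.mulE hh).const_smul (1 / γ))
    refine ⟨hA', ?_⟩
    simp only [state, step_y]
    rcases hproj with rfl | rfl
    · exact measurable_ite_exactProj he hk t hA' (fun ω => eigBounds_nextA
        (hf.norm_oracle_le fun i => z i ω) (eigBounds_state (hf.norm_oracle_le fun i => z i ω) t)) hy'
    · exact measurable_ite_approxProj t hA' hy'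

theorem measurable_decision (hf : IsStochasticLoss α G P f) (he : 0 < e) (hk : 1 ≤ k)
    (hproj : proj = exactProj ∨ proj = approxProj γ G e k) {z : ℕ → Ω → Ξ} {t : ℕ}
    (hz : ∀ i < t, Measurable (z i)) :
    Measurable fun ω => decision proj γ e k (oracle f fun i => z i ω) t :=
  measurable_euclProj.comp (measurable_state hf he hk hproj hz).2

end Measurability

/-! ### Elementary inequalities -/

/-- For negative `t` compare with `(1 + t/8)^8 ≤ exp t`, in two stages: first a quadratic lower
bound for the fourth power, then its square. -/
theorem one_add_add_sq_div_three_le_exp {t : ℝ} (h : -1 ≤ t) :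
    1 + t + t ^ 2 / 3 ≤ Real.exp t := by
  rcases le_or_gt 0 t with h0 | h0
  · have := Real.quadratic_le_exp_of_nonneg h0
    nlinarith [sq_nonneg t]
  · have h1 : 1 + t / 8 ≤ Real.exp (t / 8) := by
      have := Real.add_one_le_exp (t / 8); linarith
    have h2 : (1 + t / 8) ^ 4 ≤ Real.exp (t / 8) ^ 4 := pow_le_pow_left₀ (by linarith) h1 4
    have h3 : 1 + t / 2 + 11 / 128 * t ^ 2 ≤ (1 + t / 8) ^ 4 := by
      have e : (1 + t / 8) ^ 4 - (1 + t / 2 + 11 / 128 * t ^ 2)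
        = t ^ 2 * ((1 + t) / 128) + t ^ 4 / 4096 := by ring
      have : 0 ≤ t ^ 2 * ((1 + t) / 128) + t ^ 4 / 4096 := by
        have : 0 ≤ 1 + t := by linarith
        positivity
      linarith
    have h4 : 0 ≤ 1 + t / 2 + 11 / 128 * t ^ 2 := by nlinarith [sq_nonneg t]
    have h5 : (1 + t / 2 + 11 / 128 * t ^ 2) ^ 2 ≤ (Real.exp (t / 8) ^ 4) ^ 2 :=
      pow_le_pow_left₀ h4 (h3.trans h2) 2
    have h6 : (Real.exp (t / 8) ^ 4) ^ 2 = Real.exp t := by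
      rw [← pow_mul, ← Real.exp_nat_mul]; congr 1; push_cast; ring
    rw [h6] at h5
    refine le_trans ?_ h5
    have e : (1 + t / 2 + 11 / 128 * t ^ 2) ^ 2 - (1 + t + t ^ 2 / 3)
        = t ^ 2 * (11 / 128 * (1 + t) + 1 / 384 + (11 / 128) ^ 2 * t ^ 2) := by ring
    have : 0 ≤ t ^ 2 * (11 / 128 * (1 + t) + 1 / 384 + (11 / 128) ^ 2 * t ^ 2) := by
      have : 0 ≤ 1 + t := by linarith
      positivity
    linarith

/-- Taylor's bound `1 - s y + s² y²` combined with `y² ≤ 3 (exp (-y) - 1 + y)`. Under the central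
condition the last expression has expectation at most that of `y`, so the second-order term is
controlled by the mean. -/
theorem exp_neg_mul_le {s y : ℝ} (hs0 : 0 ≤ s) (hs1 : s ≤ 1) (hy : |y| ≤ 1) :
    Real.exp (-(s * y)) ≤ 1 - s * y + 3 * s ^ 2 * (Real.exp (-y) - 1 + y) := by
  have h1 : |-(s * y)| ≤ 1 := by
    rw [abs_neg, abs_mul, abs_of_nonneg hs0]
    nlinarith [abs_nonneg y]
  have h2 := (abs_le.1 (Real.abs_exp_sub_one_sub_id_le h1)).2
  have h3 := one_add_add_sq_div_three_le_exp (t := -y) (by linarith [(abs_le.1 hy).2])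
  have h4 := mul_le_mul_of_nonneg_left h3 (by positivity : 0 ≤ 3 * s ^ 2)
  nlinarith

/-- Choosing the best of the scales `2⁻ⁱ` in a family of deviation inequalities. -/
theorem le_of_dyadic_deviation {σ r L T : ℝ} (hT : 3 ≤ T) (hL : 1 ≤ L) (hσ0 : 0 ≤ σ) (hσ : σ ≤ T)
    (h : ∀ i ≤ ⌈Real.log T⌉₊, (1 / 2) ^ i * (σ - r) - 3 * ((1 / 2) ^ i) ^ 2 * σ ≤ L) :
    σ ≤ r + 4 * √(r * L) + 16 * L := by
  have hs : 0 ≤ √(r * L) := Real.sqrt_nonneg _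
  rcases lt_or_ge σ L with hσL | hσL
  -- Here `r` may be negative; scale `i = 0` bounds it below by `-3 L`.
  · have := h 0 (Nat.zero_le _)
    simp at this
    linarith
  set y := √(σ / L) with hy
  have hL0 : 0 < L := by linarith
  have hy1 : 1 ≤ y := by
    rw [hy, Real.one_le_sqrt, one_le_div hL0]; exact hσL
  have hy0 : 0 < y := by linarith
  have hyσ : σ = y ^ 2 * L := by
    rw [hy, Real.sq_sqrt (by positivity)]; field_simp
  -- The best scale is of order `1 / y`; this `i` gives `y ≤ 2 ^ i ≤ 2 y`.
  set i := ⌈Real.logb 2 y⌉₊ with hi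
  have hlogy : 0 ≤ Real.logb 2 y := Real.logb_nonneg (by norm_num) hy1
  -- `logb 2 y = log (σ / L) / (2 log 2)`, and `2 log 2 ≥ 1`, `σ / L ≤ T`.
  have hiT : i ≤ ⌈Real.log T⌉₊ := by
    refine Nat.ceil_mono ?_
    rw [Real.logb, div_le_iff₀ (Real.log_pos (by norm_num)), hy, Real.log_sqrt (by positivity)]
    have h1 : Real.log (σ / L) ≤ Real.log T := by
      refine Real.log_le_log (div_pos (by linarith) hL0) ?_
      rw [div_le_iff₀ hL0]; nlinarith
    have h2 : (0.5 : ℝ) ≤ Real.log 2 := by linarith [Real.log_two_gt_d9]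
    have h3 : 0 ≤ Real.log T := Real.log_nonneg (by linarith)
    nlinarith
  have h2i : y ≤ 2 ^ i := by
    rw [← Real.rpow_natCast]
    calc y = 2 ^ Real.logb 2 y := by rw [Real.rpow_logb] <;> norm_num [hy0]
      _ ≤ _ := Real.rpow_le_rpow_of_exponent_le (by norm_num) (Nat.le_ceil _)
  have h2i' : (2 : ℝ) ^ i ≤ 2 * y := by
    rw [← Real.rpow_natCast]
    calc (2 : ℝ) ^ (i : ℝ) ≤ 2 ^ (Real.logb 2 y + 1) :=
          Real.rpow_le_rpow_of_exponent_le (by norm_num) (Nat.ceil_lt_add_one hlogy).le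
      _ = 2 * y := by
        rw [Real.rpow_add (by norm_num), Real.rpow_logb] <;> norm_num [hy0]; ring
  have hk := h i hiT
  set p : ℝ := 2 ^ i with hp
  have hp0 : 0 < p := by positivity
  have e1 : ((1 : ℝ) / 2) ^ i = 1 / p := by rw [hp, one_div_pow]
  rw [e1] at hk
  have hk2 : p * (σ - r) - 3 * σ ≤ L * p ^ 2 := by
    have := mul_le_mul_of_nonneg_right hk (by positivity : 0 ≤ p ^ 2)
    have e2 : (1 / p * (σ - r) - 3 * (1 / p) ^ 2 * σ) * p ^ 2 = p * (σ - r) - 3 * σ := by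
      field_simp
    linarith
  -- with `τ = y / p` this is `σ - r ≤ L y (3 τ + 1 / τ)`
  have hk3 : σ - r ≤ 4 * y * L := by
    -- Equivalent to `(p - y) (3 y - p) ≥ 0` after division by `L`.
    have h1 : 3 * (y ^ 2 * L) + L * p ^ 2 ≤ p * (4 * y * L) := by
      nlinarith [mul_nonneg (mul_nonneg (sub_nonneg.2 h2i) (by linarith : 0 ≤ 3 * y - p)) hL0.le]
    have h2 : p * (σ - r) ≤ p * (4 * y * L) := by rw [hyσ] at hk2 ⊢; linarith
    exact le_of_mul_le_mul_left h2 hp0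
  -- For `y > 4` the bound reads `r ≥ y (y - 4) L ≥ (y - 4)² L`, so `4 y L = 16 L + 4 (y - 4) L` is
  -- at most `16 L + 4 √(r L)`.
  rcases le_or_gt y 4 with hy4 | hy4
  · nlinarith
  · have h1 : (y - 4) * L ≤ √(r * L) := by
      refine Real.le_sqrt_of_sq_le ?_
      have : (y - 4) ^ 2 * L ≤ r := by nlinarith
      nlinarith
    nlinarith

/-! ### The expected loss -/

section Risk

variable {Ξ : Type*} [MeasurableSpace Ξ] {α G : ℝ} {P : Measure Ξ} [IsProbabilityMeasure P]
  {f : E d → Ξ → ℝ}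

theorem IsStochasticLoss.abs_risk_sub_le (hf : IsStochasticLoss α G P f) (hα : 0 < α) (hG : 0 < G)
    {x u : E d} (hx : x ∈ domain d) (hu : u ∈ domain d) :
    |risk P f x - risk P f u| ≤ G * ‖x - u‖ := by
  unfold risk
  rw [← integral_sub (hf.integrable_loss x hx) (hf.integrable_loss u hu), ← Real.norm_eq_abs]
  refine (norm_integral_le_of_norm_le_const (C := G * ‖x - u‖)
    (Filter.Eventually.of_forall fun z => ?_)).trans (by simp)
  exact hf.abs_sub_le hα hG z hx hu

theorem IsStochasticLoss.continuousOn_risk (hf : IsStochasticLoss α G P f) (hα : 0 < α)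
    (hG : 0 < G) : ContinuousOn (risk P f) (domain d) := by
  have : LipschitzOnWith (Real.toNNReal G) (risk P f) (domain d) := by
    refine LipschitzOnWith.of_dist_le_mul fun x hx u hu => ?_
    rw [Real.dist_eq, dist_eq_norm, Real.coe_toNNReal _ hG.le]
    exact hf.abs_risk_sub_le hα hG hx hu
  exact this.continuousOn

theorem IsStochasticLoss.exists_minimizer (hf : IsStochasticLoss α G P f) (hα : 0 < α)
    (hG : 0 < G) : ∃ u ∈ domain d, (∀ x ∈ domain d, risk P f u ≤ risk P f x) ∧
      sInf (risk P f '' domain d) = risk P f u := by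
  obtain ⟨u, hu, hmin⟩ := (isCompact_closedBall (0 : E d) 1).exists_isMinOn
    domain_nonempty (hf.continuousOn_risk hα hG)
  refine ⟨u, hu, fun x hx => hmin hx, ?_⟩
  refine IsLeast.csInf_eq ⟨⟨u, hu, rfl⟩, ?_⟩
  rintro _ ⟨x, hx, rfl⟩
  exact hmin hx

theorem integrable_of_abs_le {g : Ξ → ℝ} (hg : Measurable g) {C : ℝ} (h : ∀ z, |g z| ≤ C) :
    Integrable g P :=
  Integrable.of_bound hg.aestronglyMeasurable C (Filter.Eventually.of_forall h)

/-- The central condition: the exponential moment of the excess loss of any decision over a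
minimizer of the risk is at most one. -/
theorem IsStochasticLoss.integral_exp_le_one (hf : IsStochasticLoss α G P f) (hα : 0 < α)
    (hG : 0 < G) {u x : E d} (hu : u ∈ domain d) (hmin : ∀ x ∈ domain d, risk P f u ≤ risk P f x)
    (hx : x ∈ domain d) {η : ℝ} (hη : 0 < η) (hηα : η ≤ α) (hηG : η * (2 * G) ≤ 1) :
    ∫ z, Real.exp (-(η * (f x z - f u z))) ∂P ≤ 1 := by
  have hbd : ‖x - u‖ ≤ 2 := by
    rw [mem_domain] at hx hu
    exact (norm_sub_le _ _).trans (by linarith)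
  have hmeas : Measurable fun z => Real.exp (-(η * (f x z - f u z))) :=
    (((hf.measurable_loss x hx).sub (hf.measurable_loss u hu)).const_mul η).neg.exp
  have hint : Integrable (fun z => Real.exp (-(η * (f x z - f u z)))) P := by
    refine integrable_of_abs_le hmeas (C := Real.exp 1) fun z => ?_
    rw [abs_of_pos (Real.exp_pos _), Real.exp_le_exp]
    have h := (abs_le.1 (hf.abs_sub_le hα hG z hx hu)).1
    have : G * ‖x - u‖ ≤ 2 * G := by nlinarith
    nlinarith
  refine le_of_forall_pos_le_add fun ε hε => ?_
  -- `m` is the point at fraction `θ` of the segment from `u` to `x`. The estimate gives `E exp (…)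
  -- - 1 ≤ θ`, and `θ` is arbitrarily small.
  set θ := min ε 1 with hθ
  have hθ0 : 0 < θ := lt_min hε one_pos
  have hθ1 : θ ≤ 1 := min_le_right _ _
  have hconv : Convex ℝ (domain d) := convex_closedBall 0 1
  set m := (1 - θ) • u + θ • x with hm
  have hmd : m ∈ domain d := hconv hu hx (by linarith) hθ0.le (by ring)
  have hmu : ‖m - u‖ ≤ θ * 2 := by
    have : m - u = θ • (x - u) := by rw [hm, sub_smul, one_smul, smul_sub]; abel
    rw [this, norm_smul, Real.norm_of_nonneg hθ0.le]
    gcongr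
  -- Concavity of `exp (-η f)` at `m`, followed by a second-order Taylor bound whose error is `θ²`
  -- because `f m - f u` is of order `θ`. Minimality of `u` makes the linear term nonpositive in
  -- expectation.
  have hpt : ∀ z, θ * (Real.exp (-(η * (f x z - f u z))) - 1)
      ≤ -(η * (f m z - f u z)) + θ ^ 2 := by
    intro z
    have h1 := ((hf.expConcave z).mono hα hη.le hηα).2 hu hx (by linarith : 0 ≤ 1 - θ) hθ0.le
      (by ring)
    simp only [smul_eq_mul] at h1
    have h2 : 1 + θ * (Real.exp (-(η * (f x z - f u z))) - 1)
        ≤ Real.exp (-(η * (f m z - f u z))) := by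
      have e1 : ∀ w, Real.exp (-(η * (f w z - f u z)))
        = Real.exp (-η * f w z) / Real.exp (-η * f u z) := by
        intro w; rw [← Real.exp_sub]; congr 1; ring
      rw [e1, e1, le_div_iff₀ (Real.exp_pos _)]
      have := Real.exp_pos (-η * f u z)
      have e2 : (1 + θ * (Real.exp (-η * f x z) / Real.exp (-η * f u z) - 1))
          * Real.exp (-η * f u z)
          = (1 - θ) * Real.exp (-η * f u z) + θ * Real.exp (-η * f x z) := by
        field_simp; ring
      rw [e2]; exact h1
    have h3 : |-(η * (f m z - f u z))| ≤ θ := by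
      rw [abs_neg, abs_mul, abs_of_pos hη]
      have := hf.abs_sub_le hα hG z hmd hu
      have h4 : G * ‖m - u‖ ≤ G * (θ * 2) := by gcongr
      calc η * |f m z - f u z| ≤ η * (G * (θ * 2)) := by gcongr; linarith
        _ = η * (2 * G) * θ := by ring
        _ ≤ 1 * θ := by gcongr
        _ = θ := one_mul _
    have h4 := (abs_le.1 (Real.abs_exp_sub_one_sub_id_le (h3.trans hθ1))).2
    have h5 : (-(η * (f m z - f u z))) ^ 2 ≤ θ ^ 2 := by
      rw [← sq_abs]; gcongr
    linarith
  have hint2 : Integrable (fun z => -(η * (f m z - f u z)) + θ ^ 2) P :=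
    ((((hf.integrable_loss m hmd).sub (hf.integrable_loss u hu)).const_mul η).neg).add
      (integrable_const _)
  have h6 := integral_mono ((hint.sub (integrable_const 1)).const_mul θ) hint2 hpt
  have e3 : ∫ z, (-(η * (f m z - f u z)) + θ ^ 2) ∂P
      = -(η * (risk P f m - risk P f u)) + θ ^ 2 := by
    rw [integral_add ?_ (integrable_const _), integral_neg, integral_const_mul,
      integral_sub (hf.integrable_loss m hmd) (hf.integrable_loss u hu)]
    · simp [risk]
    · exact (((hf.integrable_loss m hmd).sub (hf.integrable_loss u hu)).const_mul η).neg
  have e4 : ∫ z, θ * (Real.exp (-(η * (f x z - f u z))) - 1) ∂P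
      = θ * (∫ z, Real.exp (-(η * (f x z - f u z))) ∂P - 1) := by
    rw [integral_const_mul, integral_sub hint (integrable_const _)]; simp
  have h6' : ∫ z, θ * (Real.exp (-(η * (f x z - f u z))) - 1) ∂P
      ≤ ∫ z, (-(η * (f m z - f u z)) + θ ^ 2) ∂P := h6
  rw [e3, e4] at h6'
  have h7 : 0 ≤ η * (risk P f m - risk P f u) :=
    mul_nonneg hη.le (by linarith [hmin m hmd])
  have h8 : θ * (∫ z, Real.exp (-(η * (f x z - f u z))) ∂P - 1) ≤ θ * θ := by nlinarith
  have h9 := le_of_mul_le_mul_left h8 hθ0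
  have : θ ≤ ε := min_le_left _ _
  linarith

/-- The factor of round `x`, `z` in the exponential supermartingale at scale `s`. -/
noncomputable def deviation (P : Measure Ξ) (f : E d → Ξ → ℝ) (η s : ℝ) (u x : E d) (z : Ξ) : ℝ :=
  s * (η * (risk P f x - risk P f u) - η * (f x z - f u z))
    - 3 * s ^ 2 * (η * (risk P f x - risk P f u))

/-- For `Y = η (f x - f u)` with mean `m`, the central condition yields `E exp (-s Y) ≤ 1 - s m + 3
s² m ≤ exp (-s m + 3 s² m)`; the remaining terms of `deviation` cancel this factor. -/
theorem IsStochasticLoss.lintegral_exp_deviation_le (hf : IsStochasticLoss α G P f) (hα : 0 < α)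
    (hG : 0 < G) {u x : E d} (hu : u ∈ domain d) (hmin : ∀ x ∈ domain d, risk P f u ≤ risk P f x)
    (hx : x ∈ domain d) {η : ℝ} (hη : 0 < η) (hηα : η ≤ α) (hηG : η * (2 * G) ≤ 1) {s : ℝ}
    (hs0 : 0 ≤ s) (hs1 : s ≤ 1) :
    ∫⁻ z, ENNReal.ofReal (Real.exp (deviation P f η s u x z)) ∂P ≤ 1 := by
  have hcent := hf.integral_exp_le_one hα hG hu hmin hx hη hηα hηG
  have hbd : ‖x - u‖ ≤ 2 := by
    rw [mem_domain] at hx hu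
    exact (norm_sub_le _ _).trans (by linarith)
  have hY : ∀ z, |η * (f x z - f u z)| ≤ 1 := by
    intro z
    rw [abs_mul, abs_of_pos hη]
    have := hf.abs_sub_le hα hG z hx hu
    have : G * ‖x - u‖ ≤ 2 * G := by nlinarith
    calc η * |f x z - f u z| ≤ η * (2 * G) := by gcongr; linarith
      _ ≤ 1 := hηG
  have hmY : Measurable fun z => η * (f x z - f u z) :=
    ((hf.measurable_loss x hx).sub (hf.measurable_loss u hu)).const_mul η
  have hiY : Integrable (fun z => η * (f x z - f u z)) P := integrable_of_abs_le hmY hY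
  have hie : Integrable (fun z => Real.exp (-(η * (f x z - f u z)))) P := by
    refine integrable_of_abs_le hmY.neg.exp (C := Real.exp 1) fun z => ?_
    rw [abs_of_pos (Real.exp_pos _), Real.exp_le_exp]
    linarith [(abs_le.1 (hY z)).1]
  set m := η * (risk P f x - risk P f u) with hm
  have hmE : ∫ z, η * (f x z - f u z) ∂P = m := by
    rw [integral_const_mul, integral_sub (hf.integrable_loss x hx) (hf.integrable_loss u hu)]
    rfl
  have hbound : ∀ z, Real.exp (deviation P f η s u x z)
      ≤ Real.exp (s * m - 3 * s ^ 2 * m) * (1 - s * (η * (f x z - f u z))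
        + 3 * s ^ 2 * (Real.exp (-(η * (f x z - f u z))) - 1 + η * (f x z - f u z))) := by
    intro z
    have e : deviation P f η s u x z = (s * m - 3 * s ^ 2 * m) + -(s * (η * (f x z - f u z))) := by
      rw [deviation, ← hm]; ring
    rw [e, Real.exp_add]
    exact mul_le_mul_of_nonneg_left (exp_neg_mul_le hs0 hs1 (hY z)) (Real.exp_pos _).le
  have hi1 : Integrable (fun z => 1 - s * (η * (f x z - f u z))) P :=
    (integrable_const 1).sub (hiY.const_mul s)
  have hi2 : Integrable (fun z => Real.exp (-(η * (f x z - f u z))) - 1 + η * (f x z - f u z)) P :=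
    (hie.sub (integrable_const 1)).add hiY
  have hi3 : Integrable (fun z => Real.exp (s * m - 3 * s ^ 2 * m) * (1 - s * (η * (f x z - f u z))
        + 3 * s ^ 2 * (Real.exp (-(η * (f x z - f u z))) - 1 + η * (f x z - f u z)))) P :=
    (hi1.add (hi2.const_mul _)).const_mul _
  have e1 : ∫ z, (1 - s * (η * (f x z - f u z))) ∂P = 1 - s * m := by
    rw [integral_sub (integrable_const 1) (hiY.const_mul s), integral_const_mul, hmE]; simp
  have e2 : ∫ z, (Real.exp (-(η * (f x z - f u z))) - 1 + η * (f x z - f u z)) ∂P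
      = ∫ z, Real.exp (-(η * (f x z - f u z))) ∂P - 1 + m := by
    rw [integral_add (f := fun z => Real.exp (-(η * (f x z - f u z))) - 1)
      (hie.sub (integrable_const 1)) hiY, integral_sub hie (integrable_const 1), hmE]; simp
  refine (lintegral_mono fun z => ENNReal.ofReal_le_ofReal (hbound z)).trans ?_
  rw [← ofReal_integral_eq_lintegral_ofReal hi3
    (Filter.Eventually.of_forall fun z => (Real.exp_pos _).le.trans (hbound z)),
    ENNReal.ofReal_le_one, integral_const_mul, integral_add hi1 (hi2.const_mul _), e1,
    integral_const_mul, e2]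
  set w := ∫ z, Real.exp (-(η * (f x z - f u z))) ∂P
  have h1 : 1 - s * m + 3 * s ^ 2 * (w - 1 + m) ≤ Real.exp (-(s * m - 3 * s ^ 2 * m)) := by
    refine le_trans ?_ (Real.add_one_le_exp _)
    nlinarith [mul_nonneg (sq_nonneg s) (sub_nonneg.2 hcent)]
  refine (mul_le_mul_of_nonneg_left h1 (Real.exp_pos _).le).trans ?_
  rw [← Real.exp_add, add_neg_cancel, Real.exp_zero]

/-- The loss is continuous in the point and measurable in the sample, hence jointly measurable. -/
theorem IsStochasticLoss.measurable_deviation (hf : IsStochasticLoss α G P f) (hα : 0 < α)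
    (hG : 0 < G) {u : E d} (hu : u ∈ domain d) (η s : ℝ) :
    Measurable fun p : domain d × Ξ => deviation P f η s u p.1 p.2 := by
  have h1 : Measurable (Function.uncurry fun (x : domain d) z => f x z) := by
    refine measurable_uncurry_of_continuous_of_measurable (fun z => ?_)
      fun x => hf.measurable_loss x x.2
    have := (hf.differentiable z).continuousOn
    exact continuousOn_iff_continuous_domRestrict.1 this
  have h2 : Measurable fun x : domain d => risk P f x :=
    (continuousOn_iff_continuous_domRestrict.1 (hf.continuousOn_risk hα hG)).measurable
  have h3 : Measurable fun p : domain d × Ξ => risk P f p.1 := h2.comp measurable_fst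
  have h4 : Measurable fun p : domain d × Ξ => f u p.2 :=
    (hf.measurable_loss u hu).comp measurable_snd
  have h1' : Measurable fun p : domain d × Ξ => f p.1 p.2 := h1
  have h5 := (h3.sub_const (risk P f u)).const_mul η
  exact ((h5.sub ((h1'.sub h4).const_mul η)).const_mul s).sub (h5.const_mul (3 * s ^ 2))

end Risk

/-! ### Averaging, and regret against a fixed point -/

section Average

variable {Ξ : Type*} [MeasurableSpace Ξ] {α G : ℝ} {P : Measure Ξ} {f : E d → Ξ → ℝ}

/-- Jensen's inequality for the risk. -/
theorem IsStochasticLoss.risk_average_le (hf : IsStochasticLoss α G P f) (hα : 0 < α) (hG : 0 < G)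
    {x : ℕ → E d} (hx : ∀ t, x t ∈ domain d) {T : ℕ} (hT : 0 < T) :
    (1 / (T : ℝ)) • ∑ t ∈ Finset.range T, x t ∈ domain d ∧
    T * risk P f ((1 / (T : ℝ)) • ∑ t ∈ Finset.range T, x t)
      ≤ ∑ t ∈ Finset.range T, risk P f (x t) := by
  have hT' : (0 : ℝ) < T := by exact_mod_cast hT
  set y := (1 / (T : ℝ)) • ∑ t ∈ Finset.range T, x t with hy
  have hyd : y ∈ domain d := by
    rw [mem_domain, hy, norm_smul, Real.norm_of_nonneg (by positivity)]
    have : ‖∑ t ∈ Finset.range T, x t‖ ≤ T := by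
      refine (norm_sum_le _ _).trans ((Finset.sum_le_sum fun t _ => mem_domain.1 (hx t)).trans ?_)
      simp
    rw [one_div, inv_mul_le_iff₀ hT']; linarith
  refine ⟨hyd, ?_⟩
  have hpt : ∀ z, (T : ℝ) * f y z ≤ ∑ t ∈ Finset.range T, f (x t) z := by
    intro z
    have h1 : ∑ t ∈ Finset.range T, (f y z - f (x t) z)
        ≤ ∑ t ∈ Finset.range T, inner ℝ (lossGrad f z y) (y - x t) :=
      Finset.sum_le_sum fun t _ => hf.le_inner hα hG z hyd (hx t)
    rw [← inner_sum, Finset.sum_sub_distrib, Finset.sum_sub_distrib] at h1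
    -- The deviations from the average sum to zero, so the gradient terms at `y` cancel.
    have h2 : ∑ t ∈ Finset.range T, y - ∑ t ∈ Finset.range T, x t = 0 := by
      rw [Finset.sum_const, Finset.card_range, hy, ← Nat.cast_smul_eq_nsmul ℝ, smul_smul,
        mul_one_div_cancel hT'.ne', one_smul, sub_self]
    rw [h2, inner_zero_right] at h1
    simp at h1
    linarith
  unfold risk
  rw [← integral_const_mul, ← integral_finsetSum _ fun t _ => hf.integrable_loss _ (hx t)]
  exact integral_mono ((hf.integrable_loss y hyd).const_mul _)
    (integrable_finsetSum _ fun t _ => hf.integrable_loss _ (hx t)) hpt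

theorem IsStochasticLoss.sum_sub_le_regret (hf : IsStochasticLoss α G P f) (hα : 0 < α)
    (hG : 0 < G) (z : ℕ → Ξ) (x : ℕ → E d) (T : ℕ) {u : E d} (hu : u ∈ domain d) :
    ∑ t ∈ Finset.range T, (f (x t) (z t) - f u (z t)) ≤ regret f z x T := by
  unfold regret
  rw [Finset.sum_sub_distrib]
  have : sInf ((fun u => ∑ t ∈ Finset.range T, f u (z t)) '' domain d)
      ≤ ∑ t ∈ Finset.range T, f u (z t) := by
    refine csInf_le ⟨∑ t ∈ Finset.range T, (f u (z t) - G * 2), ?_⟩ ⟨u, hu, rfl⟩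
    rintro _ ⟨v, hv, rfl⟩
    refine Finset.sum_le_sum fun t _ => ?_
    have h1 := (abs_le.1 (hf.abs_sub_le hα hG (z t) hu hv)).2
    have h2 : ‖u - v‖ ≤ 2 := by
      rw [mem_domain] at hu hv
      exact (norm_sub_le _ _).trans (by linarith)
    have : G * ‖u - v‖ ≤ G * 2 := by gcongr
    linarith
  linarith

end Average

/-! ### Conversion of regret into excess risk -/

section Supermartingale

variable {Ξ Ω X : Type*} [MeasurableSpace Ξ]

/-- The information of the samples before round `t + 1`. -/
abbrev past (ξ : ℕ → Ω → Ξ) (t : ℕ) : MeasurableSpace Ω :=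
  ⨆ i ∈ Set.Iio t, MeasurableSpace.comap (ξ i) inferInstance

theorem past_mono (ξ : ℕ → Ω → Ξ) {s t : ℕ} (h : s ≤ t) : past ξ s ≤ past ξ t :=
  biSup_mono fun _ hi => lt_of_lt_of_le hi h

theorem measurable_past (ξ : ℕ → Ω → Ξ) {i t : ℕ} (h : i < t) : Measurable[past ξ t] (ξ i) :=
  Measurable.of_comap_le (le_biSup (fun i => MeasurableSpace.comap (ξ i) inferInstance)
    (show i ∈ Set.Iio t from h))

variable [MeasurableSpace Ω] [MeasurableSpace X] {P : Measure Ξ} {μ : Measure Ω} {ξ : ℕ → Ω → Ξ}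

theorem IsIIDSample.past_le (hξ : IsIIDSample P μ ξ) (t : ℕ) : past ξ t ≤ ‹MeasurableSpace Ω› :=
  iSup₂_le fun i _ => (hξ.measurable i).comap_le

theorem IsIIDSample.indep_past (hξ : IsIIDSample P μ ξ) (t : ℕ) :
    Indep (past ξ t) (MeasurableSpace.comap (ξ t) inferInstance) μ := by
  have h := indep_iSup_of_disjoint (fun i => (hξ.measurable i).comap_le) hξ.indep
    (S := Set.Iio t) (T := {t}) (by simp)
  simpa [past] using h

/-- The product of factors with conditional expectation at most one has expectation at most one. -/
theorem IsIIDSample.lintegral_prod_le_one [IsProbabilityMeasure P]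
    [IsProbabilityMeasure μ] (hξ : IsIIDSample P μ ξ)
    {x : ℕ → Ω → X} (hx : ∀ t, Measurable[past ξ t] (x t)) {h : X → Ξ → ENNReal}
    (hh : Measurable (Function.uncurry h)) (hle : ∀ a, ∫⁻ z, h a z ∂P ≤ 1) (n : ℕ) :
    Measurable[past ξ n] (fun ω => ∏ t ∈ Finset.range n, h (x t ω) (ξ t ω)) ∧
      ∫⁻ ω, ∏ t ∈ Finset.range n, h (x t ω) (ξ t ω) ∂μ ≤ 1 := by
  induction n with
  | zero => simp
  | succ n ih =>
    obtain ⟨hM, hI⟩ := ih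
    simp only [Finset.prod_range_succ]
    set M : Ω → ENNReal := fun ω => ∏ t ∈ Finset.range n, h (x t ω) (ξ t ω) with hMdef
    constructor
    · refine Measurable.mul (hM.mono (past_mono ξ n.le_succ) le_rfl) ?_
      exact hh.comp (((hx n).mono (past_mono ξ n.le_succ) le_rfl).prodMk
        (measurable_past ξ n.lt_succ_self))
    · have hq : Measurable[past ξ n] fun ω => (M ω, x n ω) := hM.prodMk (hx n)
      have hq' : Measurable fun ω => (M ω, x n ω) := hq.mono (hξ.past_le n) le_rfl
      -- The pair is determined by the past and so is independent of the new sample; their joint law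
      -- is a product, and Fubini's theorem integrates the new factor first.
      have hind : IndepFun (fun ω => (M ω, x n ω)) (ξ n) μ :=
        indep_of_indep_of_le_left (hξ.indep_past n) hq.comap_le
      have hmap := hind.map_prod_eq_prod_map_map hq'.aemeasurable (hξ.measurable n).aemeasurable
      rw [hξ.law n] at hmap
      have hg : Measurable fun p : (ENNReal × X) × Ξ => p.1.1 * h p.1.2 p.2 :=
        (measurable_fst.comp measurable_fst).mul
          (hh.comp ((measurable_snd.comp measurable_fst).prodMk measurable_snd))
      calc ∫⁻ ω, M ω * h (x n ω) (ξ n ω) ∂μ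
          = ∫⁻ p, p.1.1 * h p.1.2 p.2 ∂(μ.map fun ω => ((M ω, x n ω), ξ n ω)) := by
            rw [lintegral_map hg (hq'.prodMk (hξ.measurable n))]
        _ = ∫⁻ q, ∫⁻ z, q.1 * h q.2 z ∂P ∂(μ.map fun ω => (M ω, x n ω)) := by
            rw [hmap, lintegral_prod _ hg.aemeasurable]
        _ ≤ ∫⁻ q, q.1 ∂(μ.map fun ω => (M ω, x n ω)) := by
            refine lintegral_mono fun q => ?_
            have hz : Measurable fun z => h q.2 z := hh.comp (measurable_const.prodMk measurable_id)
            rw [lintegral_const_mul _ hz]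
            exact mul_le_of_le_one_right' (hle q.2)
        _ = ∫⁻ ω, M ω ∂μ := by rw [lintegral_map measurable_fst hq']
        _ ≤ 1 := hI

end Supermartingale

/-! ### Tail bounds and expectations -/

section HighProbability

variable {Ξ Ω : Type*} [MeasurableSpace Ξ] [MeasurableSpace Ω] {α G : ℝ} {P : Measure Ξ}
  [IsProbabilityMeasure P] {f : E d → Ξ → ℝ} {μ : Measure Ω} [IsProbabilityMeasure μ]
  {ξ : ℕ → Ω → Ξ}

/-- Markov's inequality for the product of the factors `exp (deviation …)`, whose expectation is at
most one. -/
theorem measure_deviation_ge_le (hf : IsStochasticLoss α G P f) (hα : 0 < α)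
    (hG : 0 < G) (hξ : IsIIDSample P μ ξ) {u : E d} (hu : u ∈ domain d)
    (hmin : ∀ x ∈ domain d, risk P f u ≤ risk P f x) {x : ℕ → Ω → E d}
    (hx : ∀ t ω, x t ω ∈ domain d) (hxm : ∀ t, Measurable[past ξ t] (x t))
    {η : ℝ} (hη : 0 < η) (hηα : η ≤ α) (hηG : η * (2 * G) ≤ 1) {s : ℝ}
    (hs0 : 0 ≤ s) (hs1 : s ≤ 1) (T : ℕ) {c : ℝ} (hc : 0 < c) :
    μ {ω | Real.log c ≤ ∑ t ∈ Finset.range T, deviation P f η s u (x t ω) (ξ t ω)}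
      ≤ ENNReal.ofReal (1 / c) := by
  have hx' : ∀ t, Measurable[past ξ t] fun ω => (⟨x t ω, hx t ω⟩ : domain d) :=
    fun t => (hxm t).subtype_mk
  obtain ⟨hm, hI⟩ := hξ.lintegral_prod_le_one (μ := μ) (X := domain d)
    (x := fun t ω => (⟨x t ω, hx t ω⟩ : domain d)) hx'
    (h := fun a z => ENNReal.ofReal (Real.exp (deviation P f η s u a z)))
    (hf.measurable_deviation hα hG hu η s).exp.ennreal_ofReal
    (fun a => hf.lintegral_exp_deviation_le hα hG hu hmin a.2 hη hηα hηG hs0 hs1) T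
  have e : ∀ ω, ∏ t ∈ Finset.range T,
      ENNReal.ofReal (Real.exp (deviation P f η s u (x t ω) (ξ t ω)))
      = ENNReal.ofReal (Real.exp (∑ t ∈ Finset.range T, deviation P f η s u (x t ω) (ξ t ω))) := by
    intro ω
    rw [Real.exp_sum, ENNReal.ofReal_prod_of_nonneg fun _ _ => (Real.exp_pos _).le]
  simp only [e] at hm hI
  have h1 := meas_ge_le_lintegral_div (μ := μ) (hm.mono (hξ.past_le T) le_rfl).aemeasurable
    (ε := ENNReal.ofReal c) (by simpa using hc) ENNReal.ofReal_ne_top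
  have h2 : {ω | Real.log c ≤ ∑ t ∈ Finset.range T, deviation P f η s u (x t ω) (ξ t ω)}
      ⊆ {ω | ENNReal.ofReal c ≤ ENNReal.ofReal
          (Real.exp (∑ t ∈ Finset.range T, deviation P f η s u (x t ω) (ξ t ω)))} := by
    intro ω hω
    refine ENNReal.ofReal_le_ofReal ?_
    rwa [← Real.log_le_iff_le_exp hc]
  refine (measure_mono h2).trans (h1.trans ?_)
  rw [ENNReal.ofReal_div_of_pos hc, ENNReal.ofReal_one]
  gcongr

/-- Online-to-batch conversion for exp-concave losses. -/
theorem excessRisk_le_riskBound (hf : IsStochasticLoss α G P f) (hα : 0 < α)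
    (hG : 0 < G) (hξ : IsIIDSample P μ ξ) {x : ℕ → Ω → E d}
    (hx : ∀ t ω, x t ω ∈ domain d) (hxm : ∀ t, Measurable[past ξ t] (x t))
    {T : ℕ} (hT : 3 ≤ T) {δ : ℝ} (hδ0 : 0 < δ) (hδ1 : δ < 1) :
    ENNReal.ofReal (1 - δ) ≤ μ {ω |
      excessRisk P f ((1 / (T : ℝ)) • ∑ t ∈ Finset.range T, x t ω)
        ≤ riskBound α G δ T (regret f (fun t => ξ t ω) (fun t => x t ω) T)} := by
  obtain ⟨u, hu, hmin, hinf⟩ := hf.exists_minimizer hα hG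
  have hγ := gamma0_pos hα hG
  set η := 2 * gamma0 α G with hη
  have hη0 : 0 < η := by positivity
  have hηα : η ≤ α := two_mul_gamma0_le α G
  have hηG : η * (2 * G) ≤ 1 := by
    have := four_mul_gamma0_mul_le α hG
    rw [hη]; linarith
  have hT' : (3 : ℝ) ≤ T := by exact_mod_cast hT
  have hT0 : (0 : ℝ) < T := by linarith
  have hlogT : 1 ≤ Real.log T := by
    rw [Real.le_log_iff_exp_le hT0]
    linarith [Real.exp_one_lt_d9]
  -- The number of scales for the union bound; `N ≤ 4 log T` produces the factor `4 log T / δ`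
  -- inside the logarithm.
  set N := ⌈Real.log T⌉₊ + 1 with hN
  have hN0 : (0 : ℝ) < N := by rw [hN]; positivity
  have hNle : (N : ℝ) ≤ 4 * Real.log T := by
    have := Nat.ceil_lt_add_one (by linarith : 0 ≤ Real.log T)
    rw [hN]; push_cast; linarith
  set L := Real.log (4 * Real.log T / δ) with hL
  have hL1 : 1 ≤ L := by
    rw [hL, Real.le_log_iff_exp_le (by positivity)]
    have : 4 ≤ 4 * Real.log T / δ := by
      rw [le_div_iff₀ hδ0]; nlinarith
    linarith [Real.exp_one_lt_d9]
  set B : Set Ω := ⋃ i ∈ Finset.range N, {ω | Real.log (N / δ) ≤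
    ∑ t ∈ Finset.range T, deviation P f η ((1 / 2) ^ i) u (x t ω) (ξ t ω)} with hB
  have hBδ : μ B ≤ ENNReal.ofReal δ := by
    refine (measure_biUnion_finset_le _ _).trans ?_
    refine (Finset.sum_le_sum fun i _ => measure_deviation_ge_le hf hα hG hξ hu hmin hx hxm hη0
      hηα hηG (by positivity) (pow_le_one₀ (by norm_num) (by norm_num)) T
      (div_pos hN0 hδ0)).trans ?_
    rw [Finset.sum_const, Finset.card_range, nsmul_eq_mul, ← ENNReal.ofReal_natCast,
      ← ENNReal.ofReal_mul hN0.le]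
    refine ENNReal.ofReal_le_ofReal (le_of_eq ?_)
    field_simp
  have hsub : Bᶜ ⊆ {ω | excessRisk P f ((1 / (T : ℝ)) • ∑ t ∈ Finset.range T, x t ω)
        ≤ riskBound α G δ T (regret f (fun t => ξ t ω) (fun t => x t ω) T)} := by
    intro ω hω
    simp only [hB, Set.mem_compl_iff, Set.mem_iUnion, Set.mem_ofPred_eq, not_exists, not_le,
      Finset.mem_range] at hω
    set S := ∑ t ∈ Finset.range T, (risk P f (x t ω) - risk P f u) with hS
    set Z := ∑ t ∈ Finset.range T, (f (x t ω) (ξ t ω) - f u (ξ t ω)) with hZ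
    set R := regret f (fun t => ξ t ω) (fun t => x t ω) T with hR
    have hZR : Z ≤ R := hf.sum_sub_le_regret hα hG _ _ T hu
    have hdev : ∀ s : ℝ, ∑ t ∈ Finset.range T, deviation P f η s u (x t ω) (ξ t ω)
        = s * (η * S - η * Z) - 3 * s ^ 2 * (η * S) := by
      intro s
      simp only [deviation, Finset.sum_sub_distrib, ← Finset.mul_sum, hS, hZ]
    have hS0 : 0 ≤ S := Finset.sum_nonneg fun t _ => by linarith [hmin _ (hx t ω)]
    have hST : η * S ≤ T := by
      have : S ≤ ∑ t ∈ Finset.range T, 2 * G := by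
        refine Finset.sum_le_sum fun t _ => ?_
        have h1 := (abs_le.1 (hf.abs_risk_sub_le hα hG (hx t ω) hu)).2
        have h2 : ‖x t ω - u‖ ≤ 2 := by
          have := hx t ω
          rw [mem_domain] at this hu
          exact (norm_sub_le _ _).trans (by linarith)
        nlinarith
      simp at this
      calc η * S ≤ η * (T * (2 * G)) := by gcongr
        _ = T * (η * (2 * G)) := by ring
        _ ≤ T * 1 := by gcongr
        _ = T := mul_one _
    -- The deviations are in units of `1 / η`: `η S` is the scaled excess risk and `η Z` the scaled
    -- excess loss on the samples.
    have hkey : η * S ≤ η * Z + 4 * √(η * Z * L) + 16 * L := by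
      refine le_of_dyadic_deviation hT' hL1 (by positivity) hST fun i hi => ?_
      have h1 := (hω i (by omega)).le
      rw [hdev] at h1
      refine h1.trans (Real.log_le_log (by positivity) ?_)
      gcongr
    have hkey2 : η * S ≤ η * R + 4 * √(η * R * L) + 16 * L := by
      refine hkey.trans ?_
      have : √(η * Z * L) ≤ √(η * R * L) := Real.sqrt_le_sqrt (by gcongr)
      have : η * Z ≤ η * R := by gcongr
      linarith
    have hsqrt : √(η * R * L) = η * √(R / η * L) := by
      have : η * R * L = η ^ 2 * (R / η * L) := by field_simp
      rw [this, Real.sqrt_mul (by positivity), Real.sqrt_sq hη0.le]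
    have hkey3 : S ≤ R + 4 * √(R / η * L) + 8 / gamma0 α G * L := by
      have e1 : 16 * L = η * (8 / gamma0 α G * L) := by rw [hη]; field_simp; norm_num
      rw [hsqrt, e1] at hkey2
      exact le_of_mul_le_mul_left (by linarith) hη0
    obtain ⟨-, hav⟩ := hf.risk_average_le hα hG (fun t => hx t ω) (by omega : 0 < T)
    simp only [Set.mem_ofPred_eq, excessRisk, hinf, riskBound]
    rw [← hη, ← hL, one_div_mul_eq_div, le_div_iff₀ hT0]
    refine le_trans ?_ hkey3
    have e2 : S = ∑ t ∈ Finset.range T, risk P f (x t ω) - T * risk P f u := by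
      rw [hS, Finset.sum_sub_distrib]; simp
    rw [e2]
    linarith
  -- Subadditivity alone is used, so `B` need not be shown measurable.
  have h1 : (1 : ENNReal) ≤ μ Bᶜ + μ B := by
    rw [← measure_univ (μ := μ), ← Set.compl_union_self B]
    exact measure_union_le _ _
  have h2 : ENNReal.ofReal (1 - δ) ≤ μ Bᶜ := by
    rw [ENNReal.ofReal_sub _ hδ0.le, ENNReal.ofReal_one, tsub_le_iff_right]
    exact h1.trans (by gcongr)
  exact h2.trans (measure_mono hsub)

theorem excessRisk_nonneg_le (hf : IsStochasticLoss α G P f) (hα : 0 < α) (hG : 0 < G) {x : E d}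
    (hx : x ∈ domain d) : 0 ≤ excessRisk P f x ∧ excessRisk P f x ≤ 2 * G := by
  obtain ⟨u, hu, hmin, hinf⟩ := hf.exists_minimizer hα hG
  rw [excessRisk, hinf]
  refine ⟨by linarith [hmin x hx], ?_⟩
  have h1 := (abs_le.1 (hf.abs_risk_sub_le hα hG hx hu)).2
  have h2 : ‖x - u‖ ≤ 2 := by
    rw [mem_domain] at hx hu
    exact (norm_sub_le _ _).trans (by linarith)
  nlinarith

/-- A high-probability bound on a bounded random variable bounds its expectation. -/
theorem integral_le_of_prob_le {g : Ω → ℝ} (hg : Measurable g) (h0 : ∀ ω, 0 ≤ g ω) {M b δ : ℝ}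
    (hM : ∀ ω, g ω ≤ M) (hb : 0 ≤ b)
    (h : ENNReal.ofReal (1 - δ) ≤ μ {ω | g ω ≤ b}) :
    Integrable g μ ∧ ∫ ω, g ω ∂μ ≤ b + M * δ := by
  have hint : Integrable g μ := Integrable.of_bound hg.aestronglyMeasurable M
    (Filter.Eventually.of_forall fun ω => by rw [Real.norm_of_nonneg (h0 ω)]; exact hM ω)
  have : Nonempty Ω := nonempty_of_isProbabilityMeasure μ
  have hM0 : 0 ≤ M := (h0 (Classical.arbitrary Ω)).trans (hM _)
  refine ⟨hint, ?_⟩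
  have hms : MeasurableSet {ω | g ω ≤ b} := measurableSet_le hg measurable_const
  have hbad : μ.real {ω | g ω ≤ b}ᶜ ≤ δ := by
    rw [probReal_compl_eq_one_sub hms]
    have : 1 - δ ≤ μ.real {ω | g ω ≤ b} := by
      rw [measureReal_def, ← ENNReal.ofReal_le_iff_le_toReal (measure_ne_top _ _)]; exact h
    linarith
  -- On the good event `g` is at most `b`, elsewhere at most `M`.
  have hpt : ∀ ω, g ω ≤ b + Set.indicator {ω | g ω ≤ b}ᶜ (fun _ => M) ω := by
    intro ω
    by_cases hω : g ω ≤ b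
    · rw [Set.indicator_of_notMem (by simpa using hω)]; linarith
    · rw [Set.indicator_of_mem (by simpa using hω)]; linarith [hM ω]
  have hi : Integrable (Set.indicator {ω | g ω ≤ b}ᶜ (fun _ => M)) μ :=
    (integrable_const M).indicator hms.compl
  refine (integral_mono hint ((integrable_const b).add hi) hpt).trans ?_
  simp only [Pi.add_apply]
  rw [integral_add (integrable_const b) hi, integral_indicator_const _ hms.compl]
  simp
  rw [mul_comm]
  gcongr

end HighProbability

section Average

variable {Ξ Ω : Type*} [MeasurableSpace Ξ] {α G : ℝ} {P : Measure Ξ} {f : E d → Ξ → ℝ}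
  {ξ : ℕ → Ω → Ξ}

variable {e k γ : ℝ} {proj : ProjRoutine d}

/-- Adaptedness: `measurable_decision` with `Ω` carrying the σ-algebra of the earlier samples. -/
theorem measurable_decision_past (hf : IsStochasticLoss α G P f) (he : 0 < e) (hk : 1 ≤ k)
    (hproj : proj = exactProj ∨ proj = approxProj γ G e k) (t : ℕ) :
    Measurable[past ξ t] fun ω => decision proj γ e k (oracle f fun i => ξ i ω) t :=
  @measurable_decision d Ω (past ξ t) Ξ _ α G e k γ P f proj hf he hk hproj ξ t
    fun _ hi => measurable_past ξ hi

theorem averaged_mem (hf : IsStochasticLoss α G P f) (hα : 0 < α) (hG : 0 < G)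
    (proj : ProjRoutine d) (γ e k : ℝ) (grad : ℕ → E d → E d) {T : ℕ} (hT : 0 < T) :
    averaged proj γ e k grad T ∈ domain d :=
  (hf.risk_average_le hα hG (decision_mem γ e k proj grad) hT).1

theorem measurable_excessRisk_averaged (hf : IsStochasticLoss α G P f) (hα : 0 < α) (hG : 0 < G)
    [MeasurableSpace Ω] {μ : Measure Ω} [IsProbabilityMeasure P] (hξ : IsIIDSample P μ ξ) (he : 0 < e) (hk : 1 ≤ k)
    (hproj : proj = exactProj ∨ proj = approxProj γ G e k) {T : ℕ} (hT : 0 < T) :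
    Measurable fun ω => excessRisk P f (averaged proj γ e k (oracle f fun t => ξ t ω) T) := by
  have h2 : Measurable fun x : domain d => risk P f x :=
    (continuousOn_iff_continuous_domRestrict.1 (hf.continuousOn_risk hα hG)).measurable
  have h3 : Measurable fun ω => averaged proj γ e k (oracle f fun t => ξ t ω) T :=
    (Finset.measurable_sum _ fun t _ =>
      measurable_decision hf he hk hproj fun i _ => hξ.measurable i).const_smul (1 / (T : ℝ))
  exact (h2.comp (h3.subtype_mk
    (h := fun ω => averaged_mem hf hα hG proj γ e k _ hT))).sub_const _

end Average

/-! ### The program computes LightONS -/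

namespace Timed

section Monad

variable {β β' : Type}

theorem bind_val (m : Timed β) (g : β → Timed β') : (m >>= g).val = (g m.val).val := rfl

theorem bind_time (m : Timed β) (g : β → Timed β') :
    (m >>= g).time = m.time + (g m.val).time := rfl

theorem pure_val (b : β) : (pure b : Timed β).val = b := rfl

theorem pure_time (b : β) : (pure b : Timed β).time = 0 := rfl

theorem ite_val (c : Prop) [Decidable c] (m n : Timed β) :
    (if c then m else n).val = if c then m.val else n.val := apply_ite _ _ _ _

theorem ite_time (c : Prop) [Decidable c] (m n : Timed β) :
    (if c then m else n).time = if c then m.time else n.time := apply_ite _ _ _ _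

theorem loop_succ_val (body : ℕ → β → Timed β) (n : ℕ) (b : β) :
    (loop body (n + 1) b).val = (body n (loop body n b).val).val := rfl

theorem loop_succ_time (body : ℕ → β → Timed β) (n : ℕ) (b : β) :
    (loop body (n + 1) b).time
      = (loop body n b).time + ((body n (loop body n b).val).time + 1) := rfl

end Monad

/-! #### Gauss-Jordan inversion -/

theorem pivot_val (p : Fin d) (M : Mat d) (i j : Fin d) : (pivot p M).val i j =
    if i = p then if j = p then 1 / M p p else 0 - M p j / M p p
    else if j = p then M i p / M p p else M i j - M i p / M p p * M p j := by
  simp only [pivot, mat, Matrix.of_apply, ite_val, bind_val, div, sub, mul, pure_val]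

/-- Solve equation `p` for `a p`, which needs the nonzero pivot, and substitute into the other
equations. -/
theorem pivot_mulVec {p : Fin d} {N : Mat d} (hp : N p p ≠ 0) {a b : Fin d → ℝ}
    (h : N.mulVec a = b) :
    (pivot p N).val.mulVec (Function.update a p (b p)) = Function.update b p (a p) := by
  have hb : ∀ i, N i p * a p + ∑ j ∈ Finset.univ.erase p, N i j * a j = b i := by
    intro i
    rw [Finset.add_sum_erase _ (fun j => N i j * a j) (Finset.mem_univ p), ← h]
    rfl
  ext i
  simp only [Matrix.mulVec, dotProduct]
  rw [← Finset.add_sum_erase _ _ (Finset.mem_univ p), Function.update_self]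
  have hsum : ∑ j ∈ Finset.univ.erase p, (pivot p N).val i j * Function.update a p (b p) j
      = if i = p then -(∑ j ∈ Finset.univ.erase p, N p j * a j) / N p p
        else ∑ j ∈ Finset.univ.erase p, N i j * a j
          - N i p / N p p * ∑ j ∈ Finset.univ.erase p, N p j * a j := by
    split_ifs with hi
    · rw [neg_div, Finset.sum_div, ← Finset.sum_neg_distrib]
      refine Finset.sum_congr rfl fun j hj => ?_
      have hjp := Finset.ne_of_mem_erase hj
      rw [pivot_val, if_pos hi, if_neg hjp, Function.update_of_ne hjp]
      ring
    · rw [Finset.mul_sum, ← Finset.sum_sub_distrib]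
      refine Finset.sum_congr rfl fun j hj => ?_
      have hjp := Finset.ne_of_mem_erase hj
      rw [pivot_val, if_neg hi, if_neg hjp, Function.update_of_ne hjp]
      ring
  rw [hsum, pivot_val]
  by_cases hi : i = p
  · subst hi
    have := hb i
    simp only [if_true, Function.update_self]
    field_simp
    linarith
  · have h1 := hb i
    have h2 := hb p
    simp only [if_neg hi, if_true, Function.update_of_ne hi]
    rw [← h1, ← h2]
    field_simp
    ring

/-- The vector with the entries of `x` below `n` and those of `y` from `n` on. -/
def mix (n : ℕ) (x y : Fin d → ℝ) : Fin d → ℝ := fun i => if i.val < n then x i else y i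

theorem mix_succ {n : ℕ} (hn : n < d) (x y : Fin d → ℝ) :
    mix (n + 1) x y = Function.update (mix n x y) ⟨n, hn⟩ (x ⟨n, hn⟩) := by
  ext i
  by_cases hi : i = ⟨n, hn⟩
  · subst hi; simp [mix]
  · have : i.val ≠ n := fun h => hi (Fin.ext h)
    rw [Function.update_of_ne hi]
    simp only [mix]
    congr 1
    exact propext ⟨fun h => by omega, fun h => by omega⟩

/-- The map is linear and injective: if its value vanishes, then for each `i` either `x i` or `(M x)
i` is zero, so `xᵀ M x = 0` and `x = 0`. -/
theorem exists_mix_eq_single {M : Mat d} (hM : ∀ x ≠ 0, 0 < x ⬝ᵥ M.mulVec x) (n : ℕ)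
    (v : Fin d → ℝ) : ∃ x, mix n (M.mulVec x) x = v := by
  let φ : (Fin d → ℝ) →ₗ[ℝ] (Fin d → ℝ) :=
    { toFun := fun x => mix n (M.mulVec x) x
      map_add' := fun x y => by
        ext i; simp only [mix, Matrix.mulVec_add, Pi.add_apply]; split_ifs <;> rfl
      map_smul' := fun c x => by
        ext i; simp only [mix, Matrix.mulVec_smul, Pi.smul_apply, RingHom.id_apply]
        split_ifs <;> rfl }
  have hinj : Function.Injective φ := by
    rw [← LinearMap.ker_eq_bot, LinearMap.ker_eq_bot']
    intro x hx
    by_contra h0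
    have h1 := hM x h0
    have h2 : x ⬝ᵥ M.mulVec x = 0 := by
      refine Finset.sum_eq_zero fun i _ => ?_
      have h3 : mix n (M.mulVec x) x i = 0 := congrFun hx i
      simp only [mix] at h3
      split_ifs at h3 with hi
      · rw [h3, mul_zero]
      · rw [h3, zero_mul]
    linarith
  exact LinearMap.injective_iff_surjective.1 hinj v

/-- Loop invariant of Gauss-Jordan: after `n` steps the first `n` coordinates of argument and value
have been exchanged. At `n = d` the matrix is the inverse. -/
theorem loop_pivot_mulVec {M : Mat d} (hM : ∀ x ≠ 0, 0 < x ⬝ᵥ M.mulVec x) {n : ℕ} (hn : n ≤ d)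
    (x : Fin d → ℝ) :
    (loop (fun p N => if hp : p < d then pivot ⟨p, hp⟩ N else pure N) n M).val.mulVec
      (mix n (M.mulVec x) x) = mix n x (M.mulVec x) := by
  induction n generalizing x with
  | zero =>
    have h : ∀ u v : Fin d → ℝ, mix 0 u v = v := fun u v => by ext i; simp [mix]
    rw [h, h]; rfl
  | succ n ih =>
    have hnd : n < d := hn
    rw [loop_succ_val, dif_pos hnd]
    set N := (loop (fun p N => if hp : p < d then pivot ⟨p, hp⟩ N else pure N) n M).val
    set p : Fin d := ⟨n, hnd⟩ with hp
    -- Choose `w` whose partially exchanged argument is the unit vector `p`. The exchange preserves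
    -- the pairing of argument and value, so `N p p = wᵀ M w > 0`.
    have hpos : 0 < N p p := by
      obtain ⟨w, hw⟩ := exists_mix_eq_single hM n (Pi.single p 1)
      have h1 := ih hnd.le w
      rw [hw] at h1
      have h2 : N p p = mix n w (M.mulVec w) p := by rw [← h1]; simp
      have hw0 : w ≠ 0 := by
        rintro rfl
        have := congrFun hw p
        simp [mix] at this
      have h3 : w ⬝ᵥ M.mulVec w = ∑ i, mix n (M.mulVec w) w i * mix n w (M.mulVec w) i := by
        refine Finset.sum_congr rfl fun i _ => ?_
        simp only [mix]
        split_ifs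
        · ring
        · rfl
      rw [hw] at h3
      have h4 := hM w hw0
      rw [h3] at h4
      simp [Pi.single_apply] at h4
      rw [h2]; exact h4
    have h := pivot_mulVec hpos.ne' (ih hnd.le x)
    have e1 : mix n x (M.mulVec x) p = M.mulVec x p := by simp [mix, hp]
    have e2 : mix n (M.mulVec x) x p = x p := by simp [mix, hp]
    rw [e1, e2, ← mix_succ, ← mix_succ] at h
    exact h

theorem inverse_val {M : Mat d} (hM : ∀ x ≠ 0, 0 < x ⬝ᵥ M.mulVec x) : (inverse M).val = M⁻¹ := by
  symm
  refine Matrix.inv_eq_left_inv ?_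
  rw [← Matrix.mulVec_injective.eq_iff]
  funext x
  have h := loop_pivot_mulVec hM le_rfl x
  have e1 : mix d (M.mulVec x) x = M.mulVec x := by ext i; simp [mix]
  have e2 : mix d x (M.mulVec x) = x := by ext i; simp [mix]
  rw [e1, e2, Matrix.mulVec_mulVec] at h
  rw [Matrix.one_mulVec]
  exact h

/-! #### Projection by bisection -/

theorem dot_val (u v : Fin d → ℝ) : (dot u v).val = u ⬝ᵥ v := rfl

theorem mulVec_val (A : Mat d) (u : Fin d → ℝ) : (mulVec A u).val = A.mulVec u := rfl

theorem smul_val (c : ℝ) (u : Fin d → ℝ) : (smul c u).val = c • u := rfl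

theorem norm_val (u : Fin d → ℝ) : (norm u).val = ‖(WithLp.toLp 2 u : E d)‖ := by
  rw [← Real.sqrt_sq (norm_nonneg (WithLp.toLp 2 u : E d)), ← real_inner_self_eq_norm_sq,
    inner_eq_dotProduct]
  rfl

theorem shiftedSolve_val {A : Mat d} {lo hi : ℝ} (hA : EigBounds A lo hi) (hlo : 0 < lo) {m : ℝ}
    (hm : 0 ≤ m) (u : Fin d → ℝ) : (shiftedSolve A m (A.mulVec u)).val
      = (SXO.shrink A (WithLp.toLp 2 u) m).ofLp := by
  have hM : (mat fun i j => if i = j then add (A i j) m else (pure (A i j) : Timed ℝ)).val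
      = A + m • (1 : Mat d) := by
    ext i j
    by_cases h : i = j
    · simp [mat, h, add]
    · simp [mat, h, pure_val]
  have hpos : ∀ x ≠ 0, 0 < x ⬝ᵥ (A + m • (1 : Mat d)).mulVec x := by
    intro x hx
    have := ((hA.add_smul_one m).posDef (by linarith)).dotProduct_mulVec_pos hx
    simpa using this
  simp only [shiftedSolve, bind_val, hM, inverse_val hpos, mulVec_val]
  rfl

/-- The body of the bisection loop. -/
noncomputable def bisectBody (A : Mat d) (p : Fin d → ℝ) (RR : ℝ) (q : ℝ × ℝ) : Timed (ℝ × ℝ) := do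
  let s ← add q.1 q.2
  let m ← div s 2
  let w ← shiftedSolve A m p
  let ww ← dot w w
  let big ← le RR ww
  if big then pure (m, q.2) else pure (q.1, m)

/-- A nonnegative bracket keeps the shifted matrix positive definite, hence correctly inverted by
the program. The square of the radius is `1 * 1`, as the program computes it. -/
theorem bisectBody_val {A : Mat d} {lo hi : ℝ} (hA : EigBounds A lo hi) (hlo : 0 < lo)
    (u : Fin d → ℝ) {q : ℝ × ℝ} (h1 : 0 ≤ q.1) (h2 : 0 ≤ q.2) :
    (bisectBody A (A.mulVec u) (1 * 1) q).val = bisectStep A (WithLp.toLp 2 u) 1 q := by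
  simp only [bisectBody, bind_val, add, div, shiftedSolve_val hA hlo (by positivity :
    0 ≤ (q.1 + q.2) / 2), dot_val, le, ← inner_eq_dotProduct, real_inner_self_eq_norm_sq,
    bisectStep, ite_val, pure_val, decide_eq_true_eq]
  simp [sub_nonneg]

theorem loop_bisectBody_val {A : Mat d} {lo hi : ℝ} (hA : EigBounds A lo hi) (hlo : 0 < lo)
    (u : Fin d → ℝ) (n : ℕ) {q : ℝ × ℝ} (h1 : 0 ≤ q.1) (h2 : 0 ≤ q.2) :
    (loop (fun _ => bisectBody A (A.mulVec u) (1 * 1)) n q).val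
        = (bisectStep A (WithLp.toLp 2 u) 1)^[n] q ∧
      0 ≤ ((bisectStep A (WithLp.toLp 2 u) 1)^[n] q).1 ∧
      0 ≤ ((bisectStep A (WithLp.toLp 2 u) 1)^[n] q).2 := by
  induction n with
  | zero => exact ⟨rfl, h1, h2⟩
  | succ n ih =>
    obtain ⟨i1, i2, i3⟩ := ih
    rw [loop_succ_val, i1, bisectBody_val hA hlo u i2 i3, Function.iterate_succ_apply']
    refine ⟨rfl, ?_⟩
    unfold bisectStep at i2 i3 ⊢
    split_ifs
    · exact ⟨by simp only; linarith, i3⟩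
    · exact ⟨i2, by simp only; linarith⟩

theorem fastProj_val {A : Mat d} {lo hi : ℝ} (hA : EigBounds A lo hi) (hlo : 0 < lo)
    (hlh : lo ≤ hi) {u : Fin d → ℝ} (hu : 1 < ‖(WithLp.toLp 2 u : E d)‖) (ζ : ℝ) :
    (fastProj A u 1 ζ lo hi).val = (SXO.fastProj A (WithLp.toLp 2 u) 1 ζ lo hi).ofLp := by
  set r := ‖(WithLp.toLp 2 u : E d)‖ with hr
  have hr1 : 0 ≤ r / 1 - 1 := by rw [div_one]; linarith
  obtain ⟨e, h1, h2⟩ := loop_bisectBody_val hA hlo u (bisectCount r 1 ζ lo hi)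
    (q := ((r / 1 - 1) * lo, (r / 1 - 1) * hi)) (mul_nonneg hr1 hlo.le)
    (mul_nonneg hr1 (hlo.le.trans hlh))
  change (smul (1 / (norm (shiftedSolve A (((loop (fun _ => bisectBody A (A.mulVec u) (1 * 1))
    ⌈Real.logb 2 (1 / ζ * (hi / lo - 1) * (norm u).val * ((norm u).val / 1 - 1))⌉₊
      (((norm u).val / 1 - 1) * lo, ((norm u).val / 1 - 1) * hi)).val.1 +
    (loop (fun _ => bisectBody A (A.mulVec u) (1 * 1))
    ⌈Real.logb 2 (1 / ζ * (hi / lo - 1) * (norm u).val * ((norm u).val / 1 - 1))⌉₊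
      (((norm u).val / 1 - 1) * lo, ((norm u).val / 1 - 1) * hi)).val.2) / 2) (A.mulVec u)).val).val)
      (shiftedSolve A (((loop (fun _ => bisectBody A (A.mulVec u) (1 * 1))
    ⌈Real.logb 2 (1 / ζ * (hi / lo - 1) * (norm u).val * ((norm u).val / 1 - 1))⌉₊
      (((norm u).val / 1 - 1) * lo, ((norm u).val / 1 - 1) * hi)).val.1 +
    (loop (fun _ => bisectBody A (A.mulVec u) (1 * 1))
    ⌈Real.logb 2 (1 / ζ * (hi / lo - 1) * (norm u).val * ((norm u).val / 1 - 1))⌉₊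
      (((norm u).val / 1 - 1) * lo, ((norm u).val / 1 - 1) * hi)).val.2) / 2) (A.mulVec u)).val).val
    = _
  rw [norm_val u, ← hr]
  unfold bisectCount at e h1 h2
  rw [e, shiftedSolve_val hA hlo (by linarith), norm_val]
  rfl

end Timed

/-! ### Rounds, rank-one updates and operation counts -/

namespace Timed

theorem tolerance_val (γ G e k : ℝ) (t : ℕ) :
    (tolerance γ G e k t).val = SXO.tolerance γ G e k t := by
  simp only [tolerance, bind_val, mul, add, div, sqrt, le, ite_val, pure_val, decide_eq_true_eq,
    SXO.tolerance, min_def]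
  simp only [← sq]

theorem le_val {a b : ℝ} : (le a b).val = true ↔ a ≤ b := by
  simp [le]

theorem observe_val (grad : ℕ → E d → E d) (t : ℕ) (y : E d) :
    (observe grad t y.ofLp).val = ((euclProj (domain d) y).ofLp,
      (surrogateGrad (grad t (euclProj (domain d) y)) (euclProj (domain d) y) y).ofLp) := by
  have hn : (norm y.ofLp).val = ‖y‖ := norm_val _
  simp only [observe, bind_val, ite_val, hn, le_val, pure_val, div, query, sub, dot_val, smul_val,
    vsub, vadd, vec]
  by_cases h : ‖y‖ ≤ 1
  · rw [if_pos h, euclProj_of_norm_le h]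
    simp [surrogateGrad]
  · rw [if_neg h]
    push Not at h
    have hx : (WithLp.toLp 2 ((1 / ‖y‖) • y.ofLp) : E d) = euclProj (domain d) y := by
      rw [euclProj_of_one_lt h]; rfl
    have hx' : (1 / ‖y‖) • y.ofLp = (euclProj (domain d) y).ofLp := by rw [← hx]
    rw [hx, hx']
    set x := euclProj (domain d) y
    set g := grad t x
    have h1 : (g.ofLp ⬝ᵥ fun i => y.ofLp i - x.ofLp i) = inner ℝ g (y - x) := by
      rw [inner_eq_dotProduct]; rfl
    have h2 : ((fun i => y.ofLp i - x.ofLp i) ⬝ᵥ fun i => y.ofLp i - x.ofLp i)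
        = ‖y - x‖ ^ 2 := by
      rw [← real_inner_self_eq_norm_sq, inner_eq_dotProduct]; rfl
    by_cases hp : 0 ≤ (inner ℝ g (y - x) : ℝ)
    · rw [if_pos (h1.symm ▸ hp), surrogateGrad, max_eq_left (by linarith)]
      simp
    · rw [if_neg (h1.symm ▸ hp), surrogateGrad, max_eq_right (by linarith), h1, h2, zero_sub]
      rfl

/-- The Sherman-Morrison formula. -/
theorem sub_div_eq_inv {A : Mat d} {lo hi : ℝ} (hA : EigBounds A lo hi) (hlo : 0 < lo) (h : E d) :
    (Matrix.of fun i j => A⁻¹ i j - (A⁻¹.mulVec h.ofLp) i * (A⁻¹.mulVec h.ofLp) j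
        / (1 + h.ofLp ⬝ᵥ A⁻¹.mulVec h.ofLp))
      = (A + Matrix.vecMulVec h.ofLp h.ofLp)⁻¹ := by
  set V : Mat d := Matrix.of fun i j => A⁻¹ i j - (A⁻¹.mulVec h.ofLp) i * (A⁻¹.mulVec h.ofLp) j
        / (1 + h.ofLp ⬝ᵥ A⁻¹.mulVec h.ofLp) with hV
  have hw : h.ofLp ⬝ᵥ A⁻¹.mulVec h.ofLp = inner ℝ h (mulE A⁻¹ h) := by
    rw [inner_eq_dotProduct]; rfl
  have h0 := inner_inv_mulE_nonneg hA hlo h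
  set w : ℝ := inner ℝ h (mulE A⁻¹ h) with hwdef
  -- The candidate inverse acts as `A⁻¹` minus a multiple of `A⁻¹ h`; applying the updated matrix to
  -- this gives back `x`.
  have hVx : ∀ x : E d, mulE V x
      = mulE A⁻¹ x - (inner ℝ (mulE A⁻¹ h) x / (1 + w)) • mulE A⁻¹ h := by
    intro x
    ext i
    have e : inner ℝ (mulE A⁻¹ h) x = ∑ j, (A⁻¹.mulVec h.ofLp) j * x j := by
      rw [inner_eq_dotProduct]; rfl
    have e2 : (mulE A⁻¹ x - (inner ℝ (mulE A⁻¹ h) x / (1 + w)) • mulE A⁻¹ h) i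
      = ∑ j, A⁻¹ i j * x j - (inner ℝ (mulE A⁻¹ h) x / (1 + w)) * (A⁻¹.mulVec h.ofLp) i := rfl
    have e3 : mulE V x i = ∑ j, (A⁻¹ i j - (A⁻¹.mulVec h.ofLp) i * (A⁻¹.mulVec h.ofLp) j
        / (1 + w)) * x j := by rw [← hw]; rfl
    rw [e2, e3, e, Finset.sum_div, Finset.sum_mul, ← Finset.sum_sub_distrib]
    exact Finset.sum_congr rfl fun j _ => by ring
  have hsymm : ∀ x : E d, inner ℝ (mulE A⁻¹ h) x = inner ℝ h (mulE A⁻¹ x) := by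
    intro x
    conv_lhs => rw [← hA.mulE_inv hlo x]
    rw [hA.inner_mulE, hA.mulE_inv hlo]
  have key : ∀ x : E d, mulE (A + Matrix.vecMulVec h.ofLp h.ofLp) (mulE V x) = x := by
    intro x
    rw [add_mulE, vecMulVec_mulE, hVx, mulE_sub, mulE_smul, hA.mulE_inv hlo, hA.mulE_inv hlo,
      inner_sub_right, inner_smul_right, hsymm, ← hwdef]
    have e : inner ℝ h (mulE A⁻¹ x) - inner ℝ h (mulE A⁻¹ x) / (1 + w) * w
        = inner ℝ h (mulE A⁻¹ x) / (1 + w) := by field_simp; ring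
    rw [e, sub_add_cancel]
  symm
  refine Matrix.inv_eq_right_inv ?_
  rw [← Matrix.mulVec_injective.eq_iff]
  funext x
  have := key (WithLp.toLp 2 x)
  rw [mulE_mulE] at this
  rw [Matrix.one_mulVec]
  exact congrArg WithLp.ofLp this

variable {G e k γ : ℝ} {grad : ℕ → E d → E d}

/-- The memory of the program represents the state of LightONS. -/
structure Represents (m : Memory d) (s : State d) (total : E d) : Prop where
  A_eq : m.A = s.A
  V_eq : m.V = s.A⁻¹
  y_eq : m.y = s.y.ofLp
  total_eq : m.total = total.ofLp

theorem start_val (he : 0 < e) :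
    Represents (d := d) (start e).val { A := e • (1 : Mat d), y := 0 } 0 where
  A_eq := by
    ext i j
    by_cases h : i = j
    · simp [start, bind_val, mat, h, pure_val]
    · simp [start, bind_val, mat, h, pure_val]
  V_eq := by
    have h1 : (e • (1 : Mat d))⁻¹ = (1 / e) • (1 : Mat d) := by
      refine Matrix.inv_eq_left_inv ?_
      rw [smul_mul_smul_comm, one_div, inv_mul_cancel₀ he.ne']; simp
    rw [h1]
    ext i j
    by_cases h : i = j
    · simp [start, bind_val, mat, h, pure_val, div]
    · simp [start, bind_val, mat, h, pure_val, div]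
  y_eq := rfl
  total_eq := rfl

/-- The surrogate decision of the program after a round, before the projection. -/
theorem round_val_eq (γ G e k : ℝ) (grad : ℕ → E d → E d) (t : ℕ) {m : Memory d} {s : State d}
    {total : E d} (hm : Represents m s total) (he : 0 < e)
    (hs : EigBounds s.A e (e + G ^ 2 * t)) :
    (round γ G e k grad t m).val =
      if ‖nextY γ grad t s‖ ≤ k then
        ⟨nextA grad t s, (nextA grad t s)⁻¹, (nextY γ grad t s).ofLp,
          (total + euclProj (domain d) s.y).ofLp⟩
      else ⟨nextA grad t s, (nextA grad t s)⁻¹,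
        (fastProj (nextA grad t s) (nextY γ grad t s).ofLp 1 (SXO.tolerance γ G e k (t + 1)) e
          (e + G * G * (t + 1 : ℕ))).val, (total + euclProj (domain d) s.y).ofLp⟩ := by
  obtain ⟨hA, hV, hy, ht⟩ := hm
  have hA' : (mat fun i j => do
      let c ← mul ((roundGrad grad t s).ofLp i) ((roundGrad grad t s).ofLp j)
      add (s.A i j) c).val = nextA grad t s := rfl
  have hV' : (mat fun i j => do
      let c ← mul ((s.A⁻¹.mulVec (roundGrad grad t s).ofLp) i)
        ((s.A⁻¹.mulVec (roundGrad grad t s).ofLp) j)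
      let q ← div c (1 + (roundGrad grad t s).ofLp ⬝ᵥ s.A⁻¹.mulVec (roundGrad grad t s).ofLp)
      sub (s.A⁻¹ i j) q).val = (nextA grad t s)⁻¹ := sub_div_eq_inv hs he _
  have hyhat : (vsub s.y.ofLp (smul (1 / γ)
      ((nextA grad t s)⁻¹.mulVec (roundGrad grad t s).ofLp)).val).val
      = (nextY γ grad t s).ofLp := rfl
  have htot : (vadd total.ofLp (euclProj (domain d) s.y).ofLp).val
    = (total + euclProj (domain d) s.y).ofLp := rfl
  have hn : (norm (nextY γ grad t s).ofLp).val = ‖nextY γ grad t s‖ := norm_val _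
  have hobs : (observe grad t s.y.ofLp).val
    = ((euclProj (domain d) s.y).ofLp, (roundGrad grad t s).ofLp) := observe_val grad t s.y
  simp only [round, bind_val, hy, hobs, ht, hV, hA, hA', mulVec_val, dot_val]
  have hadd : ∀ a b : ℝ, (add a b).val = a + b := fun _ _ => rfl
  have hdiv : ∀ a b : ℝ, (div a b).val = a / b := fun _ _ => rfl
  have hmul : ∀ a b : ℝ, (mul a b).val = a * b := fun _ _ => rfl
  simp only [hadd, hdiv, hmul, hV', hyhat, htot, hn, ite_val, bind_val, pure_val, le,
    decide_eq_true_eq, tolerance_val]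

theorem round_represents (hgrad : ∀ t, ∀ x ∈ domain d, ‖grad t x‖ ≤ G) (hk : 1 ≤ k)
    {t : ℕ} {m : Memory d} {s : State d} {total : E d} (hm : Represents m s total) (he : 0 < e)
    (hs : EigBounds s.A e (e + G ^ 2 * t)) :
    Represents (round γ G e k grad t m).val (step (approxProj γ G e k) γ k grad t s)
      (total + euclProj (domain d) s.y) := by
  have h := round_val_eq γ G e k grad t hm he hs
  have hA := eigBounds_nextA hgrad hs
  by_cases hc : ‖nextY γ grad t s‖ ≤ k
  · rw [if_pos hc] at h
    rw [h]
    exact ⟨rfl, rfl, by rw [step_y, if_pos hc], rfl⟩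
  · rw [if_neg hc] at h
    rw [h]
    refine ⟨rfl, rfl, ?_, rfl⟩
    rw [step_y, if_neg hc]
    push Not at hc
    have hlh : e ≤ e + G ^ 2 * (t + 1 : ℕ) := by
      nlinarith [sq_nonneg G, (Nat.cast_nonneg (t + 1) : (0 : ℝ) ≤ _)]
    have := fastProj_val hA he hlh (u := (nextY γ grad t s).ofLp)
      (lt_of_le_of_lt hk hc) (SXO.tolerance γ G e k (t + 1))
    rw [← sq, this]
    rfl

theorem loop_round_represents (hgrad : ∀ t, ∀ x ∈ domain d, ‖grad t x‖ ≤ G) (hk : 1 ≤ k)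
    (he : 0 < e) (T : ℕ) :
    Represents (loop (round γ G e k grad) T (start e).val).val
      (state (approxProj γ G e k) γ e k grad T)
      (∑ t ∈ Finset.range T, decision (approxProj γ G e k) γ e k grad t) := by
  induction T with
  | zero => exact start_val he
  | succ n ih =>
    rw [Finset.sum_range_succ, loop_succ_val]
    exact round_represents hgrad hk ih he (eigBounds_state hgrad n)

theorem lightONS_val (hgrad : ∀ t, ∀ x ∈ domain d, ‖grad t x‖ ≤ G) (hk : 1 ≤ k)
    (he : 0 < e) (T : ℕ) :
    (lightONS γ G e k grad T).val = averaged (approxProj γ G e k) γ e k grad T := by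
  have h := (loop_round_represents (γ := γ) hgrad hk he T).total_eq
  have e1 : (lightONS γ G e k grad T).val = WithLp.toLp 2 ((1 / (T : ℝ)) •
    (loop (round γ G e k grad) T (start e).val).val.total) := rfl
  rw [e1, h]
  rfl

/-! ### The running time of the program -/

theorem vec_time_le {n : ℕ} {g : Fin n → Timed ℝ} {c : ℕ} (h : ∀ i, (g i).time ≤ c) :
    (vec g).time ≤ n * (c + 1) := by
  change ∑ i, ((g i).time + 1) ≤ _
  refine (Finset.sum_le_card_nsmul _ _ (c + 1) fun i _ => Nat.add_le_add_right (h i) 1).trans ?_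
  simp

theorem sum_time_le {n : ℕ} {g : Fin n → Timed ℝ} {c : ℕ} (h : ∀ i, (g i).time ≤ c) :
    (sum g).time ≤ n * (c + 1) := vec_time_le h

theorem mat_time_le {n : ℕ} {g : Fin n → Fin n → Timed ℝ} {c : ℕ} (h : ∀ i j, (g i j).time ≤ c) :
    (mat g).time ≤ n ^ 2 * (c + 1) := by
  change ∑ i, (vec (g i)).time ≤ _
  refine (Finset.sum_le_card_nsmul _ _ (n * (c + 1)) fun i _ => vec_time_le (h i)).trans ?_
  simp [sq, mul_assoc]

theorem loop_time_le {β : Type} {body : ℕ → β → Timed β} {c : ℕ} (h : ∀ i b, (body i b).time ≤ c)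
    (n : ℕ) (b : β) : (loop body n b).time ≤ n * (c + 1) := by
  induction n with
  | zero => simp [loop, pure_time]
  | succ n ih =>
    rw [loop_succ_time, add_mul, one_mul]
    exact Nat.add_le_add ih (Nat.add_le_add_right (h _ _) 1)

theorem dot_time_le (u v : Fin d → ℝ) : (dot u v).time ≤ d * 2 :=
  sum_time_le fun _ => le_rfl

theorem norm_time_le (u : Fin d → ℝ) : (norm u).time ≤ d * 2 + 1 :=
  Nat.add_le_add_right (dot_time_le u u) 1

theorem smul_time_le (c : ℝ) (u : Fin d → ℝ) : (smul c u).time ≤ d * 2 :=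
  vec_time_le fun _ => le_rfl

theorem vsub_time_le (u v : Fin d → ℝ) : (vsub u v).time ≤ d * 2 :=
  vec_time_le fun _ => le_rfl

theorem vadd_time_le (u v : Fin d → ℝ) : (vadd u v).time ≤ d * 2 :=
  vec_time_le fun _ => le_rfl

theorem mulVec_time_le (A : Mat d) (u : Fin d → ℝ) : (mulVec A u).time ≤ d * (d * 2 + 1) :=
  vec_time_le fun _ => sum_time_le fun _ => le_rfl

theorem pivot_time_le (p : Fin d) (M : Mat d) : (pivot p M).time ≤ d ^ 2 * 4 := by
  refine mat_time_le fun i j => ?_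
  simp only [ite_time, bind_time, div, sub, mul, pure_time]
  split_ifs <;> omega

theorem inverse_time_le (M : Mat d) : (inverse M).time ≤ d * (d ^ 2 * 4 + 1) := by
  refine loop_time_le (fun i N => ?_) d M
  split_ifs
  · exact pivot_time_le _ _
  · simp [pure_time]

theorem shiftedSolve_time_le (A : Mat d) (m : ℝ) (p : Fin d → ℝ) :
    (shiftedSolve A m p).time ≤ 10 * d ^ 3 := by
  have h1 : (mat fun i j => if i = j then add (A i j) m else (pure (A i j) : Timed ℝ)).time
      ≤ d ^ 2 * 2 := by
    refine mat_time_le fun i j => ?_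
    split_ifs <;> simp [add, pure_time]
  have h2 := inverse_time_le
    (mat fun i j => if i = j then add (A i j) m else (pure (A i j) : Timed ℝ)).val
  have h3 := mulVec_time_le (inverse
    (mat fun i j => if i = j then add (A i j) m else (pure (A i j) : Timed ℝ)).val).val p
  simp only [shiftedSolve, bind_time]
  have h4 : d ≤ d ^ 3 := Nat.le_self_pow (by norm_num) d
  have h5 : d ^ 2 ≤ d ^ 3 := by
    rcases Nat.eq_zero_or_pos d with h | h
    · simp [h]
    · exact Nat.pow_le_pow_right h (by norm_num)
  nlinarith

theorem bisectBody_time_le (hd : 1 ≤ d) (A : Mat d) (p : Fin d → ℝ) (RR : ℝ) (q : ℝ × ℝ) :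
    (bisectBody A p RR q).time ≤ 16 * d ^ 3 := by
  have h1 := shiftedSolve_time_le A ((q.1 + q.2) / 2) p
  have h2 := dot_time_le (shiftedSolve A ((q.1 + q.2) / 2) p).val
    (shiftedSolve A ((q.1 + q.2) / 2) p).val
  simp only [bisectBody, bind_time, ite_time, pure_time, add, div, le, ite_self, add_zero]
  have h4 : d ≤ d ^ 3 := Nat.le_self_pow (by norm_num) d
  omega

theorem bind_time_le {β β' : Type} {m : Timed β} {g : β → Timed β'} {a b : ℕ} (hm : m.time ≤ a)
    (hg : (g m.val).time ≤ b) : (m >>= g).time ≤ a + b := Nat.add_le_add hm hg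

theorem add_time_le (a b : ℝ) : (add a b).time ≤ 1 := le_rfl

theorem sub_time_le (a b : ℝ) : (sub a b).time ≤ 1 := le_rfl

theorem mul_time_le (a b : ℝ) : (mul a b).time ≤ 1 := le_rfl

theorem div_time_le (a b : ℝ) : (div a b).time ≤ 1 := le_rfl

theorem fastProj_time_le (hd : 1 ≤ d) (A : Mat d) (u : Fin d → ℝ) (ζ lo hi : ℝ) :
    (fastProj A u 1 ζ lo hi).time
      ≤ 50 * d ^ 3 * (bisectCount ‖(WithLp.toLp 2 u : E d)‖ 1 ζ lo hi + 1) := by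
  rw [← norm_val]
  refine (bind_time_le (mulVec_time_le _ _) <| bind_time_le (mul_time_le _ _) <|
    bind_time_le (norm_time_le _) <| bind_time_le (div_time_le _ _) <|
    bind_time_le (sub_time_le _ _) <| bind_time_le (mul_time_le _ _) <|
    bind_time_le (mul_time_le _ _) <| bind_time_le (div_time_le _ _) <|
    bind_time_le (div_time_le _ _) <| bind_time_le (sub_time_le _ _) <|
    bind_time_le (mul_time_le _ _) <| bind_time_le (mul_time_le _ _) <|
    bind_time_le (mul_time_le _ _) <|
    bind_time_le (m := ceilLog2 _) (a := 2 * bisectCount (norm u).val 1 ζ lo hi + 1) le_rfl <|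
    bind_time_le (loop_time_le
      (fun _ q => bisectBody_time_le hd A (mulVec A u).val (mul 1 1).val q) _ _) <|
    bind_time_le (add_time_le _ _) <|
    bind_time_le (div_time_le _ _) <| bind_time_le (shiftedSolve_time_le _ _ _) <|
    bind_time_le (norm_time_le _) <| bind_time_le (div_time_le _ _) (smul_time_le _ _)).trans ?_
  change _ + (_ + (_ + (_ + (_ + (_ + (_ + (_ + (_ + (_ + (_ + (_ + (_ + (_ +
    (bisectCount (norm u).val 1 ζ lo hi * _ + _)))))))))))))) ≤ _
  set n := bisectCount (norm u).val 1 ζ lo hi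
  have h7 : d ≤ d ^ 3 := Nat.le_self_pow (by norm_num) d
  have h8 : d ^ 2 ≤ d ^ 3 := Nat.pow_le_pow_right hd (by norm_num)
  nlinarith [Nat.zero_le n]

theorem tolerance_time (γ G e k : ℝ) (t : ℕ) : (tolerance γ G e k t).time = 16 := by
  simp [tolerance, bind_time, mul, add, div, sqrt, le, ite_time, pure_time]

theorem observe_time_le (hd : 1 ≤ d) (grad : ℕ → E d → E d) (t : ℕ) (y : Fin d → ℝ) :
    (observe grad t y).time ≤ 30 * d := by
  simp only [observe, bind_time, ite_time, pure_time, le, div, sub, query]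
  have h1 := norm_time_le y
  have h2 := smul_time_le (d := d)
  have h3 := vsub_time_le (d := d)
  have h4 := dot_time_le (d := d)
  have h5 := vadd_time_le (d := d)
  split_ifs
  · omega
  · have a1 := h2 (1 / (norm y).val) y
    have a2 := h3 y (smul (1 / (norm y).val) y).val
    set x := (smul (1 / (norm y).val) y).val
    have a3 := h4 ((grad t (WithLp.toLp 2 x)).ofLp) (vsub y x).val
    omega
  · have a1 := h2 (1 / (norm y).val) y
    have a2 := h3 y (smul (1 / (norm y).val) y).val
    set x := (smul (1 / (norm y).val) y).val
    set v := (vsub y x).val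
    set g := (grad t (WithLp.toLp 2 x)).ofLp
    have a3 := h4 g v
    have a4 := h4 v v
    have a5 := h2 ((0 - (dot g v).val) / (dot v v).val) v
    have a6 := h5 g (smul ((0 - (dot g v).val) / (dot v v).val) v).val
    omega

theorem start_time_le (hd : 1 ≤ d) (e : ℝ) : (start (d := d) e).time ≤ 5 * d ^ 2 := by
  have h1 : ∀ c : ℝ, (mat fun i j : Fin d => if i = j then (pure c : Timed ℝ) else pure 0).time
      ≤ d ^ 2 * 1 := fun c => mat_time_le fun i j => by split_ifs <;> simp [pure_time]
  have h2 : (vec fun _ : Fin d => (pure 0 : Timed ℝ)).time ≤ d * 1 :=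
    vec_time_le fun i => by simp [pure_time]
  have h3 := h1 e
  have h4 := h1 (1 / e)
  have h5 : d ≤ d ^ 2 := Nat.le_self_pow (by norm_num) d
  have h6 : (start (d := d) e).time
    = (mat fun i j : Fin d => if i = j then (pure e : Timed ℝ) else pure 0).time + (1 +
      ((mat fun i j : Fin d => if i = j then (pure (1 / e) : Timed ℝ) else pure 0).time +
      ((vec fun _ : Fin d => (pure 0 : Timed ℝ)).time +
        ((vec fun _ : Fin d => (pure 0 : Timed ℝ)).time + 0)))) := rfl
  nlinarith

end Timed

/-! ### Total running time -/

namespace Timed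

variable {G e k γ : ℝ} {grad : ℕ → E d → E d}

/-- The cubic cost is charged only in rounds with a projection. Whether one occurs depends on the
data, which is why the memory must represent a state of LightONS. -/
theorem round_time_le (hd : 1 ≤ d) (γ G e k : ℝ) (grad : ℕ → E d → E d) (t : ℕ) {m : Memory d}
    {s : State d} {total : E d} (hm : Represents m s total) (he : 0 < e)
    (hs : EigBounds s.A e (e + G ^ 2 * t)) :
    (round γ G e k grad t m).time ≤ 60 * d ^ 2 + if ‖nextY γ grad t s‖ ≤ k then 0 else
      70 * d ^ 3 * (bisectCount ‖nextY γ grad t s‖ 1 (SXO.tolerance γ G e k (t + 1)) e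
          (e + G ^ 2 * (t + 1 : ℕ)) + 1) := by
  obtain ⟨hA, hV, hy, ht⟩ := hm
  have hV' : (mat fun i j => do
      let c ← mul ((s.A⁻¹.mulVec (roundGrad grad t s).ofLp) i)
        ((s.A⁻¹.mulVec (roundGrad grad t s).ofLp) j)
      let q ← div c (1 + (roundGrad grad t s).ofLp ⬝ᵥ s.A⁻¹.mulVec (roundGrad grad t s).ofLp)
      sub (s.A⁻¹ i j) q).val = (nextA grad t s)⁻¹ := sub_div_eq_inv hs he _
  have hyhat : (vsub s.y.ofLp (smul (1 / γ)
      ((nextA grad t s)⁻¹.mulVec (roundGrad grad t s).ofLp)).val).val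
      = (nextY γ grad t s).ofLp := rfl
  have hn : (norm (nextY γ grad t s).ofLp).val = ‖nextY γ grad t s‖ := norm_val _
  have hobs : (observe grad t s.y.ofLp).val
    = ((euclProj (domain d) s.y).ofLp, (roundGrad grad t s).ofLp) := observe_val grad t s.y
  have hadd : ∀ a b : ℝ, (add a b).val = a + b := fun _ _ => rfl
  have hdiv : ∀ a b : ℝ, (div a b).val = a / b := fun _ _ => rfl
  have hmul : ∀ a b : ℝ, (mul a b).val = a * b := fun _ _ => rfl
  simp only [round, bind_time, hy, hobs, ht, hV, hA, mulVec_val, dot_val, hadd, hdiv,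
    hmul, hV', hyhat, hn, ite_time, pure_time, le_val, tolerance_val]
  refine (Nat.add_le_add (observe_time_le hd _ _ _) <| Nat.add_le_add (vadd_time_le _ _) <|
    Nat.add_le_add (mat_time_le (c := 2) fun _ _ => le_rfl) <|
    Nat.add_le_add (mulVec_time_le _ _) <| Nat.add_le_add (dot_time_le _ _) <|
    Nat.add_le_add (add_time_le _ _) <|
    Nat.add_le_add (mat_time_le (c := 3) fun _ _ => le_rfl) <|
    Nat.add_le_add (mulVec_time_le _ _) <| Nat.add_le_add (div_time_le _ _) <|
    Nat.add_le_add (smul_time_le _ _) <| Nat.add_le_add (vsub_time_le _ _) <|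
    Nat.add_le_add (norm_time_le _) <|
    Nat.add_le_add (show (le _ _).time ≤ 1 from le_rfl) le_rfl).trans ?_
  have h1 : d ≤ d ^ 2 := Nat.le_self_pow (by norm_num) d
  by_cases hc : ‖nextY γ grad t s‖ ≤ k
  · simp only [if_pos hc]
    nlinarith
  · simp only [if_neg hc]
    have h2 := fastProj_time_le hd (mat fun i j => do
      let c ← mul ((roundGrad grad t s).ofLp i) ((roundGrad grad t s).ofLp j)
      add (s.A i j) c).val (nextY γ grad t s).ofLp (SXO.tolerance γ G e k (t + 1)) e
      (e + G * G * (t + 1 : ℕ))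
    rw [WithLp.toLp_ofLp, ← sq G] at h2
    rw [← sq G]
    have h4 : ∀ a b : ℝ, (mul a b).time = 1 := fun _ _ => rfl
    have h5 : ∀ a b : ℝ, (add a b).time = 1 := fun _ _ => rfl
    have h6 : 1 ≤ d ^ 3 := Nat.one_le_pow _ _ hd
    rw [tolerance_time, h4, h4, h5]
    generalize (fastProj _ _ _ _ _ _).time = τ at h2 ⊢
    generalize bisectCount _ _ _ _ _ = n at h2 ⊢
    have h7 : 1 ≤ d ^ 3 * (n + 1) := Nat.mul_pos h6 n.succ_pos
    have h8 : d * (d * 2 + 1) = 2 * d ^ 2 + d := by ring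
    rw [mul_assoc] at h2 ⊢
    rw [h8]
    generalize d ^ 3 * (n + 1) = x at h2 h7 ⊢
    generalize d ^ 2 = y at h1 ⊢
    clear * - hd h1 h2 h7
    linarith

/-- The drift of one round: the eigenvalues of the preconditioner are at least `e`, so the Newton
step has length at most `G / (γ e)`. -/
theorem norm_nextY_le (hγ : 0 < γ) (he : 0 < e) (hgrad : ∀ t, ∀ x ∈ domain d, ‖grad t x‖ ≤ G)
    {t : ℕ} {s : State d} (hs : EigBounds s.A e (e + G ^ 2 * t)) :
    ‖nextY γ grad t s‖ ≤ ‖s.y‖ + G / (γ * e) := by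
  have h1 := (eigBounds_nextA hgrad hs).norm_inv_mulE_le he (roundGrad grad t s)
  have h2 := norm_roundGrad_le hgrad t s
  refine (norm_sub_le _ _).trans (add_le_add_right ?_ _)
  rw [norm_smul, Real.norm_of_nonneg (by positivity)]
  calc 1 / γ * ‖mulE (nextA grad t s)⁻¹ (roundGrad grad t s)‖
      ≤ 1 / γ * (G / e) := by
        gcongr
        exact h1.trans (by gcongr)
    _ = G / (γ * e) := by field_simp

/-- The hysteresis makes projections rare: the total time is linear in the number of rounds, with
the cost `W (k - 1)` of a projection multiplied by the drift `G / (γ e)` of one round. -/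
theorem loop_round_time_le (hd : 1 ≤ d) (hγ : 0 < γ) (hk : 1 < k) (he : 0 < e)
    (hgrad : ∀ t, ∀ x ∈ domain d, ‖grad t x‖ ≤ G) {W : ℝ} (hW : 0 ≤ W) {T : ℕ}
    (hB : ∀ t < T, ∀ r, 1 < r → r ≤ k + G / (γ * e) →
      70 * (d : ℝ) ^ 3 * (bisectCount r 1 (SXO.tolerance γ G e k (t + 1)) e
          (e + G ^ 2 * (t + 1 : ℕ)) + 1) ≤ W * (k - 1)) :
    ((loop (round γ G e k grad) T (start e).val).time : ℝ)
      + W * ‖(state (approxProj γ G e k) γ e k grad T).y‖ ≤ T * (61 * d ^ 2 + W * (G / (γ * e))) := by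
  induction T with
  | zero => simp [loop, pure_time, state]
  | succ n ih =>
    have ih := ih fun t ht => hB t (by omega)
    have hA := eigBounds_state (proj := approxProj γ G e k) (γ := γ) (e := e) (k := k) hgrad n
    have hrep := loop_round_represents (γ := γ) hgrad hk.le he n
    have h1 := round_time_le hd γ G e k grad n hrep he hA
    have hproj : IsNearProj (approxProj (d := d) γ G e k) G e _ := isNearProj_approxProj hγ hk.le he
    have h2 := norm_nextY_le hγ he hgrad hA
    have h2' := norm_state_le (γ := γ) hproj hk.le hgrad n
    rw [loop_succ_time]
    simp only [state, step_y]
    set s := state (approxProj γ G e k) γ e k grad n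
    set m := (loop (round γ G e k grad) n (start e).val).val
    have hd1 : (1 : ℝ) ≤ (d : ℝ) ^ 2 := one_le_pow₀ (by exact_mod_cast hd)
    have h1' : ((round γ G e k grad n m).time : ℝ) ≤ 60 * (d : ℝ) ^ 2
      + if ‖nextY γ grad n s‖ ≤ k then 0 else
      70 * (d : ℝ) ^ 3 * (bisectCount ‖nextY γ grad n s‖ 1 (SXO.tolerance γ G e k (n + 1)) e
          (e + G ^ 2 * (n + 1 : ℕ)) + 1) := by
      by_cases hc : ‖nextY γ grad n s‖ ≤ k
      · simp only [if_pos hc] at h1 ⊢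
        exact_mod_cast h1
      · simp only [if_neg hc] at h1 ⊢
        exact_mod_cast h1
    push_cast
    have h3 := mul_le_mul_of_nonneg_left h2 hW
    by_cases hc : ‖nextY γ grad n s‖ ≤ k
    · simp only [if_pos hc] at h1' ⊢
      linarith
    · simp only [if_neg hc] at h1' ⊢
      push Not at hc
      -- A projection lowers the norm from above `k` to at most `1`; the drop of the potential `W
      -- ‖y‖` pays its cost `W (k - 1)`.
      have h4 := hB n (by omega) ‖nextY γ grad n s‖ (by linarith) (by linarith)
      have h5 := hproj.norm_le n _ _ (eigBounds_nextA hgrad hA) (by linarith : 1 < ‖nextY γ grad n s‖)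
      have h6 := mul_le_mul_of_nonneg_left h5 hW
      have h7 := mul_le_mul_of_nonneg_left hc.le hW
      linarith

/-- The reciprocal of a minimum is at most the sum of the reciprocals, and `√x ≤ 1 + x` makes the
bound polynomial in the round number. -/
theorem inv_tolerance_le (hγ : 0 < γ) (hk : 0 < k) (he : 0 < e) (t : ℕ) :
    1 / SXO.tolerance γ G e k (t + 1) ≤
      4 * k * (G ^ 2 * (t + 1 : ℕ) + e) * ((t + 1 : ℕ) : ℝ) ^ 2 / γ
        + (t + 1 : ℕ) * (1 + 2 * (G ^ 2 * (t + 1 : ℕ) + e) * (t + 1 : ℕ) / γ) := by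
  unfold SXO.tolerance
  set s : ℝ := ((t + 1 : ℕ) : ℝ)
  have hs0 : 0 < s := by positivity
  set m := G ^ 2 * s + e
  have hm0 : 0 < m := by positivity
  rcases le_total (γ / (2 * k * 2 * m * s ^ 2)) (1 / s * √(γ / (2 * m * s))) with h | h
  · rw [min_eq_left h]
    have e1 : 1 / (γ / (2 * k * 2 * m * s ^ 2)) = 4 * k * m * s ^ 2 / γ := by
      field_simp; norm_num
    rw [e1]
    have : 0 ≤ s * (1 + 2 * m * s / γ) := by positivity
    linarith
  · rw [min_eq_right h]
    have e1 : 1 / (1 / s * √(γ / (2 * m * s))) = s * √(2 * m * s / γ) := by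
      rw [← inv_div (2 * m * s) γ, Real.sqrt_inv]; field_simp
    rw [e1]
    have h2 : √(2 * m * s / γ) ≤ 1 + 2 * m * s / γ := by
      have h0 : 0 ≤ 2 * m * s / γ := by positivity
      rw [Real.sqrt_le_left (by positivity)]
      nlinarith
    have : 0 ≤ 4 * k * m * s ^ 2 / γ := by positivity
    have := mul_le_mul_of_nonneg_left h2 hs0.le
    linarith

set_option maxHeartbeats 1000000 in
/-- The number of bisection steps is logarithmic in the number of rounds. -/
theorem exists_bisectCount_le (hγ : 0 < γ) (hG : 0 < G) (hk : 1 < k) :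
    ∃ C : ℝ, 0 ≤ C ∧ ∀ e : ℝ, 1 ≤ e → ∀ T : ℕ, 3 ≤ T → ∀ t < T, ∀ r, 1 < r →
      r ≤ k + G / (γ * e) → (bisectCount r 1 (SXO.tolerance γ G e k (t + 1)) e
          (e + G ^ 2 * (t + 1 : ℕ)) : ℝ) + 1 ≤ C * Real.log T := by
  -- The argument of the logarithm will be at most `K T⁴`; the summand `1` ensures `log K ≥ 0`.
  set K := G ^ 2 * (4 * k * (G ^ 2 + 1) / γ + (1 + 2 * (G ^ 2 + 1) / γ)) * (k + G / γ) ^ 2 + 1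
    with hK
  have hK1 : 1 ≤ K := by rw [hK]; simp; positivity
  have hlogK : 0 ≤ Real.log K := Real.log_nonneg hK1
  refine ⟨2 * Real.log K + 10, by positivity, ?_⟩
  intro e he T hT t ht r hr1 hr2
  have he0 : 0 < e := by linarith
  have hk0 : 0 < k := by linarith
  have hTs : ((t + 1 : ℕ) : ℝ) ≤ T := by exact_mod_cast ht
  set s : ℝ := ((t + 1 : ℕ) : ℝ) with hs
  have hs1 : 1 ≤ s := by rw [hs]; push_cast; linarith [(Nat.cast_nonneg t : (0 : ℝ) ≤ t)]
  have hs0 : 0 < s := by linarith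
  have hlogT : 1 ≤ Real.log T := by
    have hT' : (3 : ℝ) ≤ T := by exact_mod_cast hT
    rw [Real.le_log_iff_exp_le (by linarith)]
    linarith [Real.exp_one_lt_d9]
  set ζ := SXO.tolerance γ G e k (t + 1) with hζ
  have hζ0 : 0 < ζ := tolerance_pos hγ hk0 he0 t
  set m := G ^ 2 * s + e with hm
  have hm0 : 0 < m := by positivity
  -- Dividing by `e ≥ 1` makes all bounds uniform in the preconditioner coefficient.
  have hme : m / e ≤ (G ^ 2 + 1) * s := by
    rw [div_le_iff₀ he0, hm]
    nlinarith [sq_nonneg G, mul_nonneg (mul_nonneg (sq_nonneg G) hs0.le) (sub_nonneg.2 he),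
      mul_nonneg (sub_nonneg.2 hs1) he0.le]
  have h1 := inv_tolerance_le (G := G) hγ hk0 he0 t
  rw [← hζ, ← hs, ← hm] at h1
  set a := 1 / ζ * ((e + G ^ 2 * s) / e - 1) * r * (r / 1 - 1) with ha
  have hcount : bisectCount r 1 ζ e (e + G ^ 2 * s) = ⌈Real.logb 2 a⌉₊ := rfl
  have e2 : (e + G ^ 2 * s) / e - 1 = G ^ 2 * s / e := by field_simp; ring
  have h3 : 1 / ζ * (G ^ 2 * s / e) ≤
      G ^ 2 * (4 * k * (G ^ 2 + 1) / γ + (1 + 2 * (G ^ 2 + 1) / γ)) * s ^ 4 := by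
    have hie : 1 / e ≤ 1 := by rw [div_le_one he0]; exact he
    calc 1 / ζ * (G ^ 2 * s / e)
        ≤ (4 * k * m * s ^ 2 / γ + s * (1 + 2 * m * s / γ)) * (G ^ 2 * s / e) := by gcongr
      _ = G ^ 2 * (4 * k * (m / e) * s ^ 3 / γ + (1 / e * s ^ 2 + 2 * (m / e) * s ^ 3 / γ)) := by
          field_simp
      _ ≤ G ^ 2 * (4 * k * ((G ^ 2 + 1) * s) * s ^ 3 / γ
          + (1 * s ^ 4 + 2 * ((G ^ 2 + 1) * s) * s ^ 3 / γ)) := by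
          gcongr
          norm_num
      _ = _ := by ring
  have hrb : r ≤ k + G / γ := by
    refine hr2.trans (add_le_add_right ?_ _)
    exact div_le_div_of_nonneg_left hG.le hγ (by nlinarith)
  have h4 : a ≤ K * (T : ℝ) ^ 4 := by
    rw [ha, e2, div_one]
    have h5 : 0 ≤ r - 1 := by linarith
    calc 1 / ζ * (G ^ 2 * s / e) * r * (r - 1)
        = 1 / ζ * (G ^ 2 * s / e) * (r * (r - 1)) := by ring
      _ ≤ G ^ 2 * (4 * k * (G ^ 2 + 1) / γ + (1 + 2 * (G ^ 2 + 1) / γ)) * s ^ 4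
          * (k + G / γ) ^ 2 := by
          gcongr
          rw [sq]
          gcongr
          linarith
      _ = G ^ 2 * (4 * k * (G ^ 2 + 1) / γ + (1 + 2 * (G ^ 2 + 1) / γ)) * (k + G / γ) ^ 2
          * s ^ 4 := by ring
      _ ≤ K * (T : ℝ) ^ 4 := by
          gcongr
          rw [hK]; linarith
  have hT0 : (0 : ℝ) < T := by linarith
  have h6 : Real.logb 2 a ≤ 2 * Real.log K + 8 * Real.log T := by
    have ha0 : 0 ≤ a := by
      rw [ha, e2, div_one]
      have h5 : 0 ≤ r - 1 := by linarith
      positivity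
    rcases ha0.eq_or_lt with h0 | h0
    · rw [← h0, Real.logb_zero]; positivity
    · have h7 : Real.log a ≤ Real.log K + 4 * Real.log T := by
        refine (Real.log_le_log h0 h4).trans (le_of_eq ?_)
        rw [Real.log_mul (by positivity) (by positivity), Real.log_pow]
        norm_num
      rw [Real.logb, div_le_iff₀ (Real.log_pos (by norm_num))]
      have h8 : (0.5 : ℝ) ≤ Real.log 2 := by linarith [Real.log_two_gt_d9]
      nlinarith
  rw [hcount]
  have h9 : (⌈Real.logb 2 a⌉₊ : ℝ) ≤ 2 * Real.log K + 8 * Real.log T + 1 := by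
    refine (Nat.cast_le.2 (Nat.ceil_mono h6)).trans ?_
    exact (Nat.ceil_lt_add_one (by positivity)).le
  nlinarith

/-- With preconditioner coefficient `d log T` the program takes `O(T d²)` operations. -/
theorem exists_lightONS_time_le (hγ : 0 < γ) (hG : 0 < G) (hk : 1 < k) :
    ∃ C : ℝ, 0 ≤ C ∧ ∀ d : ℕ, 1 ≤ d → ∀ T : ℕ, 3 ≤ T → ∀ grad : ℕ → E d → E d,
      (∀ t, ∀ x ∈ domain d, ‖grad t x‖ ≤ G) →
      ((lightONS γ G (d * Real.log T) k grad T).time : ℝ) ≤ C * (T * d ^ 2) := by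
  obtain ⟨C, hC0, hC⟩ := exists_bisectCount_le hγ hG hk
  have hk1 : 0 < k - 1 := by linarith
  refine ⟨70 + 70 * C * G / (γ * (k - 1)), by positivity, ?_⟩
  intro d hd T hT grad hgrad
  have hd' : (1 : ℝ) ≤ d := by exact_mod_cast hd
  have hT' : (3 : ℝ) ≤ T := by exact_mod_cast hT
  have hlogT : 1 ≤ Real.log T := by
    rw [Real.le_log_iff_exp_le (by linarith)]
    linarith [Real.exp_one_lt_d9]
  set e := d * Real.log T with he
  have he1 : 1 ≤ e := by nlinarith
  have he0 : 0 < e := by linarith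
  set W := 70 * (d : ℝ) ^ 3 * (C * Real.log T) / (k - 1) with hW
  have h1 := loop_round_time_le (T := T) hd hγ hk he0 hgrad (W := W) (by positivity) (by
    intro t ht r hr1 hr2
    rw [hW, div_mul_cancel₀ _ hk1.ne']
    exact mul_le_mul_of_nonneg_left (hC e he1 T hT t ht r hr1 hr2) (by positivity))
  -- The drift carries `1 / (d log T)`, which cancels the logarithm from the bisection and one of
  -- the three factors `d` of a projection.
  have h2 : W * (G / (γ * e)) = 70 * C * G / (γ * (k - 1)) * d ^ 2 := by
    rw [hW, he]; field_simp
  rw [h2] at h1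
  have h3 : 0 ≤ W * ‖(state (approxProj γ G e k) γ e k grad T).y‖ := by positivity
  have h4 : (lightONS γ G e k grad T).time ≤ 5 * d ^ 2
      + ((loop (round γ G e k grad) T (start e).val).time + (1 + (d * 2 + 0))) :=
    bind_time_le (start_time_le hd e) <| bind_time_le le_rfl <|
      bind_time_le (div_time_le _ _) <| bind_time_le (smul_time_le _ _) le_rfl
  have h4' : ((lightONS γ G e k grad T).time : ℝ) ≤ 5 * (d : ℝ) ^ 2
      + (((loop (round γ G e k grad) T (start e).val).time : ℝ) + (1 + ((d : ℝ) * 2 + 0))) := by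
    exact_mod_cast h4
  have h5 : (d : ℝ) ≤ d ^ 2 := by nlinarith
  have h6 : 5 * (d : ℝ) ^ 2 + (1 + ((d : ℝ) * 2 + 0)) ≤ T * (9 * d ^ 2) := by nlinarith
  have h7 : (70 + 70 * C * G / (γ * (k - 1))) * (T * (d : ℝ) ^ 2)
    = T * (61 * d ^ 2 + 70 * C * G / (γ * (k - 1)) * d ^ 2) + T * (9 * d ^ 2) := by ring
  rw [h7]
  linarith

end Timed

/-! ### Regret, risk and time in terms of the target accuracy -/

section Rates

variable {α G : ℝ}

theorem one_le_log_of_three_le {T : ℕ} (hT : 3 ≤ T) : 1 ≤ Real.log T := by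
  have h3 : (3 : ℝ) ≤ T := by exact_mod_cast hT
  rw [Real.le_log_iff_exp_le (by linarith)]
  exact Real.exp_one_lt_three.le.trans h3

/-- For this preconditioner coefficient both terms of the regret bound are of order `d log T`, and
`d log T ≥ 1` absorbs the constant `c`. -/
theorem exists_regretBound_le (hα : 0 < α) (hG : 0 < G) (c : ℝ) (hc : 0 ≤ c) :
    ∃ K : ℝ, 0 ≤ K ∧ ∀ d : ℕ, 1 ≤ d → ∀ T : ℕ, 3 ≤ T →
      regretBound α G (d * Real.log T) d T + c ≤ K * (d * Real.log T) := by
  have hγ := gamma0_pos hα hG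
  have hl : 0 ≤ Real.log (1 + G ^ 2) := Real.log_nonneg (by nlinarith)
  refine ⟨(Real.log (1 + G ^ 2) + 1) / (2 * gamma0 α G) + gamma0 α G / 2 + c, by positivity, ?_⟩
  intro d hd T hT
  have hd' : (1 : ℝ) ≤ d := by exact_mod_cast hd
  have hlog := one_le_log_of_three_le hT
  have hT0 : (1 : ℝ) ≤ T := by exact_mod_cast (by omega : 1 ≤ T)
  have hdl : 1 ≤ d * Real.log T := one_le_mul_of_one_le_of_one_le hd' hlog
  have h1 : Real.log (1 + G ^ 2 / (d * (d * Real.log T)) * T)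
      ≤ (Real.log (1 + G ^ 2) + 1) * Real.log T := by
    have h2 : G ^ 2 / (d * (d * Real.log T)) ≤ G ^ 2 :=
      div_le_self (sq_nonneg G) (one_le_mul_of_one_le_of_one_le hd' hdl)
    calc Real.log (1 + G ^ 2 / (d * (d * Real.log T)) * T)
        ≤ Real.log ((1 + G ^ 2) * T) := by
          refine Real.log_le_log (by positivity) ?_
          nlinarith [mul_le_mul_of_nonneg_right h2 (by linarith : (0 : ℝ) ≤ T)]
      _ = Real.log (1 + G ^ 2) + Real.log T := Real.log_mul (by positivity) (by positivity)
      _ ≤ _ := by nlinarith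
  have h3 : (d : ℝ) / (2 * gamma0 α G) * Real.log (1 + G ^ 2 / (d * (d * Real.log T)) * T)
      ≤ (Real.log (1 + G ^ 2) + 1) / (2 * gamma0 α G) * (d * Real.log T) := by
    refine (mul_le_mul_of_nonneg_left h1 (by positivity)).trans (le_of_eq ?_)
    ring
  have h4 : c ≤ c * (d * Real.log T) := le_mul_of_one_le_right hc hdl
  rw [regretBound]
  linarith

/-- The mixed term is removed by `√(p q) ≤ p + q`, and `log (4 log T)` is absorbed by `4 d log T`.
-/
theorem exists_riskBound_le (hα : 0 < α) (hG : 0 < G) (c : ℝ) (hc : 0 ≤ c) :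
    ∃ K : ℝ, 0 ≤ K ∧ ∀ d : ℕ, 1 ≤ d → ∀ T : ℕ, 3 ≤ T → ∀ δ : ℝ, 0 < δ → δ < 1 → ∀ r : ℝ,
      r ≤ regretBound α G (d * Real.log T) d T + c →
      riskBound α G δ T r ≤ K * ((d * Real.log T + Real.log (1 / δ)) / T) := by
  obtain ⟨K, hK0, hK⟩ := exists_regretBound_le hα hG c hc
  have hγ := gamma0_pos hα hG
  refine ⟨K + 2 * K / gamma0 α G + 16 + 32 / gamma0 α G, by positivity, ?_⟩
  intro d hd T hT δ hδ0 hδ1 r hr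
  have hd' : (1 : ℝ) ≤ d := by exact_mod_cast hd
  have hlog := one_le_log_of_three_le hT
  have hT0 : (0 : ℝ) < T := by exact_mod_cast (by omega : 0 < T)
  have hΛ : 0 ≤ Real.log (1 / δ) := Real.log_nonneg (by rw [le_div_iff₀ hδ0]; linarith)
  have hrK := hr.trans (hK d hd T hT)
  set γ := gamma0 α G
  have hL : Real.log (4 * Real.log T / δ) ≤ 4 * (d * Real.log T) + Real.log (1 / δ) := by
    rw [show 4 * Real.log T / δ = 4 * Real.log T * (1 / δ) by ring,
      Real.log_mul (by positivity) (by positivity)]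
    have h1 := Real.log_le_sub_one_of_pos (show 0 < 4 * Real.log T by positivity)
    nlinarith
  have hL0 : 0 ≤ Real.log (4 * Real.log T / δ) :=
    Real.log_nonneg (by rw [le_div_iff₀ hδ0]; linarith)
  set l := Real.log (4 * Real.log T / δ)
  set D := d * Real.log T
  have hD : 0 ≤ D := by positivity
  have hsqrt : √(r / (2 * γ) * l) ≤ K * D / (2 * γ) + (4 * D + Real.log (1 / δ)) := by
    have h1 : 0 ≤ K * D / (2 * γ) := by positivity
    refine Real.sqrt_le_iff.2 ⟨by linarith, ?_⟩
    calc r / (2 * γ) * l ≤ K * D / (2 * γ) * (4 * D + Real.log (1 / δ)) := by gcongr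
      _ ≤ _ := by nlinarith
  have h8 : 8 / γ * l ≤ 8 / γ * (4 * D + Real.log (1 / δ)) := by gcongr
  rw [riskBound]
  calc 1 / (T : ℝ) * (r + 4 * √(r / (2 * γ) * l) + 8 / γ * l)
      ≤ 1 / (T : ℝ) * (K * D + 4 * (K * D / (2 * γ) + (4 * D + Real.log (1 / δ)))
        + 8 / γ * (4 * D + Real.log (1 / δ))) := by gcongr
    _ ≤ 1 / (T : ℝ) * ((K + 2 * K / γ + 16 + 32 / γ) * (D + Real.log (1 / δ))) := by
        gcongr
        have e1 : (K + 2 * K / γ + 16 + 32 / γ) * (D + Real.log (1 / δ))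
            - (K * D + 4 * (K * D / (2 * γ) + (4 * D + Real.log (1 / δ)))
              + 8 / γ * (4 * D + Real.log (1 / δ)))
            = (K + 2 * K / γ + 12 + 24 / γ) * Real.log (1 / δ) := by
          field_simp; ring
        have e2 : 0 ≤ (K + 2 * K / γ + 12 + 24 / γ) * Real.log (1 / δ) := by positivity
        linarith
    _ = _ := by ring

/-- If `T` is at least of the order `(d / ε) log (d / ε) Λ`, then `d log T` and `Λ` are at most of
the order `T ε`. -/
theorem mul_log_le_and_le {c₁ r₀ Λ₀ ε Λ T : ℝ} {d : ℕ} (hc₁ : 0 < c₁) (hr₀ : 1 < r₀)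
    (hΛ₀ : 0 < Λ₀) (hd : 1 ≤ d) (hε : 0 < ε) (hr : r₀ ≤ d / ε) (hΛ : Λ₀ ≤ Λ)
    (hT : c₁ * (d / ε * Real.log (d / ε) * Λ) ≤ T) :
    d * Real.log T ≤ (1 / (c₁ * Λ₀) + 1) * (T * ε) ∧ Λ ≤ 1 / (c₁ * Real.log r₀) * (T * ε) := by
  have hd' : (1 : ℝ) ≤ d := by exact_mod_cast hd
  have hl0 : 0 < Real.log r₀ := Real.log_pos hr₀
  have hl : Real.log r₀ ≤ Real.log (d / ε) := Real.log_le_log (by linarith) hr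
  have hr0 : (0 : ℝ) < d / ε := by linarith
  have hΛ0 : 0 < Λ := hΛ₀.trans_le hΛ
  have hT0 : 0 < T := by
    have : 0 < Real.log (d / ε) := by linarith
    exact lt_of_lt_of_le (by positivity) hT
  have hTε : T * ε = d * (T / (d / ε)) := by field_simp
  have hTr : 0 < T / (d / ε) := by positivity
  have h1 : c₁ * (Real.log (d / ε) * Λ) ≤ T / (d / ε) := by
    rw [le_div_iff₀ hr0]
    linarith
  -- Split `T = (d / ε) (T / (d / ε))`: the logarithm of the second factor is at most the factor
  -- itself, and that of the first is controlled by the lower bound on `T`.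
  constructor
  · have h2 : Real.log T = Real.log (d / ε) + Real.log (T / (d / ε)) := by
      rw [← Real.log_mul hr0.ne' hTr.ne']
      congr 1
      field_simp
    have h3 := Real.log_le_sub_one_of_pos hTr
    have h4 : Real.log (d / ε) ≤ 1 / (c₁ * Λ₀) * (T / (d / ε)) := by
      rw [one_div, ← div_eq_inv_mul, le_div_iff₀ (by positivity)]
      refine le_trans ?_ h1
      calc Real.log (d / ε) * (c₁ * Λ₀) = c₁ * (Real.log (d / ε) * Λ₀) := by ring
        _ ≤ _ := by gcongr; linarith
    calc d * Real.log T ≤ d * ((1 / (c₁ * Λ₀) + 1) * (T / (d / ε))) := by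
          gcongr
          linarith
      _ = _ := by rw [hTε]; ring
  · rw [one_div, ← div_eq_inv_mul, le_div_iff₀ (by positivity), hTε]
    calc Λ * (c₁ * Real.log r₀) = c₁ * (Real.log r₀ * Λ) := by ring
      _ ≤ c₁ * (Real.log (d / ε) * Λ) := by gcongr
      _ ≤ T / (d / ε) := h1
      _ ≤ _ := le_mul_of_one_le_left hTr.le hd'

theorem time_rate_le {τ T C C' c₂ ε L : ℝ} {d : ℕ} (hC : 0 ≤ C) (hε : 0 < ε) (hC' : C * c₂ ≤ C')
    (hL : 0 ≤ L) (hτ : τ ≤ C * (T * d ^ 2)) (hT : T ≤ c₂ * (d / ε * L)) :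
    τ ≤ C' * ((d : ℝ) ^ 3 / ε * L) := by
  calc τ ≤ C * (T * d ^ 2) := hτ
    _ ≤ C * (c₂ * (d / ε * L) * d ^ 2) := by gcongr
    _ = C * c₂ * ((d : ℝ) ^ 3 / ε * L) := by ring
    _ ≤ _ := by gcongr

end Rates

end SXO

/-! ### Assembly of the main theorem -/

open MeasureTheory ProbabilityTheory SXO in
theorem mainTheorem5 (α G k : ℝ) (hα : 0 < α) (hG : 0 < G) (hk : 1 < k) (hk3 : k ≤ 3) :
    -- `C₀` and `p` depend on `α`, `G`, `k` only
    ∃ (C₀ : ℝ) (p : ℕ), ∀ (c₁ c₂ r₀ δ₀ : ℝ), 0 < c₁ → c₁ ≤ c₂ → 1 < r₀ → 0 < δ₀ → δ₀ < 1 →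
    -- `C` depends on `α`, `G`, `k`, the constants in `T = Θ(⋯)` and the margins `r₀`, `δ₀` only
    ∃ C : ℝ, ∀ (d : ℕ), 1 ≤ d →
    ∀ (Ξ : Type*) [MeasurableSpace Ξ] (P : Measure Ξ) [IsProbabilityMeasure P]
      (f : E d → Ξ → ℝ), IsStochasticLoss α G P f →
    ∀ (Ω : Type*) [MeasurableSpace Ω] (μ : Measure Ω) [IsProbabilityMeasure μ]
      (ξ : ℕ → Ω → Ξ), IsIIDSample P μ ξ →
    -- the decisions and the averaged solution of LightONS with projection routine `proj`
    -- and preconditioner coefficient `e`, and the program that computes the latter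
    let x : ProjRoutine d → ℝ → Ω → ℕ → E d := fun proj e ω =>
      decision proj (gamma' α G k) e k (oracle f fun t => ξ t ω)
    let xbar : ProjRoutine d → ℝ → ℕ → Ω → E d := fun proj e T ω =>
      averaged proj (gamma' α G k) e k (oracle f fun t => ξ t ω) T
    let reg : ProjRoutine d → ℝ → ℕ → Ω → ℝ := fun proj e T ω =>
      regret f (fun t => ξ t ω) (x proj e ω) T
    let approx : ℝ → ProjRoutine d := fun e => approxProj (gamma' α G k) G e k
    let program : ℝ → ℕ → Ω → Timed (E d) := fun e T ω =>
      Timed.lightONS (gamma' α G k) G e k (oracle f fun t => ξ t ω) T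
    -- the program computes the averaged solution
    (∀ e : ℝ, 0 < e → ∀ (T : ℕ) (ω : Ω), (program e T ω).val = xbar (approx e) e T ω) ∧
    -- the regret bound and the high-probability bound for `T` rounds
    (∀ e : ℝ, 0 < e → ∀ T : ℕ, 3 ≤ T →
      (∀ ω, reg exactProj e T ω ≤ regretBound α G e d T) ∧
      (∀ ω, reg (approx e) e T ω ≤ regretBound α G e d T + C₀) ∧
      ∀ proj : ProjRoutine d, proj = exactProj ∨ proj = approx e →
        ∀ δ : ℝ, 0 < δ → δ < 1 →
          ENNReal.ofReal (1 - δ) ≤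
            μ {ω | excessRisk P f (xbar proj e T ω) ≤ riskBound α G δ T (reg proj e T ω)}) ∧
    -- `T = Θ((d / ε) log (d / ε) log (1 / δ))`, preconditioner coefficient `d log T`
    (∀ ε δ : ℝ, 0 < ε → r₀ ≤ d / ε → 0 < δ → δ ≤ δ₀ → ∀ T : ℕ, 3 ≤ T →
      c₁ * (d / ε * Real.log (d / ε) * Real.log (1 / δ)) ≤ T →
      T ≤ c₂ * (d / ε * Real.log (d / ε) * Real.log (1 / δ)) →
      let e : ℝ := d * Real.log T
      (∀ proj : ProjRoutine d, proj = exactProj ∨ proj = approx e →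
        ENNReal.ofReal (1 - δ) ≤
          μ {ω | excessRisk P f (xbar proj e T ω) ≤ riskBound α G δ T (reg proj e T ω) ∧
            riskBound α G δ T (reg proj e T ω) ≤ C * ε}) ∧
      ∀ ω,
        ((program e T ω).time : ℝ) ≤
          C * ((d : ℝ) ^ 3 / ε * Real.log (d / ε) * Real.log (1 / δ)
            + (d : ℝ) ^ (7 / 2 : ℝ) / √ε * Real.log (d / ε) * Real.log (1 / δ)) ∧
        ((program e T ω).time : ℝ) ≤
          C * ((d : ℝ) ^ 3 / ε * Real.log (d / ε) ^ p * Real.log (1 / δ))) ∧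
    -- `T = Θ((d / ε) log (d / ε))`, preconditioner coefficient `d log T`
    (∀ ε : ℝ, 0 < ε → r₀ ≤ d / ε → ∀ T : ℕ, 3 ≤ T →
      c₁ * (d / ε * Real.log (d / ε)) ≤ T → T ≤ c₂ * (d / ε * Real.log (d / ε)) →
      let e : ℝ := d * Real.log T
      (∀ proj : ProjRoutine d, proj = exactProj ∨ proj = approx e →
        Integrable (fun ω => excessRisk P f (xbar proj e T ω)) μ ∧
        ∫ ω, excessRisk P f (xbar proj e T ω) ∂μ ≤ C * ε) ∧
      ∀ ω,
        ((program e T ω).time : ℝ) ≤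
          C * ((d : ℝ) ^ 3 / ε * Real.log (d / ε)
            + (d : ℝ) ^ (7 / 2 : ℝ) / √ε * Real.log (d / ε)) ∧
        ((program e T ω).time : ℝ) ≤ C * ((d : ℝ) ^ 3 / ε * Real.log (d / ε) ^ p)) := by
  have hγ := gamma0_pos hα hG
  rw [gamma'_eq_gamma0 α hG hk hk3]
  set γ := gamma0 α G
  -- One logarithm suffices for the `Õ` bound.
  refine ⟨2 * γ ^ 2, 1, ?_⟩
  intro c₁ c₂ r₀ δ₀ hc₁ hc₁₂ hr₀ hδ₀ hδ₀1
  obtain ⟨K, hK0, hK⟩ := exists_riskBound_le hα hG (2 * γ ^ 2) (by positivity)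
  obtain ⟨Ct, hCt0, hCt⟩ := Timed.exists_lightONS_time_le hγ hG hk
  have hc₂ : 0 < c₂ := hc₁.trans_le hc₁₂
  have hl₀ : 0 < Real.log r₀ := Real.log_pos hr₀
  have hΛ₀ : 0 < Real.log (1 / δ₀) := Real.log_pos (by rw [lt_div_iff₀ hδ₀]; linarith)
  set a := 1 / (c₁ * Real.log (1 / δ₀)) + 1 with ha
  -- The same constant with `log (1 / δ)` replaced by `1`, for the choice of `T` without a
  -- confidence factor.
  set a' := 1 / (c₁ * 1) + 1 with ha'
  set b := 1 / (c₁ * Real.log r₀) with hb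
  have ha0 : 0 ≤ a := by positivity
  have ha'0 : 0 ≤ a' := by positivity
  have hb0 : 0 ≤ b := by positivity
  have hC1 : 0 ≤ K * (a + b) := by positivity
  have hC2 : 0 ≤ K * (2 * a') + 2 * G * b := by positivity
  have hC3 : 0 ≤ Ct * c₂ := by positivity
  have hC : Ct * c₂ ≤ K * (a + b) + (K * (2 * a') + 2 * G * b) + Ct * c₂ := by linarith
  have hC0 : 0 ≤ K * (a + b) + (K * (2 * a') + 2 * G * b) + Ct * c₂ := by linarith
  refine ⟨K * (a + b) + (K * (2 * a') + 2 * G * b) + Ct * c₂, ?_⟩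
  intro d hd Ξ _ P _ f hf Ω _ μ _ ξ hξ x xbar reg approx program
  have hd' : (1 : ℝ) ≤ d := by exact_mod_cast hd
  have hgrad := fun ω => hf.norm_oracle_le fun t => ξ t ω
  have hreg : ∀ e : ℝ, 0 < e → ∀ (T : ℕ) (proj : ProjRoutine d),
      proj = exactProj ∨ proj = approx e → ∀ ω,
      reg proj e T ω ≤ regretBound α G e d T + 2 * γ ^ 2 := by
    rintro e he T proj (rfl | rfl) ω
    · exact (regret_exactProj_le hd hf hα hG hk.le hk3 he _ T).trans
        (le_add_of_nonneg_right (by positivity))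
    · exact regret_approxProj_le hd hf hα hG hk.le hk3 he _ T
  have hprob : ∀ e : ℝ, 0 < e → ∀ T : ℕ, 3 ≤ T → ∀ proj : ProjRoutine d,
      proj = exactProj ∨ proj = approx e → ∀ δ : ℝ, 0 < δ → δ < 1 → ENNReal.ofReal (1 - δ) ≤
        μ {ω | excessRisk P f (xbar proj e T ω) ≤ riskBound α G δ T (reg proj e T ω)} :=
    fun e he T hT proj hproj δ hδ0 hδ1 =>
      excessRisk_le_riskBound hf hα hG hξ (fun t ω => decision_mem _ _ _ _ _ t)
        (fun t => measurable_decision_past hf he hk.le hproj t) hT hδ0 hδ1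
  have he : ∀ T : ℕ, 3 ≤ T → 0 < d * Real.log T := fun T hT =>
    mul_pos (by linarith) (by linarith [one_le_log_of_three_le hT])
  refine ⟨fun e he T ω => Timed.lightONS_val (hgrad ω) hk.le he T,
    fun e he T hT => ⟨fun ω => regret_exactProj_le hd hf hα hG hk.le hk3 he _ T,
      fun ω => hreg e he T _ (Or.inr rfl) ω, hprob e he T hT⟩, ?_, ?_⟩
  · intro ε δ hε hr hδ0 hδ T hT hT1 hT2 e
    have hT0 : (0 : ℝ) < T := by exact_mod_cast (by omega : 0 < T)
    have hΛ : Real.log (1 / δ₀) ≤ Real.log (1 / δ) :=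
      Real.log_le_log (by positivity) (one_div_le_one_div_of_le hδ0 hδ)
    have hΛ' : 0 < Real.log (1 / δ) := hΛ₀.trans_le hΛ
    have hl : 0 < Real.log (d / ε) := hl₀.trans_le (Real.log_le_log (by linarith) hr)
    obtain ⟨h1, h2⟩ := mul_log_le_and_le hc₁ hr₀ hΛ₀ hd hε hr hΛ hT1
    refine ⟨fun proj hproj => ?_, fun ω => ?_⟩
    · refine (hprob e (he T hT) T hT proj hproj δ hδ0 (by linarith)).trans
        (measure_mono fun ω hω => ⟨hω, ?_⟩)
      refine (hK d hd T hT δ hδ0 (by linarith) _ (hreg e (he T hT) T proj hproj ω)).trans ?_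
      calc K * ((d * Real.log T + Real.log (1 / δ)) / T)
          ≤ K * ((a * (T * ε) + b * (T * ε)) / T) := by gcongr
        _ = K * (a + b) * ε := by field_simp
        _ ≤ _ := mul_le_mul_of_nonneg_right (by linarith) hε.le
    · have h3 := time_rate_le hCt0 hε hC (L := Real.log (d / ε) * Real.log (1 / δ))
        (by positivity) (hCt d hd T hT _ (hgrad ω)) (by rw [← mul_assoc (d / ε)]; exact hT2)
      -- The time is already of the order of the first summand; the second is only added.
      have h4 : 0 ≤ (d : ℝ) ^ (7 / 2 : ℝ) / √ε * Real.log (d / ε) * Real.log (1 / δ) := by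
        positivity
      rw [pow_one, mul_assoc ((d : ℝ) ^ 3 / ε)]
      exact ⟨h3.trans (mul_le_mul_of_nonneg_left (by linarith) hC0), h3⟩
  · intro ε hε hr T hT hT1 hT2 e
    have hT0 : (0 : ℝ) < T := by exact_mod_cast (by omega : 0 < T)
    have hT3 : (3 : ℝ) ≤ T := by exact_mod_cast hT
    have hlog := one_le_log_of_three_le hT
    have hl : 0 < Real.log (d / ε) := hl₀.trans_le (Real.log_le_log (by linarith) hr)
    obtain ⟨h1, h2⟩ := mul_log_le_and_le (T := T) (Λ := 1) hc₁ hr₀ one_pos hd hε hr le_rfl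
      (by rwa [mul_one])
    refine ⟨fun proj hproj => ?_, fun ω => ?_⟩
    -- With `δ = 1 / T`, failure contributes at most `2 G / T` to the expectation, and `log (1 / δ)
    -- = log T ≤ d log T` adds no new order.
    · have hδ0 : (0 : ℝ) < 1 / T := by positivity
      have hδ1 : (1 : ℝ) / T < 1 := by rw [div_lt_one hT0]; linarith
      have hex : ∀ ω, 0 ≤ excessRisk P f (xbar proj e T ω) ∧
          excessRisk P f (xbar proj e T ω) ≤ 2 * G := fun ω =>
        excessRisk_nonneg_le hf hα hG (averaged_mem hf hα hG _ _ _ _ _ (by omega))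
      have hb' : ∀ ω, riskBound α G (1 / T) T (reg proj e T ω) ≤ K * (2 * a') * ε := fun ω => by
        refine (hK d hd T hT _ hδ0 hδ1 _ (hreg e (he T hT) T proj hproj ω)).trans ?_
        rw [one_div_one_div]
        calc K * ((d * Real.log T + Real.log T) / T)
            ≤ K * ((a' * (T * ε) + a' * (T * ε)) / T) := by
              gcongr
              nlinarith
          _ = K * (2 * a') * ε := by field_simp; ring
      have h3 := integral_le_of_prob_le (μ := μ) (M := 2 * G) (b := K * (2 * a') * ε) (δ := 1 / T)
        (measurable_excessRisk_averaged hf hα hG hξ (he T hT) hk.le hproj (by omega : 0 < T))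
        (fun ω => (hex ω).1) (fun ω => (hex ω).2) (by positivity)
        ((hprob e (he T hT) T hT proj hproj _ hδ0 hδ1).trans
          (measure_mono fun ω hω => le_trans hω (hb' ω)))
      refine ⟨h3.1, h3.2.trans ?_⟩
      have h4 : 1 / (T : ℝ) ≤ b * ε := by
        rw [div_le_iff₀ hT0]
        linarith
      calc K * (2 * a') * ε + 2 * G * (1 / T) ≤ K * (2 * a') * ε + 2 * G * (b * ε) := by gcongr
        _ = (K * (2 * a') + 2 * G * b) * ε := by ring
        _ ≤ _ := mul_le_mul_of_nonneg_right (by linarith) hε.le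
    · have h3 := time_rate_le hCt0 hε hC (L := Real.log (d / ε)) hl.le
        (hCt d hd T hT _ (hgrad ω)) hT2
      have h4 : 0 ≤ (d : ℝ) ^ (7 / 2 : ℝ) / √ε * Real.log (d / ε) := by positivity
      rw [pow_one]
      exact ⟨h3.trans (mul_le_mul_of_nonneg_left (by linarith) hC0), h3⟩
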